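/- A \emph{Kuga datum} is a mixed Shimura datum $(\mathbf P,\mathbf U,h:Y\to\mathrm{Hom}(\mathbb S_{\mathbb C},\mathbf P_{\mathbb C}))$ in the sense of Pink with $\mathbf U=1$, written $(\mathbf P,Y)$. Explicitly: $\mathbf P$ is a connected linear $\mathbb Q$-group with unipotent radical $\mathbf V$; $Y$ is a homogeneous space under $\mathbf P(\mathbb R)$; $h$ is a $\mathbf P(\mathbb R)$-equivariant map with finite fibers; and the following hold for all $y\in h(Y)$, where $\mathbb S=\mathrm{Res}_{\mathbb C/\mathbb R}\mathbb G_m$: (1) $y$ is defined over $\mathbb R$; (2) $\mathrm{Ad}\circ y$ defines on $\mathrm{Lie}\,\mathbf P$ a mixed Hodge structure with types in $\{(-1,0),(0,-1),(-1,1),(0,0),(1,-1)\}$ and weight filtration $W_{-2}=0$, $W_{-1}=\mathrm{Lie}\,\mathbf V$, $W_0=\mathrm{Lie}\,\mathbf P$; (3) $\mathrm{Int}(y(\mathbf i))$ induces a Cartan involution of $(\mathbf P/\mathbf V)^{\mathrm{ad}}$, which has no compact $\mathbb Q$-factor; (4) the connected center of a Levi $\mathbb Q$-subgroup acts on $\mathbf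 V$ through a $\mathbb Q$-torus isogenous to the product of a compact and a split $\mathbb Q$-torus; (5) no proper $\mathbb Q$-subgroup $\mathbf Q\subsetneq\mathbf P$ satisfies $y(\mathbb S_{\mathbb C})\subset\mathbf Q_{\mathbb C}$ for all $y\in h(Y)$. A \emph{Kuga subdatum} $(\mathbf P',Y')$ of $(\mathbf P,Y)$ is a Kuga datum with $\mathbf P'\subset\mathbf P$ a $\mathbb Q$-subgroup, together with an injective $\mathbf P'(\mathbb R)$-equivariant map $Y'\to Y$ compatible with the maps $h$. Let $(\mathbf P,Y)$ be a Kuga datum with a rational Levi decomposition $\mathbf P=\mathbf V\rtimes_\rho\mathbf G$, where $\rho$ is the conjugation action of $\mathbf G$ on $\mathbf V$ (identified with its Lie algebra), and let $\pi:\mathbf P\to\mathbf G$ be the projection. Fix a $\mathbb Q$-torus $\mathbf C\subset\mathbf G$ and a congruence subgroup $\Gamma$ of $\mathbf P(\mathbb Q)$; it is also allowed that $\Gamma$ is only a congruence subgroup of $\mathbf P(\mathbb Q)\cap\mathbf P(\mathbb R)^+$ or of the stabilizer in $\mathbf P(\mathbb Q)$ of a connected component of $Y$. Put $\Gamma^\dagger=\Gamma\cap\mathbf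 P^{\mathrm{der}}(\mathbb R)^+$ and $\Omega=\Gamma^\dagger\backslash\mathbf P^{\mathrm{der}}(\mathbb R)^+$, with projection $\wp_\Gamma:\mathbf P^{\mathrm{der}}(\mathbb R)^+\to\Omega$, $g\mapsto\Gamma^\dagger g$; here ${}^+$ denotes the identity component for the archimedean topology. Let $\mathcal C$ be the set of all $\mathbb Q$-subgroups $\mathbf P'\subset\mathbf P$ which come from a Kuga subdatum $(\mathbf P',Y')$ of $(\mathbf P,Y)$ that is $\mathbf C$-special, i.e. the connected center of $\pi(\mathbf P')$ equals $\mathbf C$, and $\rho$-rigid, i.e. the representation of $\pi(\mathbf P')^{\mathrm{der}}$ on $\mathbf V$ through $\rho$ has no nonzero trivial subrepresentation over $\mathbb Q$. Then the map $$\mathbf P'\longmapsto\wp_\Gamma\bigl(\mathbf P'^{\mathrm{der}}(\mathbb R)^+\bigr)\subset\Omega$$ from $\mathcal C$ to the set of (lattice) subspaces of $\Omega$ is injective. -/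

import Mathlib

open Matrix

noncomputable section

namespace Kuga

/-! ## Linear algebraic groups over ℚ

A linear `ℚ`-group is a subgroup of some `GL n ℂ` (its group of complex points) which is the zero
locus in `GL n ℂ` of polynomials with rational coefficients in the matrix entries.  As the base
field has characteristic zero, algebraic groups are smooth and nothing is lost by working with
complex points. -/

/-- `A` is the zero locus in `GL n ℂ` of a set of polynomials with coefficients in `k`. -/
def IsZariskiClosed (k : Type) [CommRing k] [Algebra k ℂ] {n : ℕ} (A : Set (GL (Fin n) ℂ)) :
    Prop :=
  ∃ S : Set (MvPolynomial (Fin n × Fin n) k),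
    A = {g | ∀ f ∈ S, MvPolynomial.aeval (fun ij : Fin n × Fin n => g ij.1 ij.2) f = 0}

/-- `H` is (the group of complex points of) a linear `ℚ`-group. -/
def IsQGroup {n : ℕ} (H : Subgroup (GL (Fin n) ℂ)) : Prop :=
  IsZariskiClosed ℚ (H : Set (GL (Fin n) ℂ))

/-- Connectedness for the Zariski topology. -/
def IsZariskiConnected {n : ℕ} (H : Subgroup (GL (Fin n) ℂ)) : Prop :=
  ∀ A B : Set (GL (Fin n) ℂ), IsZariskiClosed ℂ A → IsZariskiClosed ℂ B →
    (H : Set (GL (Fin n) ℂ)) ⊆ A ∪ B → (H : Set (GL (Fin n) ℂ)) ∩ (A ∩ B) = ∅ →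
    (H : Set (GL (Fin n) ℂ)) ⊆ A ∨ (H : Set (GL (Fin n) ℂ)) ⊆ B

/-- `N` is a normal subgroup of `P` (both inside the same `GL n ℂ`). -/
def IsNormalIn {n : ℕ} (N P : Subgroup (GL (Fin n) ℂ)) : Prop :=
  N ≤ P ∧ (N.subgroupOf P).Normal

/-- The identity component: the smallest Zariski closed subgroup of finite index. -/
def identityComponent {n : ℕ} (H : Subgroup (GL (Fin n) ℂ)) : Subgroup (GL (Fin n) ℂ) :=
  sInf {K | K ≤ H ∧ IsZariskiClosed ℂ (K : Set (GL (Fin n) ℂ)) ∧ K.relIndex H ≠ 0}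

/-- The connected center `Z°(H)`. -/
def connectedCenter {n : ℕ} (H : Subgroup (GL (Fin n) ℂ)) : Subgroup (GL (Fin n) ℂ) :=
  identityComponent ((Subgroup.center H).map H.subtype)

/-- The derived group: the smallest `ℚ`-subgroup that contains all commutators. -/
def derivedGroup {n : ℕ} (H : Subgroup (GL (Fin n) ℂ)) : Subgroup (GL (Fin n) ℂ) :=
  sInf {K | IsQGroup K ∧ ⁅H, H⁆ ≤ K}

/-- All elements of `H` are unipotent. -/
def IsUnipotent {n : ℕ} (H : Subgroup (GL (Fin n) ℂ)) : Prop :=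
  ∀ g ∈ H, IsNilpotent ((g : Matrix (Fin n) (Fin n) ℂ) - 1)

/-- `W` is the unipotent radical of `P`: the greatest connected normal unipotent `ℚ`-subgroup. -/
def IsUnipotentRadical {n : ℕ} (P W : Subgroup (GL (Fin n) ℂ)) : Prop :=
  IsGreatest {N | IsQGroup N ∧ IsNormalIn N P ∧ IsZariskiConnected N ∧ IsUnipotent N} W

/-- `G` is a rational Levi subgroup: `P = W ⋊ G` with `W` the unipotent radical of `P`. -/
def IsLevi {n : ℕ} (P W G : Subgroup (GL (Fin n) ℂ)) : Prop :=
  IsQGroup G ∧ G ≤ P ∧ W ⊓ G = ⊥ ∧ W ⊔ G = P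

/-- A `ℚ`-torus: a connected `ℚ`-group which is diagonalizable over `ℂ`. -/
def IsQTorus {n : ℕ} (T : Subgroup (GL (Fin n) ℂ)) : Prop :=
  IsQGroup T ∧ IsZariskiConnected T ∧
    ∃ a : GL (Fin n) ℂ, ∀ t ∈ T, ((a * t * a⁻¹ : GL (Fin n) ℂ) : Matrix (Fin n) (Fin n) ℂ).IsDiag

/-- A `ℚ`-split torus: a connected `ℚ`-group which is diagonalizable over `ℚ`. -/
def IsSplitQTorus {n : ℕ} (T : Subgroup (GL (Fin n) ℂ)) : Prop :=
  IsQGroup T ∧ IsZariskiConnected T ∧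
    ∃ a : GL (Fin n) ℚ, ∀ t ∈ T,
      ((GeneralLinearGroup.map (algebraMap ℚ ℂ) a * t *
        (GeneralLinearGroup.map (algebraMap ℚ ℂ) a)⁻¹ : GL (Fin n) ℂ) : Matrix (Fin n) (Fin n) ℂ).IsDiag

/-- A homomorphism on `H` is algebraic over `ℚ` if its entries are regular functions over `ℚ`:
polynomials in the matrix entries divided by a power of the determinant. -/
def IsQHom {n m : ℕ} {H : Subgroup (GL (Fin n) ℂ)} (φ : H →* GL (Fin m) ℂ) : Prop :=
  ∀ i j, ∃ (k : ℕ) (F : MvPolynomial (Fin n × Fin n) ℚ), ∀ g : H,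
    ((g : GL (Fin n) ℂ) : Matrix (Fin n) (Fin n) ℂ).det ^ k * φ g i j =
      MvPolynomial.aeval (fun ij : Fin n × Fin n => (g : GL (Fin n) ℂ) ij.1 ij.2) F

/-- The Lie algebra of `H`, as the tangent space at the identity inside the `n × n` matrices:
all matrices killed by the differentials at `1` of the polynomials that vanish on `H`. -/
def lieAlgebra {n : ℕ} (H : Subgroup (GL (Fin n) ℂ)) :
    Submodule ℂ (Matrix (Fin n) (Fin n) ℂ) where
  carrier := {X | ∀ f : MvPolynomial (Fin n × Fin n) ℂ,
    (∀ g ∈ H, MvPolynomial.eval (fun ij : Fin n × Fin n => g ij.1 ij.2) f = 0) →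
    ∑ ij : Fin n × Fin n, X ij.1 ij.2 *
      MvPolynomial.eval (fun kl : Fin n × Fin n => (1 : Matrix (Fin n) (Fin n) ℂ) kl.1 kl.2)
        (MvPolynomial.pderiv ij f) = 0}
  zero_mem' := by intro f _; simp
  add_mem' := by
    intro X Y hX hY f hf
    simp only [Matrix.add_apply, add_mul, Finset.sum_add_distrib, hX f hf, hY f hf, add_zero]
  smul_mem' := by
    intro c X hX f hf
    simp only [Matrix.smul_apply, smul_eq_mul, mul_assoc, ← Finset.mul_sum, hX f hf, mul_zero]

/-! ### Points over ℝ and over ℚ -/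

/-- `H(ℝ)`, with the topology induced from `GL n ℝ`. -/
def realPoints {n : ℕ} (H : Subgroup (GL (Fin n) ℂ)) : Subgroup (GL (Fin n) ℝ) :=
  H.comap (GeneralLinearGroup.map (algebraMap ℝ ℂ))

/-- `H(ℚ)`. -/
def rationalPoints {n : ℕ} (H : Subgroup (GL (Fin n) ℂ)) : Subgroup (GL (Fin n) ℚ) :=
  H.comap (GeneralLinearGroup.map (algebraMap ℚ ℂ))

/-- `H(ℝ)⁺`, the identity component of the Lie group `H(ℝ)` (archimedean topology). -/
def realPointsPlus {n : ℕ} (H : Subgroup (GL (Fin n) ℂ)) : Subgroup (GL (Fin n) ℝ) :=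
  (Subgroup.connectedComponentOfOne (realPoints H)).map (realPoints H).subtype

/-- A linear `ℚ`-group is compact if its group of real points is. -/
def IsCompactQGroup {n : ℕ} (H : Subgroup (GL (Fin n) ℂ)) : Prop :=
  IsCompact (realPoints H : Set (GL (Fin n) ℝ))

/-- Complex conjugation on `GL n ℂ`. -/
def conjGL {n : ℕ} : GL (Fin n) ℂ →* GL (Fin n) ℂ :=
  GeneralLinearGroup.map (starRingEnd ℂ)

/-! ## The Deligne torus and Hodge types

`𝕊 = Res_{ℂ/ℝ} 𝔾_m` has complex points `ℂˣ × ℂˣ`, on which complex conjugation acts by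
`(z₁, z₂) ↦ (conj z₂, conj z₁)`, so that `𝕊(ℝ) = {(z, conj z)} = ℂˣ`. -/

/-- `φ` is algebraic: its entries are Laurent polynomials in `z₁, z₂`. -/
def IsAlgebraicHom {n : ℕ} (φ : ℂˣ × ℂˣ →* GL (Fin n) ℂ) : Prop :=
  ∀ i j, ∃ (k : ℕ) (F : MvPolynomial (Fin 2) ℂ), ∀ z : ℂˣ × ℂˣ,
    ((z.1 : ℂ) * (z.2 : ℂ)) ^ k * φ z i j = MvPolynomial.eval ![(z.1 : ℂ), (z.2 : ℂ)] F

/-- `φ` commutes with complex conjugation, i.e. it is defined over `ℝ`. -/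
def IsDefinedOverReals {n : ℕ} (φ : ℂˣ × ℂˣ →* GL (Fin n) ℂ) : Prop :=
  ∀ z₁ z₂ : ℂˣ, φ (star z₂, star z₁) = conjGL (φ (z₁, z₂))

/-- `𝔛(H) = Hom_ℝ(𝕊, H_ℝ)`. -/
def DeligneHom {n : ℕ} (H : Subgroup (GL (Fin n) ℂ)) : Set (ℂˣ × ℂˣ →* GL (Fin n) ℂ) :=
  {φ | IsAlgebraicHom φ ∧ IsDefinedOverReals φ ∧ ∀ z, φ z ∈ H}

/-- The value `φ(𝐢)` at the real point `𝐢` of `𝕊`. -/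
def atI {n : ℕ} (φ : ℂˣ × ℂˣ →* GL (Fin n) ℂ) : GL (Fin n) ℂ :=
  φ (Units.mk0 Complex.I Complex.I_ne_zero, star (Units.mk0 Complex.I Complex.I_ne_zero))

/-- The part of Hodge type `(p, q)` of `Lie P` under `Ad ∘ φ`: the subspace on which
`(z₁, z₂)` acts as `z₁ ^ (-p) * z₂ ^ (-q)`. -/
def hodgePiece {n : ℕ} (P : Subgroup (GL (Fin n) ℂ)) (φ : ℂˣ × ℂˣ →* GL (Fin n) ℂ) (p q : ℤ) :
    Submodule ℂ (Matrix (Fin n) (Fin n) ℂ) :=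
  lieAlgebra P ⊓
  { carrier := {X | ∀ z : ℂˣ × ℂˣ,
      (φ z : Matrix (Fin n) (Fin n) ℂ) * X * ((φ z)⁻¹ : GL (Fin n) ℂ) =
        ((z.1 ^ (-p) * z.2 ^ (-q) : ℂˣ) : ℂ) • X}
    zero_mem' := by intro z; simp
    add_mem' := by
      intro X Y hX hY z
      rw [mul_add, add_mul, hX z, hY z, smul_add]
    smul_mem' := by
      intro c X hX z
      rw [Matrix.mul_smul, Matrix.smul_mul, hX z, smul_comm] }

/-! ## Kuga data -/

/-- The kernel of `P → (P/W)^ad`, i.e. the preimage in `P` of the center of `P/W`. -/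
def adjointKernel {n : ℕ} {P W : Subgroup (GL (Fin n) ℂ)} (hW : IsUnipotentRadical P W) :
    Subgroup P :=
  haveI : (W.subgroupOf P).Normal := hW.1.2.1.2
  (Subgroup.center (P ⧸ W.subgroupOf P)).comap (QuotientGroup.mk' (W.subgroupOf P))

/-- `Int(φ(𝐢))` induces a Cartan involution of `(P/W)^ad`: the corresponding twisted real form
`{g | φ(𝐢) · conj g · φ(𝐢)⁻¹ = g}` of `(P/W)^ad` is compact. -/
def InducesCartanInvolution {n : ℕ} {P W : Subgroup (GL (Fin n) ℂ)}
    (hW : IsUnipotentRadical P W) (φ : ℂˣ × ℂˣ →* GL (Fin n) ℂ) : Prop :=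
  IsCompact ((QuotientGroup.mk : P → P ⧸ adjointKernel hW) ''
    {g : P | ∃ c ∈ adjointKernel hW,
      atI φ * conjGL (g : GL (Fin n) ℂ) * (atI φ)⁻¹ = (g : GL (Fin n) ℂ) * (c : GL (Fin n) ℂ)})

/-- `N` is the preimage in `P` of a non-commutative normal `ℚ`-subgroup of `(P/W)^ad`. -/
def IsNoncommNormalAdjoint {n : ℕ} {P W : Subgroup (GL (Fin n) ℂ)}
    (hW : IsUnipotentRadical P W) (N : Subgroup (GL (Fin n) ℂ)) : Prop :=
  IsQGroup N ∧ IsNormalIn N P ∧ (adjointKernel hW).map P.subtype ≤ N ∧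
    ∃ a ∈ N, ∃ b ∈ N, a * b * a⁻¹ * b⁻¹ ∉ (adjointKernel hW).map P.subtype

/-- `(P/W)^ad` has no compact `ℚ`-factor: for no minimal non-commutative normal `ℚ`-subgroup
of `(P/W)^ad` is the group of real points compact. -/
def NoCompactFactors {n : ℕ} {P W : Subgroup (GL (Fin n) ℂ)}
    (hW : IsUnipotentRadical P W) : Prop :=
  ∀ N, Minimal (IsNoncommNormalAdjoint hW) N →
    ¬ IsCompact ((QuotientGroup.mk : P → P ⧸ adjointKernel hW) ''
      {g : P | (g : GL (Fin n) ℂ) ∈ N ∧ ∃ c ∈ adjointKernel hW,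
        conjGL (g : GL (Fin n) ℂ) = (g : GL (Fin n) ℂ) * (c : GL (Fin n) ℂ)})

/-- The connected center of `G` acts on `W` by conjugation through a `ℚ`-torus which is isogenous
to a product of a compact `ℚ`-torus `A` and a split `ℚ`-torus `S`.  The torus is the image of `φ`,
and the isogeny is the multiplication map `A × S → A · S`. -/
def CenterActsThroughCompactBySplit {n : ℕ} (W G : Subgroup (GL (Fin n) ℂ)) : Prop :=
  ∃ (m : ℕ) (φ : connectedCenter G →* GL (Fin m) ℂ), IsQHom φ ∧
    (∀ c, φ c = 1 ↔ ∀ w ∈ W, (c : GL (Fin n) ℂ) * w * (c : GL (Fin n) ℂ)⁻¹ = w) ∧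
    ∃ A S : Subgroup (GL (Fin m) ℂ), IsQTorus A ∧ IsCompactQGroup A ∧ IsSplitQTorus S ∧
      φ.range = A ⊔ S ∧ ((A ⊓ S : Subgroup (GL (Fin m) ℂ)) : Set (GL (Fin m) ℂ)).Finite

/-- A Kuga datum `(P, Y)`: a mixed Shimura datum `(P, U, h : Y → 𝔜(P))` with `U = 1`.  The
topology and the complex structure of the homogeneous space `Y` are determined by the action
of `P(ℝ)` and by `h`. -/
structure KugaDatum (n : ℕ) where
  /-- the `ℚ`-group -/
  P : Subgroup (GL (Fin n) ℂ)
  isQGroup : IsQGroup P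
  connected : IsZariskiConnected P
  /-- the unipotent radical of `P` -/
  W : Subgroup (GL (Fin n) ℂ)
  isUnipotentRadical : IsUnipotentRadical P W
  /-- the homogeneous space under `P(ℝ)` -/
  Y : Type
  [action : MulAction (realPoints P) Y]
  nonempty : Nonempty Y
  transitive : ∀ y₁ y₂ : Y, ∃ g : realPoints P, g • y₁ = y₂
  /-- the equivariant map with finite fibers -/
  h : Y → (ℂˣ × ℂˣ →* GL (Fin n) ℂ)
  equivariant : ∀ (g : realPoints P) (y : Y) (z : ℂˣ × ℂˣ),
    h (g • y) z = GeneralLinearGroup.map (algebraMap ℝ ℂ) (g : GL (Fin n) ℝ) * h y z *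
      (GeneralLinearGroup.map (algebraMap ℝ ℂ) (g : GL (Fin n) ℝ))⁻¹
  finite_fibers : ∀ φ, {y | h y = φ}.Finite
  /-- every `h y` is a homomorphism `𝕊_ℂ → P_ℂ` which is defined over `ℝ` -/
  real : ∀ y, h y ∈ DeligneHom P
  /-- the Hodge types that occur in `Lie P` -/
  hodge_types : ∀ y, lieAlgebra P =
    hodgePiece P (h y) (-1) 0 ⊔ hodgePiece P (h y) 0 (-1) ⊔
      hodgePiece P (h y) (-1) 1 ⊔ hodgePiece P (h y) 0 0 ⊔ hodgePiece P (h y) 1 (-1)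
  /-- the weight filtration: `W₋₁ = Lie W` (and `W₋₂ = 0`, `W₀ = Lie P`) -/
  weight : ∀ y, lieAlgebra W = hodgePiece P (h y) (-1) 0 ⊔ hodgePiece P (h y) 0 (-1)
  cartan : ∀ y, InducesCartanInvolution isUnipotentRadical (h y)
  no_compact_factors : NoCompactFactors isUnipotentRadical
  center_action : ∀ G, IsLevi P W G → CenterActsThroughCompactBySplit W G
  /-- irreducibility: `P` is the Mumford-Tate group of `Y` -/
  irreducible : ∀ Q, IsQGroup Q → Q ≤ P → (∀ y z, h y z ∈ Q) → Q = P

attribute [instance] KugaDatum.action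

/-- `D'` is a Kuga subdatum of `D`: `P' ⊆ P`, and there is an injective map `Y' → Y`, equivariant
for `P'(ℝ) ⊆ P(ℝ)` and compatible with the maps to `𝔜(P') → 𝔜(P)`. -/
def IsSubdatum {n : ℕ} (D' D : KugaDatum n) : Prop :=
  ∃ hP : D'.P ≤ D.P, ∃ f : D'.Y → D.Y, Function.Injective f ∧
    (∀ (g : realPoints D'.P) (y : D'.Y),
      f (g • y) = (⟨g.1, hP g.2⟩ : realPoints D.P) • f y) ∧
    ∀ y, D.h (f y) = D'.h y

/-! ## `C`-special and `ρ`-rigid subgroups -/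

/-- The image `π(P')` of a subgroup `P'` of `P = W ⋊ G` under the projection `π : P → G`. -/
def leviProjection {n : ℕ} (W G P' : Subgroup (GL (Fin n) ℂ)) : Subgroup (GL (Fin n) ℂ) :=
  (P' ⊔ W) ⊓ G

/-- In a Levi decomposition `P = W ⋊ G`, the subgroup `leviProjection W G P'` consists of all
`g ∈ G` such that `w * g ∈ P'` for some `w ∈ W`. -/
theorem mem_leviProjection {n : ℕ} {P W G P' : Subgroup (GL (Fin n) ℂ)}
    (hW : IsUnipotentRadical P W) (hP' : P' ≤ P) (g : GL (Fin n) ℂ) :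
    g ∈ leviProjection W G P' ↔ g ∈ G ∧ ∃ w ∈ W, w * g ∈ P' := by
  have hN : ∀ p ∈ P, ∀ w ∈ W, p * w * p⁻¹ ∈ W := by
    intro p hp w hw
    have h := hW.1.2.1.2.conj_mem ⟨w, hW.1.2.1.1 hw⟩ (by simpa [Subgroup.mem_subgroupOf] using hw)
      ⟨p, hp⟩
    simpa [Subgroup.mem_subgroupOf] using h
  constructor
  · rintro ⟨h1, h2⟩
    refine ⟨h2, ?_⟩
    have key : ∀ x ∈ P' ⊔ W, x ∈ P ∧ ∃ w ∈ W, w * x ∈ P' := by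
      intro x hx
      rw [Subgroup.sup_eq_closure] at hx
      induction hx using Subgroup.closure_induction with
      | mem x hx =>
        rcases hx with hx | hx
        · exact ⟨hP' hx, 1, W.one_mem, by simpa using hx⟩
        · exact ⟨hW.1.2.1.1 hx, x⁻¹, W.inv_mem hx, by simp⟩
      | one => exact ⟨P.one_mem, 1, W.one_mem, by simp⟩
      | mul x y _ _ hx hy =>
        obtain ⟨hxP, w, hw, hwx⟩ := hx
        obtain ⟨hyP, v, hv, hvy⟩ := hy
        refine ⟨P.mul_mem hxP hyP, w * (x * v * x⁻¹), W.mul_mem hw (hN x hxP v hv), ?_⟩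
        have : w * (x * v * x⁻¹) * (x * y) = (w * x) * (v * y) := by group
        rw [this]
        exact P'.mul_mem hwx hvy
      | inv x _ hx =>
        obtain ⟨hxP, w, hw, hwx⟩ := hx
        refine ⟨P.inv_mem hxP, x⁻¹ * w⁻¹ * x, ?_, ?_⟩
        · simpa using hN x⁻¹ (P.inv_mem hxP) w⁻¹ (W.inv_mem hw)
        · have : x⁻¹ * w⁻¹ * x * x⁻¹ = (w * x)⁻¹ := by group
          rw [this]
          exact P'.inv_mem hwx
    exact (key g h1).2
  · rintro ⟨h2, w, hw, hwg⟩
    refine ⟨?_, h2⟩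
    have : g = w⁻¹ * (w * g) := by group
    rw [this]
    exact Subgroup.mul_mem _ (Subgroup.mem_sup_right (W.inv_mem hw)) (Subgroup.mem_sup_left hwg)

/-- `G'` is `ρ`-rigid, where `ρ` is the conjugation action on the rational vector space
`V = Lie W` (over `ℚ`): the restriction of `ρ` to the derived group of `G'` admits no nonzero
trivial subrepresentation `U ⊆ V`. -/
def IsRhoRigid {n : ℕ} (W G' : Subgroup (GL (Fin n) ℂ)) : Prop :=
  ∀ U : Submodule ℚ (Matrix (Fin n) (Fin n) ℚ),
    (∀ X ∈ U, X.map (algebraMap ℚ ℂ) ∈ lieAlgebra W) →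
    (∀ X ∈ U, ∀ g ∈ derivedGroup G',
      (g : Matrix (Fin n) (Fin n) ℂ) * X.map (algebraMap ℚ ℂ) * (g⁻¹ : GL (Fin n) ℂ) =
        X.map (algebraMap ℚ ℂ)) →
    U = ⊥

/-- The set of `ℚ`-subgroups `P'` of `P = W ⋊ G` that come from Kuga subdata `(P', Y')` of
`(P, Y)` which are `C`-special (the connected center of `π(P')` is `C`) and `ρ`-rigid. -/
def rigidSpecialSubgroups {n : ℕ} (D : KugaDatum n) (G C : Subgroup (GL (Fin n) ℂ)) :
    Set (Subgroup (GL (Fin n) ℂ)) :=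
  {P' | ∃ D' : KugaDatum n, IsSubdatum D' D ∧ D'.P = P' ∧
    connectedCenter (leviProjection D.W G P') = C ∧ IsRhoRigid D.W (leviProjection D.W G P')}

/-! ## Lattice spaces -/

/-- The subgroup of all `g ∈ P(ℚ) ∩ P(ℝ)⁺` that are integral with integral inverse and congruent
to `1` modulo `N`. -/
def principalCongruence {n : ℕ} (P : Subgroup (GL (Fin n) ℂ)) (N : ℕ) : Subgroup (GL (Fin n) ℚ) :=
  rationalPoints P ⊓ (realPointsPlus P).comap (GeneralLinearGroup.map (algebraMap ℚ ℝ)) ⊓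
    (GeneralLinearGroup.map (n := Fin n) (Int.castRingHom (ZMod N))).ker.map
      (GeneralLinearGroup.map (Int.castRingHom ℚ))

/-- Congruence subgroups: subgroups of `P(ℚ)` that contain a principal one with finite index.
As `P(ℝ)⁺` has finite index in `P(ℝ)`, this includes the congruence subgroups of `P(ℚ)`, and
those of the stabilizer of a component of `Y` and of `P(ℚ) ∩ P(ℝ)⁺`. -/
def IsCongruenceSubgroup {n : ℕ} (P : Subgroup (GL (Fin n) ℂ)) (Γ : Subgroup (GL (Fin n) ℚ)) :
    Prop :=
  Γ ≤ rationalPoints P ∧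
    ∃ N : ℕ, 0 < N ∧ principalCongruence P N ≤ Γ ∧ (principalCongruence P N).relIndex Γ ≠ 0

/-- `Γ† = Γ ∩ P^der(ℝ)⁺`, as a subgroup of `P^der(ℝ)⁺`. -/
def gammaDagger {n : ℕ} (P : Subgroup (GL (Fin n) ℂ)) (Γ : Subgroup (GL (Fin n) ℚ)) :
    Subgroup (realPointsPlus (derivedGroup P)) :=
  (Γ.map (GeneralLinearGroup.map (algebraMap ℚ ℝ))).subgroupOf (realPointsPlus (derivedGroup P))

/-- The lattice space `Ω = Γ† \ P^der(ℝ)⁺` (the set of cosets `Γ† g`). -/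
def LatticeSpace {n : ℕ} (P : Subgroup (GL (Fin n) ℂ)) (Γ : Subgroup (GL (Fin n) ℚ)) : Type :=
  Quotient (QuotientGroup.rightRel (gammaDagger P Γ))

/-- The uniformization map `℘_Γ : P^der(ℝ)⁺ → Ω`, `g ↦ Γ† g`. -/
def uniformization {n : ℕ} (P : Subgroup (GL (Fin n) ℂ)) (Γ : Subgroup (GL (Fin n) ℚ))
    (g : realPointsPlus (derivedGroup P)) : LatticeSpace P Γ :=
  Quotient.mk (QuotientGroup.rightRel (gammaDagger P Γ)) g

/-- The lattice subspace `℘_Γ(P'^der(ℝ)⁺)` of `Ω` given by a subgroup `P'` of `P`. -/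
def latticeSubspace {n : ℕ} (P : Subgroup (GL (Fin n) ℂ)) (Γ : Subgroup (GL (Fin n) ℚ))
    (P' : Subgroup (GL (Fin n) ℂ)) : Set (LatticeSpace P Γ) :=
  uniformization P Γ '' {g | (g : GL (Fin n) ℝ) ∈ realPointsPlus (derivedGroup P')}

end Kuga

end

/-! ### Polynomials on matrix space, Lie algebras and one-parameter groups -/

open Matrix
noncomputable section
namespace Kuga
open scoped Matrix.Norms.Operator Topology
open NormedSpace Filter

/-! Let `P₁`, `P₂` be two of the subgroups, with unipotent radicals `W₁`, `W₂`, and suppose that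
they define the same lattice subspace. By symmetry it suffices that `P₁ ≤ P₂`, and since `P₁` is
connected it suffices that `Lie P₁ ⊆ Lie P₂` (`le_of_expGL_mem`).

The group `Γ` is countable, so a real one-parameter group in the derived group of `P₁` is covered by
countably many translates of the derived group of `P₂`. By Baire's theorem it lies in that group,
hence the two derived groups have the same Lie algebra (`lieAlgebra_derivedGroup_le`).

A point `y` of a Kuga datum gives the weight cocharacter `t ↦ h y (t, t)`. It acts on `Lie W` with
weight 1 and on a complement with weight 0, so `Lie W` is commutative and the centralizer of the
cocharacter is a Levi subgroup. It follows that `Lie Wᵢ` is the intersection of `Lie W` with the Lie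
algebra of the derived group of `Pᵢ` (`mem_lieW_iff_derivedGroup`), so `Lie W₁ = Lie W₂`. Let `L₁`
be the Levi subgroup of `P₁` given by a point of `Y₁`. The Cartan involution provides a compact real
form of `Lie L₁` (`KugaDatum.exists_compactForm`), so `Lie L₁` is the sum of its center and its
derived algebra `k`. As `k` lies in the Lie algebra of the derived group, it is contained in `Lie
P₂`, and only central elements `Z` of `Lie L₁` remain.

Since both groups are `C`-special, `exp (t Z)` lies in `C W ⊆ P₂ W`, so `Z = u + X₂` with `u ∈ Lie
W` and `X₂ ∈ Lie P₂`. For `X ∈ k` one has `[X, Z] = 0`, hence `[X, u] = -[X, X₂]` lies in `Lie W`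
and in the Lie algebra of the derived group, that is, in `Lie W₁`. Rigidity says that `k` has no
invariants in `Lie W` (`eq_zero_of_comm_derivedLie`). The Casimir operator of `k` is therefore
invertible on `Lie W`, which forces `u ∈ Lie W₁ = Lie W₂` (`mem_of_forall_bracket_mem`), and `Z ∈
Lie P₂`. This is `le_of_lieAlgebra_derivedGroup_eq`.

Two translations support the argument. Rigidity is a statement over `ℚ` about an algebraic group: it
is brought to `ℂ` by descent along field automorphisms (`eq_zero_of_isRhoRigid`), and to Lie
algebras by showing that a connected group acts on the invariants of its derived algebra through
commuting operators (`Ad_comm_of_derivedLie`). Zariski connectedness is linked to exponentials by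
the closed subgroup theorem, which yields countable index, and by the uncountability of `ℂ`, which
excludes a nontrivial countable index. -/

/-- Complex square matrices of size `n`. -/
abbrev Mat (n : ℕ) := Matrix (Fin n) (Fin n) ℂ

/-- Polynomials in the matrix entries. -/
abbrev MatPoly (n : ℕ) := MvPolynomial (Fin n × Fin n) ℂ

/-- Evaluation of a polynomial in the matrix entries at a matrix. -/
def ev {n : ℕ} (f : MatPoly n) (A : Mat n) : ℂ :=
  MvPolynomial.eval (fun ij : Fin n × Fin n => A ij.1 ij.2) f

/-- Polynomials vanishing on a set of invertible matrices. -/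
def VanishesOn {n : ℕ} (f : MatPoly n) (H : Set (GL (Fin n) ℂ)) : Prop :=
  ∀ g ∈ H, ev f (g : Mat n) = 0

/-- Replaces chosen equations by the full vanishing ideal, so that closedness can be used without
carrying equations along. -/
theorem isZariskiClosed_iff {n : ℕ} {A : Set (GL (Fin n) ℂ)} :
    IsZariskiClosed ℂ A ↔
      ∀ g : GL (Fin n) ℂ, (∀ f : MatPoly n, VanishesOn f A → ev f (g : Mat n) = 0) → g ∈ A := by
  constructor
  · rintro ⟨S, hS⟩ g hg
    rw [hS]
    intro f hf
    have := hg f (fun a ha => by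
      rw [hS] at ha
      simpa [ev, MvPolynomial.coe_aeval_eq_eval] using ha f hf)
    simpa [ev, MvPolynomial.coe_aeval_eq_eval] using this
  · intro h
    refine ⟨{f | VanishesOn f A}, Set.Subset.antisymm ?_ ?_⟩
    · intro g hg f hf
      simpa [ev] using hf g hg
    · intro g hg
      refine h g fun f hf => ?_
      simpa [ev, MvPolynomial.coe_aeval_eq_eval] using hg f hf

theorem isZariskiClosed_setOf {n : ℕ} (S : Set (MatPoly n)) :
    IsZariskiClosed ℂ {g : GL (Fin n) ℂ | ∀ f ∈ S, ev f (g : Mat n) = 0} :=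
  ⟨S, by ext g; simp [ev]⟩

theorem IsZariskiClosed.inter {n : ℕ} {A B : Set (GL (Fin n) ℂ)}
    (hA : IsZariskiClosed ℂ A) (hB : IsZariskiClosed ℂ B) : IsZariskiClosed ℂ (A ∩ B) := by
  obtain ⟨S, rfl⟩ := hA
  obtain ⟨T, rfl⟩ := hB
  refine ⟨S ∪ T, ?_⟩
  ext g
  simp only [Set.mem_inter_iff, Set.mem_ofPred_eq, Set.mem_union]
  exact ⟨fun h f hf => hf.elim (h.1 f) (h.2 f), fun h => ⟨fun f hf => h f (Or.inl hf),
    fun f hf => h f (Or.inr hf)⟩⟩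

theorem isZariskiClosed_of_rat {n : ℕ} {A : Set (GL (Fin n) ℂ)} (hA : IsZariskiClosed ℚ A) :
    IsZariskiClosed ℂ A := by
  obtain ⟨S, rfl⟩ := hA
  refine ⟨MvPolynomial.map (algebraMap ℚ ℂ) '' S, ?_⟩
  ext g
  simp only [Set.mem_ofPred_eq, Set.forall_mem_image, MvPolynomial.aeval_map_algebraMap]

theorem IsQGroup.isClosed {n : ℕ} {H : Subgroup (GL (Fin n) ℂ)} (h : IsQGroup H) :
    IsZariskiClosed ℂ (H : Set (GL (Fin n) ℂ)) :=
  isZariskiClosed_of_rat h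

/-- A polynomial map between spaces of matrices. -/
theorem ev_bind {n m : ℕ} (f : MatPoly m) (F : Fin m × Fin m → MatPoly n) (A : Mat n) :
    ev (MvPolynomial.bind₁ F f) A = ev f (Matrix.of fun i j => ev (F (i, j)) A) := by
  simp only [ev, Matrix.of_apply, MvPolynomial.eval, MvPolynomial.eval₂Hom_bind₁]

theorem continuous_ev {n : ℕ} (f : MatPoly n) : Continuous (ev f) := by
  unfold ev
  refine (MvPolynomial.continuous_eval f).comp ?_
  fun_prop

/-- The chain rule for polynomials. The field of the time variable is left open because curves with
real and with complex time both occur. -/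
theorem hasDerivAt_ev {𝕜 : Type*} [NontriviallyNormedField 𝕜] [NormedAlgebra 𝕜 ℂ] {n : ℕ}
    (f : MatPoly n) {γ : 𝕜 → Mat n} {γ' : Mat n} {t : 𝕜}
    (h : ∀ i j, HasDerivAt (fun s => γ s i j) (γ' i j) t) :
    HasDerivAt (fun s => ev f (γ s))
      (∑ ij : Fin n × Fin n, γ' ij.1 ij.2 * ev (MvPolynomial.pderiv ij f) (γ t)) t := by
  induction f using MvPolynomial.induction_on with
  | C a => simpa [ev] using hasDerivAt_const t a
  | add p q hp hq =>
    have := hp.add hq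
    simp only [ev, map_add, mul_add, Finset.sum_add_distrib] at this ⊢
    exact this
  | mul_X p kl hp =>
    have := hp.mul (h kl.1 kl.2)
    simp only [ev, map_mul, MvPolynomial.eval_X, Derivation.leibniz, MvPolynomial.pderiv_X,
      smul_eq_mul, map_add] at this ⊢
    refine this.congr_deriv ?_
    simp only [mul_add, Finset.sum_add_distrib]
    rw [add_comm]
    congr 1
    · rw [Finset.sum_eq_single kl]
      · simp [mul_comm]
      · intro b _ hb
        simp [hb.symm]
      · simp
    · rw [Finset.sum_mul]
      refine Finset.sum_congr rfl fun ij _ => ?_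
      ring

theorem hasDerivAt_matrix_apply {𝕜 : Type*} [NontriviallyNormedField 𝕜] [NormedAlgebra 𝕜 ℂ] {n : ℕ}
    {γ : 𝕜 → Mat n} {γ' : Mat n} {t : 𝕜} (h : HasDerivAt γ γ' t) (i j : Fin n) :
    HasDerivAt (fun s => γ s i j) (γ' i j) t := by
  let L : Mat n →L[𝕜] ℂ := 
    { toFun := fun A => A i j
      map_add' := fun _ _ => rfl
      map_smul' := fun _ _ => rfl
      cont := by fun_prop }
  exact L.hasFDerivAt.comp_hasDerivAt t h

theorem mem_lieAlgebra {n : ℕ} {H : Subgroup (GL (Fin n) ℂ)} {X : Mat n} :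
    X ∈ lieAlgebra H ↔ ∀ f : MatPoly n, VanishesOn f (H : Set (GL (Fin n) ℂ)) →
      ∑ ij : Fin n × Fin n, X ij.1 ij.2 * ev (MvPolynomial.pderiv ij f) 1 = 0 :=
  Iff.rfl

/-- Velocities of curves in `H` that start at `1` belong to the Lie algebra. -/
theorem mem_lieAlgebra_of_hasDerivAt {𝕜 : Type*} [NontriviallyNormedField 𝕜] [NormedAlgebra 𝕜 ℂ]
    {n : ℕ} {H : Subgroup (GL (Fin n) ℂ)} {γ : 𝕜 → Mat n} {X : Mat n} (h : HasDerivAt γ X 0)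
    (h1 : γ 0 = 1)
    (hH : ∀ t, ∀ f : MatPoly n, VanishesOn f (H : Set (GL (Fin n) ℂ)) → ev f (γ t) = 0) :
    X ∈ lieAlgebra H := by
  rw [mem_lieAlgebra]
  intro f hf
  have h2 := hasDerivAt_ev f (hasDerivAt_matrix_apply h)
  rw [h1] at h2
  have h3 : (fun s => ev f (γ s)) = fun _ => 0 := funext fun t => hH t f hf
  rw [h3] at h2
  exact h2.unique (hasDerivAt_const 0 0)

/-- The exponential as an invertible matrix. -/
def expGL {n : ℕ} (X : Mat n) : GL (Fin n) ℂ where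
  val := exp X
  inv := exp (-X)
  val_inv := by
    rw [← Matrix.exp_add_of_commute _ _ (Commute.neg_right (Commute.refl X))]; simp
  inv_val := by
    rw [← Matrix.exp_add_of_commute _ _ (Commute.neg_left (Commute.refl X))]; simp

@[simp] theorem coe_expGL {n : ℕ} (X : Mat n) : (expGL X : Mat n) = exp X := rfl

@[simp] theorem coe_expGL_inv {n : ℕ} (X : Mat n) :
    ((expGL X)⁻¹ : GL (Fin n) ℂ).val = exp (-X) := rfl

theorem expGL_add {n : ℕ} {X Y : Mat n} (h : Commute X Y) :
    expGL (X + Y) = expGL X * expGL Y :=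
  Units.ext (Matrix.exp_add_of_commute _ _ h)

theorem expGL_add_smul {n : ℕ} (X : Mat n) (s t : ℂ) :
    expGL ((s + t) • X) = expGL (s • X) * expGL (t • X) := by
  rw [add_smul, expGL_add]
  exact ((Commute.refl X).smul_left s).smul_right t

@[simp] theorem expGL_zero {n : ℕ} : expGL (0 : Mat n) = 1 := Units.ext (by simp)

theorem expGL_neg {n : ℕ} (X : Mat n) : expGL (-X) = (expGL X)⁻¹ :=
  Units.ext rfl

theorem expGL_nsmul {n : ℕ} (k : ℕ) (X : Mat n) : expGL ((k : ℂ) • X) = expGL X ^ k := by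
  induction k with
  | zero => simp
  | succ k ih =>
    push_cast
    rw [expGL_add_smul, ih, one_smul, pow_succ]

theorem hasDerivAt_exp_smul {n : ℕ} (X : Mat n) (t : ℂ) :
    HasDerivAt (fun t : ℂ => exp (t • X)) (exp (t • X) * X) t :=
  hasDerivAt_exp_smul_const X t

theorem hasDerivAt_exp_real_smul {n : ℕ} (X : Mat n) (t : ℝ) :
    HasDerivAt (fun t : ℝ => exp ((t : ℂ) • X)) (exp ((t : ℂ) • X) * X) t := by
  have := (hasDerivAt_exp_smul X (t : ℂ)).scomp_of_eq t (Complex.ofRealCLM.hasDerivAt) rfl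
  exact this.congr_deriv (by simp)

/-- The derivation of the polynomial ring given by the right translations along `X`. -/
def rightDeriv {n : ℕ} (X : Mat n) (f : MatPoly n) : MatPoly n :=
  ∑ ij : Fin n × Fin n, (∑ k, MvPolynomial.X (ij.1, k) * MvPolynomial.C (X k ij.2)) *
    MvPolynomial.pderiv ij f

theorem ev_rightDeriv {n : ℕ} (X : Mat n) (f : MatPoly n) (A : Mat n) :
    ev (rightDeriv X f) A =
      ∑ ij : Fin n × Fin n, (A * X) ij.1 ij.2 * ev (MvPolynomial.pderiv ij f) A := by
  simp [ev, rightDeriv, Matrix.mul_apply]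

/-- For `h ∈ H` the translate `f (h ·)` vanishes on `H` as well, and its differential at `1` along
`X` is the value of `rightDeriv X f` at `h`. -/
theorem vanishesOn_rightDeriv {n : ℕ} {H : Subgroup (GL (Fin n) ℂ)} {X : Mat n}
    (hX : X ∈ lieAlgebra H) {f : MatPoly n} (hf : VanishesOn f (H : Set (GL (Fin n) ℂ))) :
    VanishesOn (rightDeriv X f) (H : Set (GL (Fin n) ℂ)) := by
  intro h hh
  let F : Fin n × Fin n → MatPoly n := fun ij =>
    ∑ k, MvPolynomial.C ((h : Mat n) ij.1 k) * MvPolynomial.X (k, ij.2)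
  have hF : ∀ A : Mat n, ev (MvPolynomial.bind₁ F f) A = ev f ((h : Mat n) * A) := by
    intro A
    rw [ev_bind]
    congr 1
    ext i j
    simp [F, ev, Matrix.mul_apply]
  have hvan : VanishesOn (MvPolynomial.bind₁ F f) (H : Set (GL (Fin n) ℂ)) := by
    intro g hg
    rw [hF]
    exact hf (h * g) (H.mul_mem hh hg)
  have h0 := mem_lieAlgebra.1 hX _ hvan
  have hd : HasDerivAt (fun t : ℂ => (1 : Mat n) + t • X) X 0 := by
    exact (((hasDerivAt_id (0 : ℂ)).smul_const X).const_add (1 : Mat n)).congr_deriv (by simp)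
  have e1 := hasDerivAt_ev (MvPolynomial.bind₁ F f) (hasDerivAt_matrix_apply hd)
  have e2 := hasDerivAt_ev f (hasDerivAt_matrix_apply (hd.const_mul (h : Mat n)))
  simp only [hF] at e1
  have := e1.unique e2
  simp only [zero_smul, add_zero, mul_one] at this
  rw [ev_rightDeriv, ← this, h0]

/-- For `f` vanishing on `H`, the derivatives of the entire function `t ↦ f (exp (t X))` are
obtained by iterating `rightDeriv X` on `f`. The iterates still vanish at `1`, so the Taylor series
at `0` is zero. -/
theorem expGL_smul_mem {n : ℕ} {H : Subgroup (GL (Fin n) ℂ)}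
    (hH : IsZariskiClosed ℂ (H : Set (GL (Fin n) ℂ))) {X : Mat n} (hX : X ∈ lieAlgebra H) (t : ℂ) :
    expGL (t • X) ∈ H := by
  refine isZariskiClosed_iff.1 hH _ fun f hf => ?_
  have hder : ∀ (f : MatPoly n) (t : ℂ), HasDerivAt (fun s : ℂ => ev f (exp (s • X)))
      (ev (rightDeriv X f) (exp (t • X))) t := by
    intro f t
    rw [ev_rightDeriv]
    exact hasDerivAt_ev f (hasDerivAt_matrix_apply (hasDerivAt_exp_smul X t))
  have hiter : ∀ (k : ℕ) (f : MatPoly n), VanishesOn f (H : Set (GL (Fin n) ℂ)) →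
      iteratedDeriv k (fun s : ℂ => ev f (exp (s • X))) 0 = 0 := by
    intro k
    induction k with
    | zero =>
      intro f hf
      simpa using hf 1 H.one_mem
    | succ k ih =>
      intro f hf
      rw [iteratedDeriv_succ']
      have : deriv (fun s : ℂ => ev f (exp (s • X))) =
          fun s : ℂ => ev (rightDeriv X f) (exp (s • X)) := funext fun t => (hder f t).deriv
      rw [this]
      exact ih _ (vanishesOn_rightDeriv hX hf)
  have := Complex.taylorSeries_eq_of_entire' 0 t (f := fun s : ℂ => ev f (exp (s • X)))
    (fun t => (hder f t).differentiableAt)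
  simp only [hiter _ f hf, mul_zero, zero_mul, tsum_zero] at this
  exact this.symm

theorem expGL_mem {n : ℕ} {H : Subgroup (GL (Fin n) ℂ)}
    (hH : IsZariskiClosed ℂ (H : Set (GL (Fin n) ℂ))) {X : Mat n} (hX : X ∈ lieAlgebra H) :
    expGL X ∈ H := by
  simpa using expGL_smul_mem hH hX 1

/-- Real times suffice, which is what limit and Baire arguments can deliver. -/
theorem mem_lieAlgebra_of_expGL {n : ℕ} {H : Subgroup (GL (Fin n) ℂ)} {X : Mat n}
    (h : ∀ t : ℝ, expGL ((t : ℂ) • X) ∈ H) : X ∈ lieAlgebra H := by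
  refine mem_lieAlgebra_of_hasDerivAt (γ := fun t : ℝ => exp ((t : ℂ) • X)) ?_ (by simp)
    fun t f hf => hf (expGL ((t : ℂ) • X)) (h t)
  simpa using hasDerivAt_exp_real_smul X 0

theorem lieAlgebra_mono {n : ℕ} {H K : Subgroup (GL (Fin n) ℂ)} (h : H ≤ K) :
    lieAlgebra H ≤ lieAlgebra K :=
  fun _ hX => mem_lieAlgebra.2 fun f hf => mem_lieAlgebra.1 hX f fun g hg => hf g (h hg)

theorem conj_mem_lieAlgebra {n : ℕ} {H : Subgroup (GL (Fin n) ℂ)}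
    (hH : IsZariskiClosed ℂ (H : Set (GL (Fin n) ℂ))) {g : GL (Fin n) ℂ}
    (hg : ∀ x ∈ H, g * x * g⁻¹ ∈ H) {X : Mat n} (hX : X ∈ lieAlgebra H) :
    (g : Mat n) * X * (g⁻¹ : GL (Fin n) ℂ) ∈ lieAlgebra H := by
  refine mem_lieAlgebra_of_expGL fun t => ?_
  have := hg _ (expGL_smul_mem hH hX t)
  have h : expGL ((t : ℂ) • ((g : Mat n) * X * ((g⁻¹ : GL (Fin n) ℂ) : Mat n))) =
      g * expGL ((t : ℂ) • X) * g⁻¹ := by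
    refine Units.ext ?_
    simp only [coe_expGL, Units.val_mul]
    rw [← Matrix.exp_units_conj g ((t : ℂ) • X), Matrix.mul_smul, Matrix.smul_mul]
  rw [h]
  exact this

/-- A curve argument: `g ↦ g Y g⁻¹ - Y` differentiates to the Lie bracket. -/
theorem hasDerivAt_conj_exp {n : ℕ} (X Y : Mat n) :
    HasDerivAt (fun t : ℂ => exp (t • X) * Y * exp (-(t • X))) (X * Y - Y * X) 0 := by
  have h1 := hasDerivAt_exp_smul X 0
  have h2 := hasDerivAt_exp_smul (-X) 0
  have := (h1.mul_const Y).mul h2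
  simp only [smul_neg] at this
  exact this.congr_deriv (by simp [sub_eq_add_neg])

theorem mem_submodule_of_hasDerivAt {n : ℕ} {S : Submodule ℂ (Mat n)} {γ : ℂ → Mat n} {X : Mat n}
    (h : HasDerivAt γ X 0) (hS : ∀ t, γ t ∈ S) : X ∈ S := by
  have hc : IsClosed (S : Set (Mat n)) := S.closed_of_finiteDimensional
  have h1 := h.tendsto_slope_zero
  refine hc.mem_of_tendsto h1 (Eventually.of_forall fun t => ?_)
  exact S.smul_mem _ (S.sub_mem (hS _) (hS _))

/-- If a closed group contains all commutators of elements of `H`, its Lie algebra contains all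
brackets of elements of `Lie H`. -/
theorem bracket_mem_lieAlgebra_of_commutator {n : ℕ} {H K : Subgroup (GL (Fin n) ℂ)}
    (hH : IsZariskiClosed ℂ (H : Set (GL (Fin n) ℂ))) (hc : ⁅H, H⁆ ≤ K) {X Y : Mat n}
    (hX : X ∈ lieAlgebra H) (hY : Y ∈ lieAlgebra H) : X * Y - Y * X ∈ lieAlgebra K := by
  -- The group commutator of `exp (t X)` and `exp (s Y)` is differentiated first in `s`, which gives
  -- this element, and then in `t`, which gives the bracket.
  have key : ∀ t : ℂ, exp (t • X) * Y * exp (-(t • X)) - Y ∈ lieAlgebra K := by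
    intro t
    refine mem_lieAlgebra_of_hasDerivAt
      (γ := fun s : ℂ => exp (t • X) * exp (s • Y) * exp (-(t • X)) * exp (-(s • Y))) ?_ ?_ ?_
    · have h1 := ((hasDerivAt_exp_smul Y 0).const_mul (exp (t • X))).mul_const (exp (-(t • X)))
      have h2 := hasDerivAt_exp_smul (-Y) 0
      have h3 := h1.mul h2
      have h4 : exp (t • X) * exp (-(t • X)) = 1 := (expGL (t • X)).val_inv
      simp only [smul_neg] at h3
      exact h3.congr_deriv (by simp [sub_eq_add_neg, mul_assoc, h4])
    · have h4 : exp (t • X) * exp (-(t • X)) = 1 := (expGL (t • X)).val_inv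
      simp [h4]
    · intro s f hf
      exact hf (expGL (t • X) * expGL (s • Y) * (expGL (t • X))⁻¹ * (expGL (s • Y))⁻¹)
        (hc (Subgroup.commutator_mem_commutator (expGL_smul_mem hH hX t)
          (expGL_smul_mem hH hY s)))
  exact mem_submodule_of_hasDerivAt ((hasDerivAt_conj_exp X Y).sub_const Y) key

theorem bracket_mem_lieAlgebra {n : ℕ} {H : Subgroup (GL (Fin n) ℂ)}
    (hH : IsZariskiClosed ℂ (H : Set (GL (Fin n) ℂ))) {X Y : Mat n}
    (hX : X ∈ lieAlgebra H) (hY : Y ∈ lieAlgebra H) : X * Y - Y * X ∈ lieAlgebra H :=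
  bracket_mem_lieAlgebra_of_commutator hH (Subgroup.commutator_le.2 fun _ ha _ hb =>
    H.mul_mem (H.mul_mem (H.mul_mem ha hb) (H.inv_mem ha)) (H.inv_mem hb)) hX hY

end Kuga
end

/-! ### Countable covers of varieties over an uncountable field -/

open Matrix
noncomputable section
namespace Kuga
open scoped Matrix.Norms.Operator Topology Cardinal
open NormedSpace Filter

/-- Nullstellensatz for countably many variables over `ℂ`. -/
theorem exists_zero_of_ne_top {τ : Type} [Countable τ] {J : Ideal (MvPolynomial τ ℂ)}
    (hJ : J ≠ ⊤) : ∃ x : τ → ℂ, ∀ f ∈ J, MvPolynomial.eval x f = 0 := by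
  obtain ⟨M, hM, hJM⟩ := J.exists_le_maximal hJ
  let : Field (MvPolynomial τ ℂ ⧸ M) := Ideal.Quotient.field M
  have hrank : Module.rank ℂ (MvPolynomial τ ℂ ⧸ M) ≤ ℵ₀ := by
    refine (rank_quotient_le (M.restrictScalars ℂ)).trans ?_
    rw [MvPolynomial.rank_eq]
    simp
  have halg : Algebra.IsAlgebraic ℂ (MvPolynomial τ ℂ ⧸ M) := by
    refine ⟨fun x => ?_⟩
    by_contra hx
    -- A transcendental `x` would make the elements `1 / (x - a)`, for `a` in `ℂ`, linearly
    -- independent: too many for a quotient of countable dimension.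
    have h1 := (Transcendental.linearIndependent_sub_inv (F := ℂ) hx).cardinal_le_rank
    have h2 : #ℂ ≤ ℵ₀ := h1.trans hrank
    exact absurd h2 (not_le.2 (Cardinal.aleph0_lt_continuum.trans_eq Cardinal.mk_complex.symm))
  have hbij := IsAlgClosed.algebraMap_bijective_of_isIntegral (k := ℂ)
    (K := MvPolynomial τ ℂ ⧸ M)
  choose x hx using fun t : τ => hbij.2 (Ideal.Quotient.mk M (MvPolynomial.X t))
  refine ⟨x, fun f hf => hbij.1 ?_⟩
  have : (Ideal.Quotient.mkₐ ℂ M) =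
      (Algebra.ofId ℂ (MvPolynomial τ ℂ ⧸ M)).comp (MvPolynomial.aeval x) := by
    ext t
    simp [Algebra.ofId_apply, hx]
  have h2 := DFunLike.congr_fun this f
  simp only [Ideal.Quotient.mkₐ_eq_mk, AlgHom.comp_apply, Algebra.ofId_apply] at h2
  rw [map_zero]
  exact h2.symm.trans (Ideal.Quotient.eq_zero_iff_mem.2 (hJM hf))

/-- A zero locus of a prime ideal is not covered by countably many hypersurfaces that do not
contain it. -/
theorem exists_zero_of_isPrime {σ : Type} [Countable σ] {p : Ideal (MvPolynomial σ ℂ)} (hp : p.IsPrime)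
    {ι : Type} [Countable ι] (f : ι → MvPolynomial σ ℂ) (hf : ∀ i, f i ∉ p) :
    ∃ x : σ → ℂ, (∀ g ∈ p, MvPolynomial.eval x g = 0) ∧ ∀ i, MvPolynomial.eval x (f i) ≠ 0 := by
  let A := MvPolynomial σ ℂ ⧸ p
  let F := FractionRing A
  let q : MvPolynomial σ ℂ →ₐ[ℂ] F := (Algebra.ofId A F |>.restrictScalars ℂ).comp
    (Ideal.Quotient.mkₐ ℂ p)
  have hq : ∀ g, q g = 0 ↔ g ∈ p := by
    intro g
    have : q g = algebraMap A F (Ideal.Quotient.mk p g) := rfl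
    rw [this, IsFractionRing.to_map_eq_zero_iff, Ideal.Quotient.eq_zero_iff_mem]
  -- Rabinowitsch's trick with countably many functions: a new variable is added for the inverse of
  -- each `f i`. A common zero of the kernel of `φ` is then a zero of `p` at which no `f i`
  -- vanishes.
  let φ : MvPolynomial (σ ⊕ ι) ℂ →ₐ[ℂ] F :=
    MvPolynomial.aeval (Sum.elim (fun s => q (MvPolynomial.X s)) fun i => (q (f i))⁻¹)
  have hφ : ∀ g : MvPolynomial σ ℂ, φ (MvPolynomial.rename Sum.inl g) = q g := by
    intro g
    rw [MvPolynomial.aeval_rename]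
    have : Sum.elim (fun s => q (MvPolynomial.X s)) (fun i => (q (f i))⁻¹) ∘ Sum.inl =
      fun s => q (MvPolynomial.X s) := rfl
    rw [this]
    have h2 : (MvPolynomial.aeval fun s => q (MvPolynomial.X s)) = q := by
      ext s; simp
    rw [h2]
  have hJ : RingHom.ker φ ≠ ⊤ := by
    rw [Ne, Ideal.eq_top_iff_one]
    simp [RingHom.mem_ker]
  obtain ⟨x, hx⟩ := exists_zero_of_ne_top hJ
  refine ⟨x ∘ Sum.inl, fun g hg => ?_, fun i hi => ?_⟩
  · have := hx (MvPolynomial.rename Sum.inl g) (by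
      rw [RingHom.mem_ker]; exact (hφ g).trans ((hq g).2 hg))
    rwa [MvPolynomial.eval_rename] at this
  · have := hx (MvPolynomial.rename Sum.inl (f i) * MvPolynomial.X (Sum.inr i) - 1) (by
      rw [RingHom.mem_ker, map_sub, map_mul, hφ, map_one]
      simp only [φ, MvPolynomial.aeval_X, Sum.elim_inr]
      rw [mul_inv_cancel₀ (fun h => hf i ((hq _).1 h)), sub_self])
    rw [map_sub, map_mul, MvPolynomial.eval_rename, hi, zero_mul, map_one] at this
    norm_num at this

/-- The determinant as a polynomial in the entries. -/
def detPoly (n : ℕ) : MatPoly n := (Matrix.of fun i j => MvPolynomial.X (i, j)).det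

theorem ev_detPoly {n : ℕ} (A : Mat n) : ev (detPoly n) A = A.det := by
  unfold ev detPoly
  rw [RingHom.map_det]
  congr 1
  ext i j
  simp

/-- The ideal of all polynomials vanishing on a set of invertible matrices. -/
def vanishingIdealGL {n : ℕ} (A : Set (GL (Fin n) ℂ)) : Ideal (MatPoly n) where
  carrier := {f | VanishesOn f A}
  zero_mem' := fun g _ => by simp [ev]
  add_mem' := fun {a b} ha hb g hg => by
    have h1 := ha g hg
    have h2 := hb g hg
    simp only [ev, map_add] at *
    rw [h1, h2, add_zero]
  smul_mem' := fun c a ha g hg => by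
    have h1 := ha g hg
    simp only [ev, smul_eq_mul, map_mul] at *
    rw [h1, mul_zero]

theorem isRadical_vanishingIdealGL {n : ℕ} (A : Set (GL (Fin n) ℂ)) :
    (vanishingIdealGL A).IsRadical := by
  intro f hf
  obtain ⟨k, hk⟩ := hf
  intro g hg
  have := hk g hg
  simp only [ev, map_pow] at this
  exact not_not.1 fun h => pow_ne_zero k h this

/-- A Zariski closed set covered by countably many Zariski closed sets is covered by finitely
many of them. -/
theorem exists_finite_subcover {n : ℕ} {A : Set (GL (Fin n) ℂ)} (hA : IsZariskiClosed ℂ A)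
    {ι : Type} [Countable ι] (B : ι → Set (GL (Fin n) ℂ)) (hB : ∀ i, IsZariskiClosed ℂ (B i))
    (h : A ⊆ ⋃ i, B i) : ∃ s : Set ι, s.Finite ∧ A ⊆ ⋃ i ∈ s, B i := by
  set I := vanishingIdealGL A
  -- Each component that meets `GL n` lies in a single `B i`; otherwise some point of it would avoid
  -- all of them.
  have key : ∀ p ∈ I.minimalPrimes, detPoly n ∉ p → ∃ i, vanishingIdealGL (B i) ≤ p := by
    intro p hp hdet
    by_contra! hcon
    choose f hf hfp using fun i => SetLike.not_le_iff_exists.1 (hcon i)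
    -- The determinant joins the functions to be avoided, as index `none`, so that the point found
    -- is an invertible matrix.
    obtain ⟨x, hx, hxf⟩ := exists_zero_of_isPrime hp.1.1
      (fun o : Option ι => o.elim (detPoly n) f) (by rintro (_ | i); exacts [hdet, hfp i])
    have hxd := hxf none
    let X : Mat n := Matrix.of fun i j => x (i, j)
    have hev : ∀ f : MatPoly n, ev f X = MvPolynomial.eval x f := fun f => rfl
    simp only [Option.elim_none, ← hev, ev_detPoly] at hxd
    let g : GL (Fin n) ℂ := Matrix.GeneralLinearGroup.mkOfDetNeZero X hxd
    have hg : g ∈ A := isZariskiClosed_iff.1 hA g fun f hf => by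
      exact hx f (hp.1.2 hf)
    obtain ⟨i, hi⟩ := Set.mem_iUnion.1 (h hg)
    exact hxf (some i) (hf i g hi)
  rcases isEmpty_or_nonempty ι with hι | hι
  · exact ⟨∅, Set.finite_empty, h.trans (by simp)⟩
  choose! c hc using key
  have hfin : I.minimalPrimes.Finite := Ideal.finite_minimalPrimes_of_isNoetherianRing _ I
  refine ⟨c '' {p ∈ I.minimalPrimes | detPoly n ∉ p}, (hfin.subset fun p hp => hp.1).image c, ?_⟩
  intro g hg
  by_contra hcon
  simp only [Set.mem_iUnion, not_exists, Set.mem_image, exists_prop] at hcon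
  have hpk : ∀ p ∈ I.minimalPrimes, ∃ f ∈ p, ev f (g : Mat n) ≠ 0 := by
    intro p hp
    by_cases hdet : detPoly n ∈ p
    · exact ⟨_, hdet, by rw [ev_detPoly]; exact ((Matrix.isUnit_iff_isUnit_det _).1 g.isUnit).ne_zero⟩
    · have := hcon (c p)
      by_contra! hz
      refine this ⟨⟨p, ⟨hp, hdet⟩, rfl⟩, isZariskiClosed_iff.1 (hB _) g fun f hf => ?_⟩
      exact hz f (hc p hp hdet hf)
  choose! f hf hfg using hpk
  -- The product lies in every minimal prime, and `I` is the intersection of these because it is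
  -- radical. Yet no factor vanishes at `g`.
  have hmem : ∏ p ∈ hfin.toFinset, f p ∈ I := by
    suffices ∏ p ∈ hfin.toFinset, f p ∈ sInf I.minimalPrimes by
      rwa [Ideal.sInf_minimalPrimes,
        (show I.IsRadical from isRadical_vanishingIdealGL A).radical] at this
    rw [Ideal.mem_sInf]
    intro p hp
    exact Ideal.mem_of_dvd _ (Finset.dvd_prod_of_mem f (hfin.mem_toFinset.2 hp)) (hf p hp)
  have := hmem g hg
  simp only [ev, map_prod, Finset.prod_eq_zero_iff] at this
  obtain ⟨p, hp, h0⟩ := this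
  exact hfg p (hfin.mem_toFinset.1 hp) h0

theorem IsZariskiClosed.biUnion {n : ℕ} {ι : Type} {s : Set ι} (hs : s.Finite)
    {B : ι → Set (GL (Fin n) ℂ)} (hB : ∀ i, IsZariskiClosed ℂ (B i)) :
    IsZariskiClosed ℂ (⋃ i ∈ s, B i) := by
  rw [isZariskiClosed_iff]
  intro g hg
  by_contra hcon
  simp only [Set.mem_iUnion, not_exists, exists_prop, not_and] at hcon
  have : ∀ i ∈ s, ∃ f, VanishesOn f (B i) ∧ ev f (g : Mat n) ≠ 0 := by
    intro i hi
    by_contra! h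
    exact hcon i hi (isZariskiClosed_iff.1 (hB i) g h)
  choose! f hf hfg using this
  have h0 := hg (∏ i ∈ hs.toFinset, f i) (by
    intro a ha
    simp only [Set.mem_iUnion, exists_prop] at ha
    obtain ⟨i, hi, hai⟩ := ha
    simp only [ev, map_prod]
    exact Finset.prod_eq_zero (hs.mem_toFinset.2 hi) (hf i hi a hai))
  simp only [ev, map_prod, Finset.prod_eq_zero_iff] at h0
  obtain ⟨i, hi, h0⟩ := h0
  exact hfg i (hs.mem_toFinset.1 hi) h0

theorem IsZariskiClosed.smul {n : ℕ} {A : Set (GL (Fin n) ℂ)} (hA : IsZariskiClosed ℂ A)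
    (h : GL (Fin n) ℂ) : IsZariskiClosed ℂ {g | h * g ∈ A} := by
  rw [isZariskiClosed_iff]
  intro g hg
  refine isZariskiClosed_iff.1 hA _ fun f hf => ?_
  let F : Fin n × Fin n → MatPoly n := fun ij =>
    ∑ k, MvPolynomial.C ((h : Mat n) ij.1 k) * MvPolynomial.X (k, ij.2)
  have hF : ∀ A : Mat n, ev (MvPolynomial.bind₁ F f) A = ev f ((h : Mat n) * A) := by
    intro A
    rw [ev_bind]
    congr 1
    ext i j
    simp [F, ev, Matrix.mul_apply]
  have := hg (MvPolynomial.bind₁ F f) fun a ha => by rw [hF]; exact hf (h * a) ha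
  rwa [hF] at this

/-- A Zariski closed subgroup of countable index in a connected group is the whole group. -/
theorem le_of_countable_index {n : ℕ} {H Z : Subgroup (GL (Fin n) ℂ)}
    (hH : IsZariskiClosed ℂ (H : Set (GL (Fin n) ℂ))) (hHc : IsZariskiConnected H)
    (hZ : IsZariskiClosed ℂ (Z : Set (GL (Fin n) ℂ))) (hc : Countable (H ⧸ Z.subgroupOf H)) :
    H ≤ Z := by
  let B : H ⧸ Z.subgroupOf H → Set (GL (Fin n) ℂ) := fun x => {g | (x.out : GL (Fin n) ℂ)⁻¹ * g ∈ Z}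
  have hB : ∀ x, IsZariskiClosed ℂ (B x) := fun x => hZ.smul _
  have hBx : ∀ g : H, ∀ x, (g : GL (Fin n) ℂ) ∈ B x ↔ (g : H ⧸ Z.subgroupOf H) = x := by
    intro g x
    conv_rhs => rw [← x.out_eq', eq_comm]
    rw [QuotientGroup.eq, Subgroup.mem_subgroupOf]
    rfl
  have hcov : (H : Set (GL (Fin n) ℂ)) ⊆ ⋃ x, B x := fun g hg =>
    Set.mem_iUnion.2 ⟨((⟨g, hg⟩ : H) : H ⧸ Z.subgroupOf H), (hBx ⟨g, hg⟩ _).2 rfl⟩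
  obtain ⟨s, hs, hsc⟩ := exists_finite_subcover hH B hB hcov
  set e : H ⧸ Z.subgroupOf H := ((1 : H) : H ⧸ Z.subgroupOf H)
  have hs' : (s \ {e}).Finite := hs.subset Set.sdiff_subset
  -- Connectedness is applied to the trivial coset and the finite union of the other cosets needed
  -- to cover `H`. The latter does not contain `1`.
  have hdisj := hHc (B e) (⋃ i ∈ s \ {e}, B i) (hB e) (IsZariskiClosed.biUnion hs' hB) ?_ ?_
  · rcases hdisj with h | h
    · intro g hg
      have h1 := (hBx ⟨g, hg⟩ e).1 (h hg)
      have h2 := QuotientGroup.eq.1 h1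
      rw [mul_one, Subgroup.mem_subgroupOf] at h2
      exact Z.inv_mem_iff.1 h2
    · have h1 := h H.one_mem
      simp only [Set.mem_iUnion] at h1
      obtain ⟨i, hi, h1⟩ := h1
      exact absurd ((hBx 1 i).1 h1).symm hi.2
  · intro g hg
    have := hsc hg
    simp only [Set.mem_iUnion] at this
    obtain ⟨i, hi, hgi⟩ := this
    by_cases hie : i = e
    · left; rw [← hie]; exact hgi
    · right
      simp only [Set.mem_iUnion]
      exact ⟨i, ⟨hi, hie⟩, hgi⟩
  · refine Set.eq_empty_of_forall_notMem ?_
    rintro g ⟨hg, h1, h2⟩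
    simp only [Set.mem_iUnion] at h2
    obtain ⟨i, hi, h2⟩ := h2
    exact hi.2 (((hBx ⟨g, hg⟩ i).1 h2).symm.trans ((hBx ⟨g, hg⟩ e).1 h1))

end Kuga
end

/-! ### The closed subgroup theorem -/

open Matrix
noncomputable section
namespace Kuga
open scoped Matrix.Norms.Operator Topology
open NormedSpace Filter

/-- Zariski closed sets are closed for the classical topology. -/
theorem mem_of_tendsto_of_isZariskiClosed {n : ℕ} {A : Set (GL (Fin n) ℂ)}
    (hA : IsZariskiClosed ℂ A) {ι : Type*} {l : Filter ι} [l.NeBot] {u : ι → GL (Fin n) ℂ}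
    {g : GL (Fin n) ℂ} (hu : Tendsto (fun i => (u i : Mat n)) l (𝓝 (g : Mat n)))
    (h : ∀ i, u i ∈ A) : g ∈ A := by
  refine isZariskiClosed_iff.1 hA g fun f hf => ?_
  have h1 : Tendsto (fun i => ev f (u i : Mat n)) l (𝓝 (ev f (g : Mat n))) :=
    ((continuous_ev f).tendsto _).comp hu
  have h2 : (fun i => ev f (u i : Mat n)) = fun _ => 0 := funext fun i => hf _ (h i)
  rw [h2] at h1
  exact tendsto_nhds_unique h1 tendsto_const_nhds

theorem expGL_zsmul {n : ℕ} (k : ℤ) (X : Mat n) : expGL ((k : ℂ) • X) = expGL X ^ k := by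
  obtain ⟨m, rfl | rfl⟩ := k.eq_nat_or_neg
  · simpa using expGL_nsmul m X
  · have : (((-(m : ℤ) : ℤ) : ℂ)) • X = -((m : ℂ) • X) := by push_cast; rw [neg_smul]
    rw [this, expGL_neg, expGL_nsmul, _root_.zpow_neg, zpow_natCast]

/-- Products `exp x * exp y`, with `x` and `y` small in complementary subspaces, fill a
neighborhood of `1`. -/
theorem map_exp_mul_exp_nhds {n : ℕ} {L E : Submodule ℂ (Mat n)} (h : IsCompl L E) :
    map (fun p : L × E => exp (p.1 : Mat n) * exp (p.2 : Mat n)) (𝓝 0) = 𝓝 1 := by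
  let e : (L × E) ≃L[ℂ] Mat n := (L.prodEquivOfIsCompl E h).toContinuousLinearEquiv
  have he : ∀ p, e p = (p.1 : Mat n) + (p.2 : Mat n) := fun p =>
    Submodule.coe_prodEquivOfIsCompl' L E h p
  have h0 : HasStrictFDerivAt (fun A : Mat n => exp A) (1 : Mat n →L[ℂ] Mat n) 0 :=
    hasStrictFDerivAt_exp_zero
  let q1 : (L × E) →L[ℂ] Mat n := L.subtypeL.comp (ContinuousLinearMap.fst ℂ L E)
  let q2 : (L × E) →L[ℂ] Mat n := E.subtypeL.comp (ContinuousLinearMap.snd ℂ L E)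
  have h1 : HasStrictFDerivAt (fun p : L × E => exp (p.1 : Mat n))
      ((1 : Mat n →L[ℂ] Mat n).comp q1) 0 := by
    have : HasStrictFDerivAt (fun A : Mat n => exp A) (1 : Mat n →L[ℂ] Mat n) (q1 0) := by
      rw [map_zero]; exact h0
    exact this.comp 0 q1.hasStrictFDerivAt
  have h2 : HasStrictFDerivAt (fun p : L × E => exp (p.2 : Mat n))
      ((1 : Mat n →L[ℂ] Mat n).comp q2) 0 := by
    have : HasStrictFDerivAt (fun A : Mat n => exp A) (1 : Mat n →L[ℂ] Mat n) (q2 0) := by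
      rw [map_zero]; exact h0
    exact this.comp 0 q2.hasStrictFDerivAt
  have h3 := h1.mul' h2
  have h4 : HasStrictFDerivAt (fun p : L × E => exp (p.1 : Mat n) * exp (p.2 : Mat n))
      (e : (L × E) →L[ℂ] Mat n) 0 := by
    refine h3.congr_fderiv ?_
    refine ContinuousLinearMap.ext fun p => ?_
    change exp (0 : Mat n) • (p.2 : Mat n) + MulOpposite.op (exp (0 : Mat n)) • (p.1 : Mat n) = e p
    rw [he, exp_zero]
    simp [add_comm]
  have h5 : exp (((0 : L × E).1 : L) : Mat n) * exp (((0 : L × E).2 : E) : Mat n) = 1 := by simp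
  exact h4.map_nhds_eq_of_equiv.trans (congrArg 𝓝 h5)

/-- The closed subgroup theorem: near `1`, a closed group is generated by its Lie algebra. -/
theorem eventually_mem_of_expGL_mem {n : ℕ} {H Z : Subgroup (GL (Fin n) ℂ)}
    (hH : IsZariskiClosed ℂ (H : Set (GL (Fin n) ℂ))) (hZ : ∀ X ∈ lieAlgebra H, expGL X ∈ Z) :
    ∀ᶠ A in 𝓝 (1 : Mat n), ∀ g : GL (Fin n) ℂ, (g : Mat n) = A → g ∈ H → g ∈ Z := by
  obtain ⟨E, hE⟩ := (lieAlgebra H).exists_isCompl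
  by_contra hcon
  rw [not_eventually, ← map_exp_mul_exp_nhds hE, frequently_map] at hcon
  have : FirstCountableTopology (Mat n) :=
    inferInstanceAs (FirstCountableTopology (Fin n → Fin n → ℂ))
  have : FirstCountableTopology (lieAlgebra H) :=
    Topology.IsInducing.subtypeVal.firstCountableTopology
  have : FirstCountableTopology E := Topology.IsInducing.subtypeVal.firstCountableTopology
  -- A sequence in `H` outside `Z` that tends to `1` is written as `exp x * exp y`, with `x` in `Lie
  -- H` and `y` in the complement `E`. Then `exp y ∈ H`, and `y ≠ 0` because `exp x ∈ Z`.
  obtain ⟨p, hp, hbad⟩ := exists_seq_forall_of_frequently hcon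
  push Not at hbad
  choose g hg hgH hgZ using hbad
  have hgmul : ∀ k, g k = expGL ((p k).1 : Mat n) * expGL ((p k).2 : Mat n) :=
    fun k => Units.ext (hg k)
  have hy : ∀ k, expGL ((p k).2 : Mat n) ∈ H := fun k => by
    have := H.mul_mem (H.inv_mem (expGL_mem hH (p k).1.2)) (hgH k)
    rwa [hgmul, inv_mul_cancel_left] at this
  have hy0 : ∀ k, ‖(p k).2‖ ≠ 0 := fun k h0 => by
    rw [norm_eq_zero] at h0
    refine hgZ k ?_
    rw [hgmul, h0]
    simpa using hZ _ (p k).1.2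
  have hu : ∀ k, ((‖(p k).2‖⁻¹ : ℝ) : ℂ) • (p k).2 ∈ Metric.sphere (0 : E) 1 := fun k => by
    rw [mem_sphere_zero_iff_norm, norm_smul]
    rw [Complex.norm_real, norm_inv, norm_norm, inv_mul_cancel₀ (hy0 k)]
  have hproper : ProperSpace E := FiniteDimensional.proper ℂ E
  obtain ⟨u, hu1, φ, hφ, hlim⟩ := (isCompact_sphere (0 : E) 1).tendsto_subseq hu
  have hytend : Tendsto (fun k => ‖(p (φ k)).2‖) atTop (𝓝 0) := by
    have h1 : Tendsto (fun q : lieAlgebra H × E => ‖q.2‖) (𝓝 0) (𝓝 0) :=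
      (continuous_snd.norm).tendsto' _ _ (by simp)
    exact (h1.comp hp).comp hφ.tendsto_atTop
  -- Here `u` is a limit of the normalized `y / ‖y‖`. The integer multiples `⌊t / ‖y‖⌋ • y` tend to
  -- `t • u`, so `exp (t u)` is a limit of powers of elements of `H`. This gives a unit vector in
  -- both `Lie H` and `E`.
  have huL : (u : Mat n) ∈ lieAlgebra H := by
    refine mem_lieAlgebra_of_expGL fun t => ?_
    refine mem_of_tendsto_of_isZariskiClosed hH (l := atTop)
      (u := fun k => expGL ((⌊t / ‖(p (φ k)).2‖⌋ : ℂ) • ((p (φ k)).2 : Mat n))) ?_ ?_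
    · have h1 : Tendsto (fun k => (⌊t / ‖(p (φ k)).2‖⌋ : ℝ) * ‖(p (φ k)).2‖) atTop (𝓝 t) := by
        have hb : ∀ k, |(⌊t / ‖(p (φ k)).2‖⌋ : ℝ) * ‖(p (φ k)).2‖ - t| ≤ ‖(p (φ k)).2‖ := by
          intro k
          have hpos : 0 < ‖(p (φ k)).2‖ := lt_of_le_of_ne (norm_nonneg _) (hy0 _).symm
          have e1 := Int.floor_le (t / ‖(p (φ k)).2‖)
          have e2 := Int.lt_floor_add_one (t / ‖(p (φ k)).2‖)
          rw [le_div_iff₀ hpos] at e1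
          rw [div_lt_iff₀ hpos] at e2
          rw [abs_le]
          constructor <;> nlinarith
        rw [tendsto_iff_dist_tendsto_zero]
        exact squeeze_zero (fun _ => dist_nonneg) (fun k => by rw [Real.dist_eq]; exact hb k) hytend
      have h2 : Tendsto (fun k => (((⌊t / ‖(p (φ k)).2‖⌋ : ℝ) * ‖(p (φ k)).2‖ : ℝ) : ℂ) •
          ((((‖(p (φ k)).2‖⁻¹ : ℝ) : ℂ) • (p (φ k)).2 : E) : Mat n)) atTop
          (𝓝 ((t : ℂ) • (u : Mat n))) :=
        ((Complex.continuous_ofReal.tendsto t).comp h1).smul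
          ((continuous_subtype_val.tendsto u).comp hlim)
      have h3 := (exp_continuous (𝔸 := Mat n)).tendsto ((t : ℂ) • (u : Mat n)) |>.comp h2
      refine h3.congr fun k => ?_
      simp only [Function.comp_apply, coe_expGL, Submodule.coe_smul, smul_smul]
      congr 2
      have := hy0 (φ k)
      push_cast
      rw [mul_assoc, mul_inv_cancel₀ (by exact_mod_cast this), mul_one]
    · intro k
      have := H.zpow_mem (hy (φ k)) ⌊t / ‖(p (φ k)).2‖⌋
      rw [← expGL_zsmul] at this
      exact this
  have hu0 : u = 0 := by
    have : (u : Mat n) ∈ lieAlgebra H ⊓ E := ⟨huL, u.2⟩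
    rw [hE.inf_eq_bot] at this
    exact Subtype.ext this
  rw [hu0] at hu1
  simp at hu1

instance secondCountableTopology_GL {n : ℕ} : SecondCountableTopology (GL (Fin n) ℂ) := by
  have : SecondCountableTopology (Mat n) :=
    inferInstanceAs (SecondCountableTopology (Fin n → Fin n → ℂ))
  have : SecondCountableTopology (Mat n)ᵐᵒᵖ :=
    MulOpposite.opHomeomorph.symm.isEmbedding.secondCountableTopology
  exact Units.isEmbedding_embedProduct.secondCountableTopology

/-- A connected closed group is contained in every closed group which contains the exponentials of
its Lie algebra. -/
theorem le_of_expGL_mem {n : ℕ} {H Z : Subgroup (GL (Fin n) ℂ)}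
    (hH : IsZariskiClosed ℂ (H : Set (GL (Fin n) ℂ))) (hHc : IsZariskiConnected H)
    (hZ : IsZariskiClosed ℂ (Z : Set (GL (Fin n) ℂ))) (h : ∀ X ∈ lieAlgebra H, expGL X ∈ Z) :
    H ≤ Z := by
  refine le_of_countable_index hH hHc hZ ?_
  -- The coset space of an open subgroup is discrete, and it is separable because `GL n ℂ` is second
  -- countable. Hence the index is countable.
  have hopen : IsOpen (Z.subgroupOf H : Set H) := by
    refine Subgroup.isOpen_of_mem_nhds _ (g := 1) ?_
    have hc : Continuous fun g : H => ((g : GL (Fin n) ℂ) : Mat n) :=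
      Units.continuous_val.comp continuous_subtype_val
    have := (hc.tendsto 1).eventually (eventually_mem_of_expGL_mem hH h)
    filter_upwards [this] with g hg
    exact hg g rfl g.2
  have hd : DiscreteTopology (H ⧸ Z.subgroupOf H) := QuotientGroup.discreteTopology hopen
  have : SecondCountableTopology H := Topology.IsEmbedding.subtypeVal.secondCountableTopology
  have : TopologicalSpace.SeparableSpace (H ⧸ Z.subgroupOf H) :=
    Quotient.mk''_surjective.denseRange.separableSpace continuous_quot_mk
  exact TopologicalSpace.separableSpace_iff_countable.1 this

end Kuga
end

/-! ### Zariski closed conditions and unipotent one-parameter groups -/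

open Matrix
noncomputable section
namespace Kuga
open scoped Matrix.Norms.Operator Topology
open NormedSpace Filter

/-- The substitution of a linear map into a polynomial in the matrix entries. -/
def linPoly {n : ℕ} (T : Mat n →ₗ[ℂ] Mat n) (f : MatPoly n) : MatPoly n :=
  MvPolynomial.bind₁ (fun ij => ∑ kl : Fin n × Fin n,
    MvPolynomial.C (T (Matrix.single kl.1 kl.2 1) ij.1 ij.2) * MvPolynomial.X kl) f

theorem ev_linPoly {n : ℕ} (T : Mat n →ₗ[ℂ] Mat n) (f : MatPoly n) (A : Mat n) :
    ev (linPoly T f) A = ev f (T A) := by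
  rw [linPoly, ev_bind]
  congr 1
  ext i j
  conv_rhs => rw [Matrix.matrix_eq_sum_single A]
  simp only [ev, map_sum, Matrix.of_apply, map_mul, MvPolynomial.eval_C, MvPolynomial.eval_X,
    Matrix.sum_apply, Fintype.sum_prod_type]
  refine Finset.sum_congr rfl fun k _ => Finset.sum_congr rfl fun l _ => ?_
  have : Matrix.single k l (A k l) = A k l • Matrix.single k l (1 : ℂ) := by simp
  rw [this, map_smul, Matrix.smul_apply, smul_eq_mul, mul_comm]

theorem isZariskiClosed_linear_preimage {n : ℕ} (T : Mat n →ₗ[ℂ] Mat n) (S : Set (MatPoly n)) :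
    IsZariskiClosed ℂ {g : GL (Fin n) ℂ | ∀ f ∈ S, ev f (T g) = 0} := by
  have := isZariskiClosed_setOf (linPoly T '' S)
  simpa only [Set.forall_mem_image, ev_linPoly] using this

theorem isZariskiClosed_linear_eq_zero {n : ℕ} (T : Mat n →ₗ[ℂ] Mat n) :
    IsZariskiClosed ℂ {g : GL (Fin n) ℂ | T g = 0} := by
  have := isZariskiClosed_linear_preimage T (Set.range fun ij => (MvPolynomial.X ij : MatPoly n))
  convert this using 1
  ext g
  simp only [Set.mem_ofPred_eq, Set.forall_mem_range, ev, MvPolynomial.eval_X]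
  exact ⟨fun h ij => by rw [h]; rfl, fun h => Matrix.ext fun i j => h (i, j)⟩

theorem IsZariskiClosed.iInter {n : ℕ} {ι : Type*} {B : ι → Set (GL (Fin n) ℂ)}
    (h : ∀ i, IsZariskiClosed ℂ (B i)) : IsZariskiClosed ℂ {g | ∀ i, g ∈ B i} := by
  rw [isZariskiClosed_iff]
  intro g hg i
  exact isZariskiClosed_iff.1 (h i) g fun f hf => hg f fun a ha => hf a (ha i)

/-- The centralizer of a set of matrices is Zariski closed. -/
theorem isZariskiClosed_commute {n : ℕ} (S : Set (Mat n)) :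
    IsZariskiClosed ℂ {g : GL (Fin n) ℂ | ∀ X ∈ S, (g : Mat n) * X = X * g} := by
  have := IsZariskiClosed.iInter (ι := S) fun X => isZariskiClosed_linear_eq_zero
    (LinearMap.mulRight ℂ (X : Mat n) - LinearMap.mulLeft ℂ (X : Mat n))
  convert this using 1
  ext g
  simp [sub_eq_zero]

/-- The adjugate as a polynomial map. -/
theorem isZariskiClosed_linear_inv {n : ℕ} (T : Mat n →ₗ[ℂ] Mat n) :
    IsZariskiClosed ℂ {g : GL (Fin n) ℂ | T ((g⁻¹ : GL (Fin n) ℂ) : Mat n) = 0} := by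
  let M : Matrix (Fin n) (Fin n) (MatPoly n) := Matrix.of fun i j => MvPolynomial.X (i, j)
  have hM : ∀ A : Mat n, (Matrix.of fun i j => ev (M.adjugate i j) A) = A.adjugate := by
    intro A
    have := RingHom.map_adjugate (MvPolynomial.eval fun ij : Fin n × Fin n => A ij.1 ij.2) M
    have h2 : (MvPolynomial.eval fun ij : Fin n × Fin n => A ij.1 ij.2).mapMatrix M = A := by
      ext i j; simp [M]
    rw [h2] at this
    rw [← this]
    rfl
  have := isZariskiClosed_setOf (Set.range fun ij => MvPolynomial.bind₁
    (fun kl : Fin n × Fin n => M.adjugate kl.1 kl.2) (linPoly T (MvPolynomial.X ij)))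
  convert this using 1
  ext g
  simp only [Set.mem_ofPred_eq, Set.forall_mem_range, ev_bind, hM, ev_linPoly]
  have hdet : IsUnit (g : Mat n).det := (Matrix.isUnit_iff_isUnit_det _).1 g.isUnit
  have hg : ((g⁻¹ : GL (Fin n) ℂ) : Mat n) = (g : Mat n).det⁻¹ • (g : Mat n).adjugate := by
    rw [Matrix.coe_units_inv, Matrix.inv_def, Ring.inverse_eq_inv]
  rw [hg, map_smul, smul_eq_zero_iff_right (inv_ne_zero hdet.ne_zero)]
  simp only [ev, MvPolynomial.eval_X]
  exact ⟨fun h ij => by rw [h]; rfl, fun h => Matrix.ext fun i j => h (i, j)⟩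

/-- The polynomial with values `Nat.choose m k`. -/
def choosePoly (k : ℕ) : Polynomial ℂ := Polynomial.C ((k.factorial : ℂ)⁻¹) * descPochhammer ℂ k

theorem eval_choosePoly (k m : ℕ) : (choosePoly k).eval (m : ℂ) = m.choose k := by
  rw [choosePoly, Polynomial.eval_mul, Polynomial.eval_C, descPochhammer_eval_eq_descFactorial,
    Nat.descFactorial_eq_factorial_mul_choose]
  push_cast
  rw [← mul_assoc, inv_mul_cancel₀ (by exact_mod_cast k.factorial_ne_zero), one_mul]

theorem polynomial_eq_zero_of_nat {p : Polynomial ℂ} (h : ∀ m : ℕ, p.eval (m : ℂ) = 0) : p = 0 :=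
  Polynomial.eq_zero_of_infinite_isRoot p
    ((Set.infinite_range_of_injective (Nat.cast_injective (R := ℂ))).mono
      (by rintro _ ⟨m, rfl⟩; exact h m))

/-- Complex powers of unipotent matrices. -/
theorem exists_polynomial_pow {n : ℕ} (A : Mat n) (hA : IsNilpotent (A - 1)) :
    ∃ p : Fin n → Fin n → Polynomial ℂ, ∀ m : ℕ, ∀ i j, (p i j).eval (m : ℂ) = (A ^ m) i j := by
  obtain ⟨d, hd⟩ := hA
  -- The binomial expansion of `(1 + (A - 1)) ^ m` stops at the nilpotency order `d`, and binomial
  -- coefficients are polynomials in `m`.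
  refine ⟨fun i j => ∑ k ∈ Finset.range d, choosePoly k * Polynomial.C (((A - 1) ^ k) i j),
    fun m i j => ?_⟩
  have h1 : A ^ m = ∑ k ∈ Finset.range d, (m.choose k : ℂ) • (A - 1) ^ k := by
    have h2 : A ^ m = ∑ k ∈ Finset.range (m + 1), (m.choose k : ℂ) • (A - 1) ^ k := by
      conv_lhs => rw [← sub_add_cancel A 1, (Commute.one_right (A - 1)).add_pow]
      refine Finset.sum_congr rfl fun k _ => ?_
      rw [one_pow, mul_one, ← nsmul_eq_mul', Nat.cast_smul_eq_nsmul]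
    rcases le_total d (m + 1) with h | h
    · rw [h2]
      refine (Finset.sum_subset (Finset.range_mono h) fun k _ hk => ?_).symm
      rw [pow_eq_zero_of_le (by simpa using hk) hd, smul_zero]
    · rw [h2]
      refine Finset.sum_subset (Finset.range_mono h) fun k _ hk => ?_
      rw [Nat.choose_eq_zero_of_lt (by simpa using hk)]
      simp
  rw [h1, Polynomial.eval_finsetSum, Matrix.sum_apply]
  refine Finset.sum_congr rfl fun k _ => ?_
  rw [Polynomial.eval_mul, eval_choosePoly, Polynomial.eval_C, Matrix.smul_apply, smul_eq_mul]

/-- A unipotent element of a closed group is the exponential of an element of the Lie algebra. -/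
theorem exists_expGL_eq_of_isNilpotent {n : ℕ} {H : Subgroup (GL (Fin n) ℂ)} {g : GL (Fin n) ℂ}
    (hg : g ∈ H) (hn : IsNilpotent ((g : Mat n) - 1)) : ∃ N ∈ lieAlgebra H, expGL N = g := by
  obtain ⟨p, hp⟩ := exists_polynomial_pow (g : Mat n) hn
  let u : ℂ → Mat n := fun t => Matrix.of fun i j => (p i j).eval t
  have hu : ∀ m : ℕ, u m = (g : Mat n) ^ m := fun m => Matrix.ext fun i j => hp m i j
  -- `f (u t)` is a polynomial in `t` that vanishes at every natural number, where `u` takes the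
  -- values `g ^ m`.
  have hf : ∀ f : MatPoly n, VanishesOn f (H : Set (GL (Fin n) ℂ)) → ∀ t, ev f (u t) = 0 := by
    intro f hf t
    have h1 : ∀ t, (MvPolynomial.aeval (fun ij : Fin n × Fin n => p ij.1 ij.2) f).eval t =
        ev f (u t) := by
      intro t
      rw [← Polynomial.coe_evalRingHom, MvPolynomial.aeval_def, MvPolynomial.hom_eval₂, ev,
        MvPolynomial.eval, MvPolynomial.coe_eval₂Hom]
      congr 1
      ext x; simp
    have h0 : MvPolynomial.aeval (fun ij : Fin n × Fin n => p ij.1 ij.2) f = 0 :=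
      polynomial_eq_zero_of_nat fun m => by
        rw [h1, hu]
        exact hf (g ^ m) (H.pow_mem hg m)
    rw [← h1, h0, Polynomial.eval_zero]
  -- The law `u (s + t) = u s * u t` is extended from natural numbers to `ℂ` in one variable at a
  -- time, by polynomial identity.
  have hmul1 : ∀ (m : ℕ) (t : ℂ), u (t + m) = u t * u m := by
    intro m t
    refine Matrix.ext fun i j => ?_
    have h1 : (p i j).comp (Polynomial.X + Polynomial.C (m : ℂ)) -
        ∑ k, p i k * Polynomial.C (u m k j) = 0 := by
      refine polynomial_eq_zero_of_nat fun l => ?_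
      have h2 : u ((l + m : ℕ) : ℂ) i j = (u l * u m) i j := by rw [hu, hu, hu, pow_add]
      simp only [Matrix.mul_apply] at h2
      simp only [Polynomial.eval_sub, Polynomial.eval_comp, Polynomial.eval_add, Polynomial.eval_X,
        Polynomial.eval_C, Polynomial.eval_finsetSum, Polynomial.eval_mul]
      rw [sub_eq_zero, ← Nat.cast_add]
      exact h2
    have h3 := congrArg (Polynomial.eval t) h1
    simp only [Polynomial.eval_sub, Polynomial.eval_comp, Polynomial.eval_add, Polynomial.eval_X,
        Polynomial.eval_C, Polynomial.eval_finsetSum, Polynomial.eval_mul, Polynomial.eval_zero,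
        sub_eq_zero] at h3
    rw [Matrix.mul_apply]
    exact h3
  have hmul : ∀ s t : ℂ, u (t + s) = u t * u s := by
    intro s t
    refine Matrix.ext fun i j => ?_
    have h1 : (p i j).comp (Polynomial.C t + Polynomial.X) -
        ∑ k, Polynomial.C (u t i k) * p k j = 0 := by
      refine polynomial_eq_zero_of_nat fun l => ?_
      have h2 : u (t + l) i j = (u t * u l) i j := by rw [hmul1]
      simp only [Matrix.mul_apply] at h2
      simp only [Polynomial.eval_sub, Polynomial.eval_comp, Polynomial.eval_add, Polynomial.eval_X,
        Polynomial.eval_C, Polynomial.eval_finsetSum, Polynomial.eval_mul]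
      rw [sub_eq_zero]
      exact h2
    have h3 := congrArg (Polynomial.eval s) h1
    simp only [Polynomial.eval_sub, Polynomial.eval_comp, Polynomial.eval_add, Polynomial.eval_X,
        Polynomial.eval_C, Polynomial.eval_finsetSum, Polynomial.eval_mul, Polynomial.eval_zero,
        sub_eq_zero] at h3
    rw [Matrix.mul_apply]
    exact h3
  have hu0 : u 0 = 1 := by simpa using hu 0
  let N : Mat n := Matrix.of fun i j => (Polynomial.derivative (p i j)).eval 0
  have hd0 : HasDerivAt u N 0 := by
    refine hasDerivAt_pi.2 fun i => hasDerivAt_pi.2 fun j => ?_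
    exact (p i j).hasDerivAt 0
  have hd : ∀ t, HasDerivAt u (u t * N) t := by
    intro t
    have h1 : HasDerivAt (fun s => u (s - t)) N t :=
      HasDerivAt.comp_sub_const t t (by rw [sub_self]; exact hd0)
    have h2 := h1.const_mul (u t)
    refine h2.congr_of_eventuallyEq (Eventually.of_forall fun s => ?_)
    change u s = u t * u (s - t)
    rw [← hmul]
    congr 1; ring
  have hN : N ∈ lieAlgebra H := mem_lieAlgebra_of_hasDerivAt hd0 hu0 fun t f hff => hf f hff t
  refine ⟨N, hN, Units.ext ?_⟩
  -- Uniqueness for the equation `u' = u N`, which both `u` and `exp (t N)` solve.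
  have hconst : ∀ t : ℂ, u t * exp (t • (-N)) = u 0 * exp ((0 : ℂ) • (-N)) := by
    intro t
    refine is_const_of_deriv_eq_zero (f := fun t : ℂ => u t * exp (t • (-N))) ?_ ?_ t 0
    · exact fun t => ((hd t).mul (hasDerivAt_exp_smul (-N) t)).differentiableAt
    · intro t
      refine HasDerivAt.deriv (((hd t).mul (hasDerivAt_exp_smul (-N) t)).congr_deriv ?_)
      have hcomm : Commute (exp (t • (-N))) N :=
        (((Commute.refl N).neg_left).smul_left t).exp_left
      rw [mul_neg, mul_neg, mul_assoc, hcomm.eq, add_neg_cancel]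
  have h1 := hconst 1
  rw [hu0] at h1
  simp only [one_smul, zero_smul, exp_zero, mul_one] at h1
  have h2 : u 1 = g := by simpa using hu 1
  have h3 : exp (-N) * exp N = 1 := (expGL N).inv_val
  rw [coe_expGL, ← h2]
  calc exp N = (u 1 * exp (-N)) * exp N := by rw [h1, one_mul]
    _ = u 1 := by rw [mul_assoc, h3, mul_one]

end Kuga
end

/-! ### Gradings by cocharacters -/

open Matrix
noncomputable section
namespace Kuga
open scoped Matrix.Norms.Operator Topology
open NormedSpace Filter

/-- A complete system of orthogonal idempotent matrices, indexed by weights. -/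
structure Grading (n : ℕ) where
  /-- the number of weights -/
  d : ℕ
  /-- the idempotents -/
  E : Fin d → Mat n
  mul_self : ∀ i, E i * E i = E i
  mul_ne : ∀ i j, i ≠ j → E i * E j = 0
  sum_eq : ∑ i, E i = 1

/-- Entrywise, a polynomial that vanishes on all of `ℂˣ` is zero. This permits the comparison of
coefficients in identities between cocharacters. -/
theorem eq_zero_of_sum_pow_smul {n d : ℕ} {A : Fin d → Mat n}
    (h : ∀ t : ℂˣ, ∑ m : Fin d, (t : ℂ) ^ (m : ℕ) • A m = 0) : ∀ m, A m = 0 := by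
  intro m
  ext i j
  let p : Polynomial ℂ := ∑ m : Fin d, Polynomial.C (A m i j) * Polynomial.X ^ (m : ℕ)
  have hp : p = 0 := by
    refine Polynomial.eq_zero_of_infinite_isRoot p
      (((Set.finite_singleton (0 : ℂ)).infinite_compl).mono ?_)
    intro t ht
    have h1 := congrFun (congrFun (h (Units.mk0 t ht)) i) j
    rw [Matrix.sum_apply] at h1
    simp only [Matrix.smul_apply, smul_eq_mul, Matrix.zero_apply] at h1
    simp only [Set.mem_ofPred_eq, Polynomial.IsRoot.def, p, Polynomial.eval_finsetSum,
      Polynomial.eval_mul, Polynomial.eval_C, Polynomial.eval_pow, Polynomial.eval_X]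
    rw [← h1]
    exact Finset.sum_congr rfl fun _ _ => mul_comm _ _
  have h2 := congrArg (fun q => Polynomial.coeff q m) hp
  simp only [p, Polynomial.finsetSum_coeff, Polynomial.coeff_C_mul_X_pow, Polynomial.coeff_zero] at h2
  rw [Finset.sum_eq_single m] at h2
  · simpa using h2
  · intro b _ hb
    rw [if_neg]
    exact fun hh => hb (Fin.ext hh.symm)
  · simp

namespace Grading

variable {n : ℕ} (gr : Grading n)

/-- The cocharacter that acts on the image of `E i` as `t ^ i`. -/
def S (t : ℂ) : Mat n := ∑ i : Fin gr.d, t ^ (i : ℕ) • gr.E i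

theorem E_mul_S (i : Fin gr.d) (t : ℂ) : gr.E i * gr.S t = t ^ (i : ℕ) • gr.E i := by
  rw [S, Finset.mul_sum, Finset.sum_eq_single i]
  · rw [Matrix.mul_smul, gr.mul_self]
  · intro j _ hj
    rw [Matrix.mul_smul, gr.mul_ne i j hj.symm, smul_zero]
  · simp

theorem S_mul_E (i : Fin gr.d) (t : ℂ) : gr.S t * gr.E i = t ^ (i : ℕ) • gr.E i := by
  rw [S, Finset.sum_mul, Finset.sum_eq_single i]
  · rw [Matrix.smul_mul, gr.mul_self]
  · intro j _ hj
    rw [Matrix.smul_mul, gr.mul_ne j i hj, smul_zero]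
  · simp

/-- The part of weight `0` of a matrix. -/
def pr : Mat n →ₗ[ℂ] Mat n :=
  ∑ i, (LinearMap.mulLeft ℂ (gr.E i)).comp (LinearMap.mulRight ℂ (gr.E i))

theorem pr_apply (X : Mat n) : gr.pr X = ∑ i, gr.E i * X * gr.E i := by
  simp [pr, mul_assoc]

/-- Matrices all of whose weights are nonnegative. -/
def IsPar (X : Mat n) : Prop := ∀ i j : Fin gr.d, i < j → gr.E i * X * gr.E j = 0

/-- Matrices of weight one. -/
def IsOne (X : Mat n) : Prop := ∀ i j : Fin gr.d, (i : ℕ) ≠ j + 1 → gr.E i * X * gr.E j = 0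

theorem eq_sum_sum (X : Mat n) : X = ∑ i, ∑ j, gr.E i * X * gr.E j := by
  simp_rw [← Finset.mul_sum, ← Finset.sum_mul, gr.sum_eq, one_mul, mul_one]

theorem eq_of_blocks {X Y : Mat n} (h : ∀ i j, gr.E i * X * gr.E j = gr.E i * Y * gr.E j) :
    X = Y := by
  rw [gr.eq_sum_sum X, gr.eq_sum_sum Y]
  exact Finset.sum_congr rfl fun i _ => Finset.sum_congr rfl fun j _ => h i j

theorem E_mul_pr (i : Fin gr.d) (X : Mat n) : gr.E i * gr.pr X = gr.E i * X * gr.E i := by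
  rw [pr_apply, Finset.mul_sum, Finset.sum_eq_single i]
  · rw [← mul_assoc, ← mul_assoc, gr.mul_self]
  · intro j _ hj
    rw [← mul_assoc, ← mul_assoc, gr.mul_ne i j hj.symm, zero_mul, zero_mul]
  · simp

theorem pr_mul_E (i : Fin gr.d) (X : Mat n) : gr.pr X * gr.E i = gr.E i * X * gr.E i := by
  rw [pr_apply, Finset.sum_mul, Finset.sum_eq_single i]
  · rw [mul_assoc, gr.mul_self]
  · intro j _ hj
    rw [mul_assoc, gr.mul_ne j i hj, mul_zero]
  · simp

theorem pr_comm_E (i : Fin gr.d) (X : Mat n) : gr.E i * gr.pr X = gr.pr X * gr.E i := by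
  rw [E_mul_pr, pr_mul_E]

theorem pr_eq_self_of_comm {X : Mat n} (h : ∀ i, gr.E i * X = X * gr.E i) : gr.pr X = X := by
  rw [pr_apply]
  calc ∑ i, gr.E i * X * gr.E i = ∑ i, X * gr.E i :=
        Finset.sum_congr rfl fun i _ => by rw [h, mul_assoc, gr.mul_self]
    _ = X := by rw [← Finset.mul_sum, gr.sum_eq, mul_one]

theorem pr_pr (X : Mat n) : gr.pr (gr.pr X) = gr.pr X :=
  gr.pr_eq_self_of_comm fun i => gr.pr_comm_E i X

theorem pr_one : gr.pr 1 = 1 := gr.pr_eq_self_of_comm fun i => by simp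

theorem comm_of_pr_eq {X : Mat n} (h : gr.pr X = X) (i : Fin gr.d) :
    gr.E i * X = X * gr.E i := by
  rw [← h, pr_comm_E]

theorem isPar_of_pr_eq {X : Mat n} (h : gr.pr X = X) : gr.IsPar X := fun i j hij => by
  rw [gr.comm_of_pr_eq h, mul_assoc, gr.mul_ne i j hij.ne, mul_zero]

theorem isPar_of_isOne {X : Mat n} (h : gr.IsOne X) : gr.IsPar X := fun i j hij =>
  h i j (by have : (i : ℕ) < j := hij; omega)

theorem pr_of_isOne {X : Mat n} (h : gr.IsOne X) : gr.pr X = 0 := by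
  rw [pr_apply]
  exact Finset.sum_eq_zero fun i _ => h i i (by omega)

theorem E_mul_mul_E (X Y : Mat n) (i j : Fin gr.d) :
    gr.E i * (X * Y) * gr.E j = ∑ k, (gr.E i * X * gr.E k) * (gr.E k * Y * gr.E j) := by
  have : ∀ k, (gr.E i * X * gr.E k) * (gr.E k * Y * gr.E j) =
      (gr.E i * X) * gr.E k * (Y * gr.E j) := fun k => by
    calc (gr.E i * X * gr.E k) * (gr.E k * Y * gr.E j) =
        gr.E i * X * (gr.E k * gr.E k) * (Y * gr.E j) := by simp only [mul_assoc]
      _ = _ := by rw [gr.mul_self]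
  rw [Finset.sum_congr rfl fun k _ => this k, ← Finset.sum_mul, ← Finset.mul_sum, gr.sum_eq,
    mul_one]
  simp only [mul_assoc]

theorem IsPar.mul {X Y : Mat n} (hX : gr.IsPar X) (hY : gr.IsPar Y) : gr.IsPar (X * Y) := by
  intro i j hij
  rw [E_mul_mul_E]
  refine Finset.sum_eq_zero fun k _ => ?_
  rcases lt_or_ge i k with h | h
  · rw [hX i k h, zero_mul]
  · rw [hY k j (lt_of_le_of_lt h hij), mul_zero]

/-- Matrices satisfying `IsPar` are block lower triangular, so in a diagonal block of the product
only diagonal blocks meet. -/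
theorem pr_mul {X Y : Mat n} (hX : gr.IsPar X) (hY : gr.IsPar Y) :
    gr.pr (X * Y) = gr.pr X * gr.pr Y := by
  have h1 : ∀ i, gr.E i * (X * Y) * gr.E i = gr.pr X * (gr.E i * Y * gr.E i) := by
    intro i
    rw [E_mul_mul_E, Finset.sum_eq_single i]
    · rw [← pr_mul_E]
      simp only [← mul_assoc]
      rw [mul_assoc (gr.pr X), gr.mul_self]
    · intro k _ hk
      rcases lt_or_gt_of_ne hk with h | h
      · rw [hY k i h, mul_zero]
      · rw [hX i k h, zero_mul]
    · simp
  rw [pr_apply gr (X * Y), pr_apply gr Y, Finset.mul_sum]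
  exact Finset.sum_congr rfl fun i _ => h1 i

/-- The subalgebra of all matrices with nonnegative weights. -/
def par : Subalgebra ℂ (Mat n) where
  carrier := {X | gr.IsPar X}
  mul_mem' := fun hX hY => IsPar.mul gr hX hY
  add_mem' := fun {X Y} hX hY i j hij => by rw [mul_add, add_mul, hX i j hij, hY i j hij, add_zero]
  algebraMap_mem' := fun r => by
    refine gr.isPar_of_pr_eq (gr.pr_eq_self_of_comm fun i => ?_)
    rw [Algebra.commutes]

theorem isPar_exp {X : Mat n} (hX : gr.IsPar X) : gr.IsPar (exp X) := by
  have hc : IsClosed (gr.par : Set (Mat n)) :=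
    (Subalgebra.toSubmodule gr.par).closed_of_finiteDimensional
  exact exp_mem (R := ℂ) (s := gr.par) hc hX

theorem continuous_pr : Continuous gr.pr := gr.pr.continuous_of_finiteDimensional

/-- `pr` commutes with the exponential on matrices with nonnegative weights. -/
theorem pr_exp {X : Mat n} (hX : gr.IsPar X) : gr.pr (exp X) = exp (gr.pr X) := by
  let F : gr.par →+* Mat n :=
    { toFun := fun X => gr.pr (X : Mat n)
      map_one' := gr.pr_one
      map_mul' := fun X Y => gr.pr_mul X.2 Y.2
      map_zero' := map_zero _
      map_add' := fun X Y => map_add _ _ _ }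
  have hpar : ∀ t : ℂ, gr.IsPar (exp (t • X)) := fun t => gr.isPar_exp (gr.par.smul_mem hX t)
  -- Both sides solve `γ' = γ * pr X` with `γ 0 = 1`.
  have hd : ∀ t : ℂ, HasDerivAt (fun t : ℂ => gr.pr (exp (t • X)))
      (gr.pr (exp (t • X)) * gr.pr X) t := by
    intro t
    rw [← gr.pr_mul (hpar t) hX]
    exact (LinearMap.toContinuousLinearMap gr.pr).hasFDerivAt.comp_hasDerivAt t
      (hasDerivAt_exp_smul X t)
  have hconst : ∀ t : ℂ, gr.pr (exp (t • X)) * exp (t • (-gr.pr X)) =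
      gr.pr (exp ((0 : ℂ) • X)) * exp ((0 : ℂ) • (-gr.pr X)) := by
    intro t
    refine is_const_of_deriv_eq_zero
      (f := fun t : ℂ => gr.pr (exp (t • X)) * exp (t • (-gr.pr X))) ?_ ?_ t 0
    · exact fun t => ((hd t).mul (hasDerivAt_exp_smul (-gr.pr X) t)).differentiableAt
    · intro t
      refine HasDerivAt.deriv (((hd t).mul (hasDerivAt_exp_smul (-gr.pr X) t)).congr_deriv ?_)
      have hcomm : Commute (exp (t • (-gr.pr X))) (gr.pr X) :=
        (((Commute.refl (gr.pr X)).neg_left).smul_left t).exp_left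
      rw [mul_neg, mul_neg, mul_assoc, hcomm.eq, add_neg_cancel]
  have h1 := hconst 1
  simp only [one_smul, zero_smul, exp_zero, mul_one, pr_one] at h1
  have h3 : exp (-gr.pr X) * exp (gr.pr X) = 1 := (expGL (gr.pr X)).inv_val
  calc gr.pr (exp X) = gr.pr (exp X) * (exp (-gr.pr X) * exp (gr.pr X)) := by rw [h3, mul_one]
    _ = exp (gr.pr X) := by rw [← mul_assoc, h1, one_mul]

/-- Matrices with positive weights only are nilpotent. -/
theorem isNilpotent_of_pr_eq_zero {X : Mat n} (hX : gr.IsPar X) (h0 : gr.pr X = 0) :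
    IsNilpotent X := by
  -- `X` is strictly block triangular, so its `k`-th power raises weights by at least `k`.
  have key : ∀ k : ℕ, ∀ i j : Fin gr.d, (i : ℕ) < j + k → gr.E i * X ^ k * gr.E j = 0 := by
    intro k
    induction k with
    | zero =>
      intro i j hij
      rw [pow_zero, mul_one]
      exact gr.mul_ne i j (by rintro rfl; omega)
    | succ k ih =>
      intro i j hij
      rw [pow_succ, E_mul_mul_E]
      refine Finset.sum_eq_zero fun l _ => ?_
      rcases lt_trichotomy l j with h | h | h
      · rw [hX l j h, mul_zero]
      · subst h
        rw [← pr_mul_E, h0, zero_mul, mul_zero]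
      · rw [ih i l (by have : (j : ℕ) < l := h; omega), zero_mul]
  refine ⟨gr.d, gr.eq_of_blocks fun i j => ?_⟩
  rw [key _ i j (by omega), mul_zero, zero_mul]

/-- The conjugation by the cocharacter. -/
theorem E_mul_conj_mul_E (X : Mat n) (t : ℂˣ) (i j : Fin gr.d) :
    gr.E i * (gr.S t * X * gr.S (t⁻¹ : ℂˣ)) * gr.E j =
      ((t : ℂ) ^ (i : ℕ) * ((t⁻¹ : ℂˣ) : ℂ) ^ (j : ℕ)) • (gr.E i * X * gr.E j) := by
  calc gr.E i * (gr.S t * X * gr.S (t⁻¹ : ℂˣ)) * gr.E j =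
      (gr.E i * gr.S t) * X * (gr.S (t⁻¹ : ℂˣ) * gr.E j) := by simp only [mul_assoc]
    _ = _ := by
      rw [E_mul_S, S_mul_E, Matrix.smul_mul, Matrix.smul_mul, Matrix.mul_smul, smul_smul]

/-- The single value `t = 2` already separates weights, since the powers of `2` are distinct. -/
theorem isOne_of_conj {X : Mat n} (h : ∀ t : ℂˣ, gr.S t * X * gr.S (t⁻¹ : ℂˣ) = (t : ℂ) • X) :
    gr.IsOne X := by
  intro i j hij
  have h1 := gr.E_mul_conj_mul_E X (Units.mk0 2 two_ne_zero) i j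
  rw [h, Matrix.mul_smul, Matrix.smul_mul, ← sub_eq_zero, ← sub_smul] at h1
  refine (smul_eq_zero.1 h1).resolve_left ?_
  rw [Units.val_inv_eq_inv_val, Units.val_mk0, sub_eq_zero, inv_pow]
  intro h2
  rw [eq_mul_inv_iff_mul_eq₀ (pow_ne_zero _ two_ne_zero), ← pow_succ'] at h2
  exact hij (Nat.pow_right_injective (le_refl 2) (by exact_mod_cast h2)).symm

theorem pr_eq_of_conj {X : Mat n} (h : ∀ t : ℂˣ, gr.S t * X * gr.S (t⁻¹ : ℂˣ) = X) :
    gr.pr X = X := by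
  have h0 : ∀ i j, i ≠ j → gr.E i * X * gr.E j = 0 := by
    intro i j hij
    have h1 := gr.E_mul_conj_mul_E X (Units.mk0 2 two_ne_zero) i j
    rw [h, ← sub_eq_zero, ← one_smul ℂ (gr.E i * X * gr.E j), smul_smul, mul_one, ← sub_smul] at h1
    refine (smul_eq_zero.1 h1).resolve_left ?_
    rw [Units.val_inv_eq_inv_val, Units.val_mk0, sub_eq_zero, inv_pow]
    intro h2
    rw [eq_mul_inv_iff_mul_eq₀ (pow_ne_zero _ two_ne_zero), one_mul] at h2
    exact hij (Fin.ext (Nat.pow_right_injective (le_refl 2) (by exact_mod_cast h2)).symm)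
  refine gr.eq_of_blocks fun i j => ?_
  rw [E_mul_pr]
  by_cases hij : i = j
  · subst hij; rw [mul_assoc _ _ (gr.E i), gr.mul_self]
  · rw [mul_assoc _ _ (gr.E j), gr.mul_ne i j hij, mul_zero, h0 i j hij]

/-- The limit of the conjugates by the cocharacter: for `X` with nonnegative weights the
conjugates are the values at `t ≠ 0` of a polynomial with value `pr X` at `0`. -/
theorem exists_continuous_conj {X : Mat n} (hX : gr.IsPar X) :
    ∃ γ : ℂ → Mat n, Continuous γ ∧ γ 0 = gr.pr X ∧
      ∀ t : ℂˣ, γ t = gr.S t * X * gr.S (t⁻¹ : ℂˣ) := by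
  -- The truncated subtraction is harmless: the blocks with `i < j` are zero. At `t = 0` only the
  -- diagonal blocks survive.
  refine ⟨fun t => ∑ i : Fin gr.d, ∑ j : Fin gr.d, t ^ ((i : ℕ) - (j : ℕ)) • (gr.E i * X * gr.E j), ?_, ?_, ?_⟩
  · fun_prop
  · rw [pr_apply]
    refine Finset.sum_congr rfl fun i _ => ?_
    rw [Finset.sum_eq_single i]
    · simp
    · intro j _ hj
      rcases lt_or_gt_of_ne hj with h | h
      · have : (j : ℕ) < i := h
        rw [zero_pow (by omega), zero_smul]
      · rw [hX i j h, smul_zero]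
    · simp
  · intro t
    conv_rhs => rw [gr.eq_sum_sum (gr.S t * X * gr.S (t⁻¹ : ℂˣ))]
    refine Finset.sum_congr rfl fun i _ => Finset.sum_congr rfl fun j _ => ?_
    rw [E_mul_conj_mul_E]
    rcases lt_or_ge i j with h | h
    · rw [hX i j h, smul_zero, smul_zero]
    · have h' : (j : ℕ) ≤ i := h
      rw [pow_sub₀ _ t.ne_zero h', Units.val_inv_eq_inv_val, inv_pow]

end Grading

/-- The weight grading given by an algebraic homomorphism from the Deligne torus. -/
theorem exists_grading {n : ℕ} {φ : ℂˣ × ℂˣ →* GL (Fin n) ℂ} (hφ : IsAlgebraicHom φ) :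
    ∃ gr : Grading n, ∀ (t : ℂˣ) (X : Mat n),
      (φ (t, t) : Mat n) * X * ((φ (t, t))⁻¹ : GL (Fin n) ℂ).val =
        gr.S t * X * gr.S (t⁻¹ : ℂˣ) := by
  choose k F hF using hφ
  let p : Fin n → Fin n → Polynomial ℂ := fun i j =>
    MvPolynomial.aeval ![Polynomial.X, Polynomial.X] (F i j)
  have hp : ∀ i j (t : ℂˣ), (p i j).eval (t : ℂ) = ((t : ℂ) * t) ^ k i j * φ (t, t) i j := by
    intro i j t
    rw [hF i j (t, t), ← Polynomial.coe_evalRingHom]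
    simp only [p]
    rw [MvPolynomial.aeval_def,
      MvPolynomial.hom_eval₂, MvPolynomial.eval, MvPolynomial.coe_eval₂Hom]
    congr 1
    · ext x; simp
    · ext x; fin_cases x <;> simp
  -- A common exponent for all entries. At `(t, t)` the factor `z₁ z₂` is `t ^ 2`, so multiplication
  -- by `t ^ (2 * K)` makes every entry of `φ (t, t)` a polynomial. The scalar shifts all weights
  -- equally and disappears under conjugation.
  let K := ∑ i, ∑ j, k i j
  have hK : ∀ i j, k i j ≤ K := fun i j =>
    (Finset.single_le_sum (f := fun j => k i j) (fun _ _ => Nat.zero_le _)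
      (Finset.mem_univ j)).trans (Finset.single_le_sum (f := fun i => ∑ j, k i j)
        (fun _ _ => Nat.zero_le _) (Finset.mem_univ i))
  let q : Fin n → Fin n → Polynomial ℂ := fun i j => Polynomial.X ^ (2 * (K - k i j)) * p i j
  have hq : ∀ i j (t : ℂˣ), (q i j).eval (t : ℂ) = (t : ℂ) ^ (2 * K) * φ (t, t) i j := by
    intro i j t
    simp only [q, Polynomial.eval_mul, Polynomial.eval_pow, Polynomial.eval_X, hp]
    rw [← mul_assoc, ← pow_two, ← pow_mul, ← pow_add]
    congr 2
    have := hK i j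
    omega
  let d := ∑ i, ∑ j, ((q i j).natDegree + 1)
  have hd : ∀ i j, (q i j).natDegree < d := fun i j =>
    Nat.lt_of_succ_le ((Finset.single_le_sum (f := fun j => (q i j).natDegree + 1)
      (fun _ _ => Nat.zero_le _) (Finset.mem_univ j)).trans
      (Finset.single_le_sum (f := fun i => ∑ j, ((q i j).natDegree + 1))
        (fun _ _ => Nat.zero_le _) (Finset.mem_univ i)))
  let E : Fin d → Mat n := fun m => Matrix.of fun i j => (q i j).coeff m
  let S : ℂ → Mat n := fun t => ∑ m : Fin d, t ^ (m : ℕ) • E m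
  have hS : ∀ t : ℂˣ, S t = (t : ℂ) ^ (2 * K) • (φ (t, t) : Mat n) := by
    intro t
    ext i j
    rw [Matrix.smul_apply, smul_eq_mul, ← hq, Polynomial.eval_eq_sum_range' (hd i j),
      Finset.sum_range]
    simp only [S]
    rw [Matrix.sum_apply]
    refine Finset.sum_congr rfl fun m _ => ?_
    simp [E, mul_comm]
  have hmul : ∀ s t : ℂˣ, S s * S t = S (s * t : ℂˣ) := by
    intro s t
    rw [hS, hS, hS, Matrix.smul_mul, Matrix.mul_smul, smul_smul, ← Units.val_mul, ← map_mul,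
      Prod.mk_mul_mk, Units.val_mul, mul_pow]
  -- Coefficients of powers of `s` are compared in `S s * S t = S (s * t)`. Doing the same once more
  -- in `t` gives the orthogonality of the idempotents `E m`.
  have hES : ∀ m (t : ℂˣ), E m * S t = (t : ℂ) ^ (m : ℕ) • E m := by
    intro m t
    rw [← sub_eq_zero]
    refine eq_zero_of_sum_pow_smul (A := fun m => E m * S t - (t : ℂ) ^ (m : ℕ) • E m) ?_ m
    intro s
    have h1 := hmul s t
    simp only [smul_sub, Finset.sum_sub_distrib, sub_eq_zero, ← Matrix.smul_mul, ← Finset.sum_mul,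
      smul_smul, ← mul_pow, ← Units.val_mul]
    exact h1
  have hEE : ∀ m l, E m * E l = if l = m then E m else 0 := by
    intro m l
    rw [← sub_eq_zero]
    refine eq_zero_of_sum_pow_smul (A := fun l => E m * E l - if l = m then E m else 0) ?_ l
    intro t
    have h1 := hES m t
    simp only [smul_sub, Finset.sum_sub_distrib, sub_eq_zero, smul_ite, smul_zero,
      Finset.sum_ite_eq', Finset.mem_univ, if_true, ← Matrix.mul_smul, ← Finset.mul_sum]
    exact h1
  have h1 : S 1 = 1 := by
    have h2 := hS 1
    have h3 : φ (1, 1) = 1 := map_one φ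
    rw [h3] at h2
    simpa using h2
  let gr : Grading n :=
    { d := d
      E := E
      mul_self := fun i => by rw [hEE, if_pos rfl]
      mul_ne := fun i j hij => by rw [hEE, if_neg hij.symm]
      sum_eq := by simpa [S] using h1 }
  refine ⟨gr, fun t X => ?_⟩
  have e1 : gr.S t = (t : ℂ) ^ (2 * K) • (φ (t, t) : Mat n) := hS t
  have e2 : gr.S (t⁻¹ : ℂˣ) = ((t⁻¹ : ℂˣ) : ℂ) ^ (2 * K) • (φ (t⁻¹, t⁻¹) : Mat n) := hS t⁻¹
  have e3 : φ (t⁻¹, t⁻¹) = (φ (t, t))⁻¹ := by rw [← map_inv, Prod.inv_mk]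
  rw [e1, e2, e3, Matrix.smul_mul, Matrix.smul_mul, Matrix.mul_smul, smul_smul, ← mul_pow,
    ← Units.val_mul, mul_inv_cancel, Units.val_one, one_pow, one_smul]

end Kuga
end

/-! ### The Levi decomposition defined by the weight cocharacter -/

open Matrix
noncomputable section
namespace Kuga
open scoped Matrix.Norms.Operator Topology
open NormedSpace Filter

/-- A connected group `P` with a normal unipotent subgroup `W`, graded by a cocharacter of `P`
whose weights on `Lie W` are `1` and whose weights on `Lie P` are `0` and `1`. -/
structure IsWeighted {n : ℕ} (gr : Grading n) (P W : Subgroup (GL (Fin n) ℂ)) : Prop where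
  closed : IsZariskiClosed ℂ (P : Set (GL (Fin n) ℂ))
  connected : IsZariskiConnected P
  closedW : IsZariskiClosed ℂ (W : Set (GL (Fin n) ℂ))
  unipotent : IsUnipotent W
  le : W ≤ P
  normal : ∀ p ∈ P, ∀ w ∈ W, p * w * p⁻¹ ∈ W
  cochar : ∀ t : ℂˣ, ∃ g ∈ P, ∀ X : Mat n,
    (g : Mat n) * X * ((g⁻¹ : GL (Fin n) ℂ) : Mat n) = gr.S t * X * gr.S (t⁻¹ : ℂˣ)
  sub_pr_mem : ∀ X ∈ lieAlgebra P, X - gr.pr X ∈ lieAlgebra W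
  isOne : ∀ X ∈ lieAlgebra W, gr.IsOne X

theorem hodgePiece_conj {n : ℕ} {P : Subgroup (GL (Fin n) ℂ)} {φ : ℂˣ × ℂˣ →* GL (Fin n) ℂ}
    {gr : Grading n} (hgr : ∀ (t : ℂˣ) (X : Mat n),
      (φ (t, t) : Mat n) * X * ((φ (t, t))⁻¹ : GL (Fin n) ℂ).val =
        gr.S t * X * gr.S (t⁻¹ : ℂˣ)) {p q : ℤ} {X : Mat n} (hX : X ∈ hodgePiece P φ p q) (t : ℂˣ) :
    gr.S t * X * gr.S (t⁻¹ : ℂˣ) = ((t ^ (-p) * t ^ (-q) : ℂˣ) : ℂ) • X := by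
  rw [← hgr]
  exact hX.2 (t, t)

/-- `h y (t, t)` acts on the part of type `(p, q)` by `t ^ (-p - q)`: with weight 1 on the two types
of `Lie W` and weight 0 on the other three. The grading enters only through its conjugation action,
so a grading taken from a subdatum also serves the ambient datum. -/
theorem KugaDatum.isWeighted {n : ℕ} (D : KugaDatum n) (y : D.Y) {gr : Grading n}
    (hgr : ∀ (t : ℂˣ) (X : Mat n),
      (D.h y (t, t) : Mat n) * X * ((D.h y (t, t))⁻¹ : GL (Fin n) ℂ).val =
        gr.S t * X * gr.S (t⁻¹ : ℂˣ)) : IsWeighted gr D.P D.W := by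
  have hone : ∀ X ∈ lieAlgebra D.W, gr.IsOne X := by
    intro X hX
    refine gr.isOne_of_conj fun t => ?_
    rw [D.weight y, Submodule.mem_sup] at hX
    obtain ⟨X1, h1, X2, h2, rfl⟩ := hX
    rw [mul_add, add_mul, hodgePiece_conj hgr h1, hodgePiece_conj hgr h2]
    simp
  have hle := D.isUnipotentRadical.1.2.1.1
  refine ⟨D.isQGroup.isClosed, D.connected, D.isUnipotentRadical.1.1.isClosed,
    D.isUnipotentRadical.1.2.2.2, hle, ?_, ?_, ?_, hone⟩
  · intro p hp w hw
    have h := D.isUnipotentRadical.1.2.1.2.conj_mem ⟨w, hle hw⟩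
      (by simpa [Subgroup.mem_subgroupOf] using hw) ⟨p, hp⟩
    simpa [Subgroup.mem_subgroupOf] using h
  · exact fun t => ⟨D.h y (t, t), (D.real y).2.2 _, hgr t⟩
  · intro X hX
    have hpr : ∀ (p : ℤ) (Y : Mat n), Y ∈ hodgePiece D.P (D.h y) p (-p) → gr.pr Y = Y := by
      intro p Y hY
      refine gr.pr_eq_of_conj fun t => ?_
      rw [hodgePiece_conj hgr hY]
      simp
    rw [D.hodge_types y, ← D.weight y, Submodule.mem_sup] at hX
    obtain ⟨Y, hY, X3, h3, rfl⟩ := hX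
    rw [Submodule.mem_sup] at hY
    obtain ⟨Z, hZ, X2, h2, rfl⟩ := hY
    rw [Submodule.mem_sup] at hZ
    obtain ⟨X0, h0, X1, h1, rfl⟩ := hZ
    rw [map_add, map_add, map_add, gr.pr_of_isOne (hone X0 h0), hpr (-1) X1 (by simpa using h1),
      hpr 0 X2 (by simpa using h2), hpr 1 X3 (by simpa using h3)]
    convert h0 using 1
    abel

namespace IsWeighted

variable {n : ℕ} {gr : Grading n} {P W : Subgroup (GL (Fin n) ℂ)} (hw : IsWeighted gr P W)
include hw

theorem pr_mem_lie {X : Mat n} (hX : X ∈ lieAlgebra P) : gr.pr X ∈ lieAlgebra P := by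
  have := (lieAlgebra P).sub_mem hX (lieAlgebra_mono hw.le (hw.sub_pr_mem X hX))
  rwa [sub_sub_cancel] at this

theorem isPar_lie {X : Mat n} (hX : X ∈ lieAlgebra P) : gr.IsPar X := by
  have h1 := gr.isPar_of_isOne (hw.isOne _ (hw.sub_pr_mem X hX))
  have h2 := gr.par.add_mem h1 (gr.isPar_of_pr_eq (gr.pr_pr X))
  rwa [sub_add_cancel] at h2

theorem mem_lieW_iff {X : Mat n} : X ∈ lieAlgebra W ↔ X ∈ lieAlgebra P ∧ gr.pr X = 0 := by
  refine ⟨fun h => ⟨lieAlgebra_mono hw.le h, gr.pr_of_isOne (hw.isOne X h)⟩, fun h => ?_⟩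
  have := hw.sub_pr_mem X h.1
  rwa [h.2, sub_zero] at this

/-- Together the two conditions define a Zariski closed subgroup that contains the exponentials of
`Lie P`, hence the connected group `P`. The inverse is included to make the condition stable under
inversion. -/
theorem isPar_and {g : GL (Fin n) ℂ} (hg : g ∈ P) :
    gr.IsPar (g : Mat n) ∧ gr.IsPar ((g⁻¹ : GL (Fin n) ℂ) : Mat n) := by
  let T : Fin gr.d × Fin gr.d → Mat n →ₗ[ℂ] Mat n := fun ij =>
    (LinearMap.mulLeft ℂ (gr.E ij.1)).comp (LinearMap.mulRight ℂ (gr.E ij.2))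
  have hT : ∀ ij X, T ij X = gr.E ij.1 * X * gr.E ij.2 := fun ij X => by simp [T, mul_assoc]
  let Z : Subgroup (GL (Fin n) ℂ) :=
    { carrier := {g | gr.IsPar (g : Mat n) ∧ gr.IsPar ((g⁻¹ : GL (Fin n) ℂ) : Mat n)}
      mul_mem' := fun {a b} ha hb => ⟨ha.1.mul gr hb.1, by
        rw [_root_.mul_inv_rev]; exact hb.2.mul gr ha.2⟩
      one_mem' := ⟨gr.par.one_mem, by rw [inv_one]; exact gr.par.one_mem⟩
      inv_mem' := fun {a} ha => ⟨ha.2, by rw [inv_inv]; exact ha.1⟩ }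
  have hZ : IsZariskiClosed ℂ (Z : Set (GL (Fin n) ℂ)) := by
    have h1 := IsZariskiClosed.iInter (ι := {ij : Fin gr.d × Fin gr.d // ij.1 < ij.2}) fun ij =>
      (isZariskiClosed_linear_eq_zero (T ij)).inter (isZariskiClosed_linear_inv (T ij))
    convert h1 using 1
    ext g
    simp only [hT, Set.mem_inter_iff, Set.mem_ofPred_eq, Subtype.forall, Prod.forall, forall_and]
    rfl
  refine le_of_expGL_mem (Z := Z) hw.closed hw.connected hZ ?_ hg
  intro X hX
  have hX' := hw.isPar_lie hX
  exact ⟨gr.isPar_exp hX', by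
    rw [coe_expGL_inv]; exact gr.isPar_exp (gr.par.neg_mem hX')⟩

theorem isPar {g : GL (Fin n) ℂ} (hg : g ∈ P) : gr.IsPar (g : Mat n) := (hw.isPar_and hg).1

theorem pr_mul_inv {g : GL (Fin n) ℂ} (hg : g ∈ P) :
    gr.pr (g : Mat n) * gr.pr ((g⁻¹ : GL (Fin n) ℂ) : Mat n) = 1 := by
  rw [← gr.pr_mul (hw.isPar_and hg).1 (hw.isPar_and hg).2, Units.mul_inv, gr.pr_one]

/-- The projection of `P` to the centralizer of the cocharacter. -/
def prHom : P →* GL (Fin n) ℂ where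
  toFun g := ⟨gr.pr ((g : GL (Fin n) ℂ) : Mat n), gr.pr (((g : GL (Fin n) ℂ)⁻¹ : GL (Fin n) ℂ) : Mat n),
    hw.pr_mul_inv g.2, by
      have := hw.pr_mul_inv (P.inv_mem g.2)
      rwa [inv_inv] at this⟩
  map_one' := Units.ext gr.pr_one
  map_mul' g h := Units.ext (gr.pr_mul (hw.isPar g.2) (hw.isPar h.2))

omit hw in
theorem coe_prHom (hw : IsWeighted gr P W) (g : P) :
    (hw.prHom g : Mat n) = gr.pr ((g : GL (Fin n) ℂ) : Mat n) := rfl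

/-- `pr g` is the limit, as `t` tends to `0`, of the conjugates of `g` by the cocharacter; these lie
in `P`, which is closed. -/
theorem prHom_mem (g : P) : hw.prHom g ∈ P := by
  refine isZariskiClosed_iff.1 hw.closed _ fun f hf => ?_
  obtain ⟨γ, hγ, hγ0, hγt⟩ := gr.exists_continuous_conj (hw.isPar g.2)
  rw [coe_prHom, ← hγ0]
  have h1 : ∀ t : ℂ, t ≠ 0 → ev f (γ t) = 0 := by
    intro t ht
    obtain ⟨a, ha, haX⟩ := hw.cochar (Units.mk0 t ht)
    have h2 := hγt (Units.mk0 t ht)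
    rw [Units.val_mk0] at h2
    rw [h2]
    have h3 := haX ((g : GL (Fin n) ℂ) : Mat n)
    rw [Units.val_mk0] at h3
    rw [← h3]
    exact hf (a * g * a⁻¹) (P.mul_mem (P.mul_mem ha g.2) (P.inv_mem ha))
  have hc : Continuous fun t => ev f (γ t) := (continuous_ev f).comp hγ
  have h2 := Continuous.ext_on (dense_compl_singleton (0 : ℂ)) hc continuous_const
    (g := fun _ => (0 : ℂ)) fun t ht => h1 t ht
  exact congrFun h2 0

/-- The kernel of the projection is the unipotent group. -/
theorem mem_W_iff {g : GL (Fin n) ℂ} : g ∈ W ↔ g ∈ P ∧ gr.pr (g : Mat n) = 1 := by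
  constructor
  · intro hg
    obtain ⟨N, hN, rfl⟩ := exists_expGL_eq_of_isNilpotent hg (hw.unipotent g hg)
    refine ⟨hw.le hg, ?_⟩
    rw [coe_expGL, gr.pr_exp (gr.isPar_of_isOne (hw.isOne N hN)), gr.pr_of_isOne (hw.isOne N hN),
      exp_zero]
  · rintro ⟨hg, h1⟩
    -- The elements of the kernel are unipotent, so `g = exp N` with `N ∈ Lie U`. Differentiating
    -- `pr (exp (t N)) = 1` gives `pr N = 0`, that is, `N ∈ Lie W`.
    let U : Subgroup (GL (Fin n) ℂ) := hw.prHom.ker.map P.subtype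
    have hgU : g ∈ U := ⟨⟨g, hg⟩, by
      rw [SetLike.mem_coe, MonoidHom.mem_ker]; exact Units.ext h1, rfl⟩
    have hn : IsNilpotent ((g : Mat n) - 1) := by
      refine gr.isNilpotent_of_pr_eq_zero (gr.par.sub_mem (hw.isPar hg) gr.par.one_mem) ?_
      rw [map_sub, h1, gr.pr_one, sub_self]
    obtain ⟨N, hN, rfl⟩ := exists_expGL_eq_of_isNilpotent hgU hn
    refine expGL_mem hw.closedW (hw.mem_lieW_iff.2 ⟨?_, ?_⟩)
    · exact lieAlgebra_mono (by rintro _ ⟨x, _, rfl⟩; exact x.2) hN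
    · have hU : ∀ x, x ∈ U ↔ x ∈ P ∧ gr.pr (x : Mat n) = 1 := by
        refine fun x => ⟨?_, fun h => ⟨⟨x, h.1⟩, Units.ext h.2, rfl⟩⟩
        rintro ⟨x, hx, rfl⟩
        exact ⟨x.2, congrArg Units.val (MonoidHom.mem_ker.1 hx)⟩
      have hclosed : IsZariskiClosed ℂ (U : Set (GL (Fin n) ℂ)) := by
        have h2 := hw.closed.inter (isZariskiClosed_linear_preimage gr.pr
          (Set.range fun ij => MvPolynomial.X ij - MvPolynomial.C ((1 : Mat n) ij.1 ij.2)))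
        convert h2 using 1
        ext x
        rw [SetLike.mem_coe, hU]
        simp only [Set.mem_inter_iff, SetLike.mem_coe, Set.mem_ofPred_eq, Set.forall_mem_range, ev,
          map_sub, MvPolynomial.eval_X, MvPolynomial.eval_C, sub_eq_zero]
        exact and_congr_right fun _ => ⟨fun h ij => by rw [h], fun h => Matrix.ext fun i j => h (i, j)⟩
      have hd : HasDerivAt (fun t : ℂ => gr.pr (exp (t • N))) (gr.pr N) 0 :=
        (LinearMap.toContinuousLinearMap gr.pr).hasFDerivAt.comp_hasDerivAt 0
          ((hasDerivAt_exp_smul N 0).congr_deriv (by simp))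
      have h2 : (fun t : ℂ => gr.pr (exp (t • N))) = fun _ => 1 :=
        funext fun t => ((hU _).1 (expGL_smul_mem hclosed hN t)).2
      rw [h2] at hd
      exact hd.unique (hasDerivAt_const _ _)

theorem exists_lieW_exp {w : GL (Fin n) ℂ} (h : w ∈ W) : ∃ N ∈ lieAlgebra W, expGL N = w :=
  exists_expGL_eq_of_isNilpotent h (hw.unipotent w h)

/-- `Lie W` is an ideal of `Lie P`. -/
theorem bracket_mem_lieW {X Y : Mat n} (hX : X ∈ lieAlgebra P) (hY : Y ∈ lieAlgebra W) :
    X * Y - Y * X ∈ lieAlgebra W := by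
  rw [hw.mem_lieW_iff] at hY ⊢
  refine ⟨bracket_mem_lieAlgebra hw.closed hX hY.1, ?_⟩
  rw [map_sub, gr.pr_mul (hw.isPar_lie hX) (hw.isPar_lie hY.1),
    gr.pr_mul (hw.isPar_lie hY.1) (hw.isPar_lie hX), hY.2, mul_zero, zero_mul, sub_zero]

/-- `Lie W` is commutative. -/
theorem commute_lieW {X Y : Mat n} (hX : X ∈ lieAlgebra W) (hY : Y ∈ lieAlgebra W) :
    Commute X Y := by
  have h1 := hw.isOne _ (hw.bracket_mem_lieW (lieAlgebra_mono hw.le hX) hY)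
  -- A product of two matrices of weight 1 has weight 2, while the bracket lies in `Lie W` and so
  -- has weight 1. Hence the bracket is zero.
  have key : ∀ {X Y : Mat n}, gr.IsOne X → gr.IsOne Y → ∀ i j : Fin gr.d, (i : ℕ) = j + 1 →
      gr.E i * (X * Y) * gr.E j = 0 := by
    intro X Y hX hY i j hij
    rw [gr.E_mul_mul_E]
    refine Finset.sum_eq_zero fun k _ => ?_
    by_cases hk : (i : ℕ) = k + 1
    · rw [hY k j (by omega), mul_zero]
    · rw [hX i k hk, zero_mul]
  refine sub_eq_zero.1 (gr.eq_of_blocks fun i j => ?_)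
  rw [mul_zero, zero_mul]
  by_cases hij : (i : ℕ) = j + 1
  · rw [mul_sub, sub_mul, key (hw.isOne X hX) (hw.isOne Y hY) i j hij,
      key (hw.isOne Y hY) (hw.isOne X hX) i j hij, sub_zero]
  · exact h1 i j hij

/-- `W` acts trivially on `Lie W`. -/
theorem conj_lieW {w : GL (Fin n) ℂ} (h : w ∈ W) {X : Mat n} (hX : X ∈ lieAlgebra W) :
    (w : Mat n) * X = X * w := by
  obtain ⟨N, hN, rfl⟩ := hw.exists_lieW_exp h
  exact ((hw.commute_lieW hN hX).exp_left).eq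

/-- The centralizer of the cocharacter. -/
def levi : Subgroup (GL (Fin n) ℂ) := hw.prHom.range

theorem levi_le : hw.levi ≤ P := by
  rintro _ ⟨g, rfl⟩
  exact hw.prHom_mem g

theorem mem_levi_iff {g : GL (Fin n) ℂ} : g ∈ hw.levi ↔ g ∈ P ∧ gr.pr (g : Mat n) = g := by
  constructor
  · rintro ⟨g, rfl⟩
    exact ⟨hw.prHom_mem g, gr.pr_pr _⟩
  · rintro ⟨hg, h⟩
    exact ⟨⟨g, hg⟩, Units.ext h⟩

theorem isZariskiClosed_levi : IsZariskiClosed ℂ (hw.levi : Set (GL (Fin n) ℂ)) := by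
  have h1 := hw.closed.inter (isZariskiClosed_linear_eq_zero (gr.pr - LinearMap.id))
  convert h1 using 1
  ext g
  simp [hw.mem_levi_iff, sub_eq_zero]

/-- The Levi subgroup is the image of `P` under `pr`, which is linear in the entries; a disjoint
closed cover pulls back to `P`. -/
theorem isZariskiConnected_levi : IsZariskiConnected hw.levi := by
  intro A B hA hB hAB hdisj
  have hpre : ∀ A : Set (GL (Fin n) ℂ), IsZariskiClosed ℂ A →
      ∃ A' : Set (GL (Fin n) ℂ), IsZariskiClosed ℂ A' ∧ ∀ g : P, (g : GL (Fin n) ℂ) ∈ A' ↔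
        hw.prHom g ∈ A := by
    rintro A ⟨S, rfl⟩
    refine ⟨_, isZariskiClosed_linear_preimage gr.pr S, fun g => ?_⟩
    simp [ev, coe_prHom]
  obtain ⟨A', hA', hA''⟩ := hpre A hA
  obtain ⟨B', hB', hB''⟩ := hpre B hB
  have h := hw.connected A' B' hA' hB' (fun g hg => ?_) ?_
  · rcases h with h | h
    · left
      rintro _ ⟨g, rfl⟩
      exact (hA'' g).1 (h g.2)
    · right
      rintro _ ⟨g, rfl⟩
      exact (hB'' g).1 (h g.2)
  · exact (hAB ⟨⟨g, hg⟩, rfl⟩).imp (hA'' ⟨g, hg⟩).2 (hB'' ⟨g, hg⟩).2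
  · refine Set.eq_empty_of_forall_notMem ?_
    rintro g ⟨hg, h1, h2⟩
    exact Set.notMem_empty (hw.prHom ⟨g, hg⟩)
      (hdisj ▸ ⟨⟨⟨g, hg⟩, rfl⟩, (hA'' ⟨g, hg⟩).1 h1, (hB'' ⟨g, hg⟩).1 h2⟩)

theorem mem_lie_levi_iff {X : Mat n} :
    X ∈ lieAlgebra hw.levi ↔ X ∈ lieAlgebra P ∧ gr.pr X = X := by
  constructor
  · intro hX
    refine ⟨lieAlgebra_mono hw.levi_le hX, ?_⟩
    have hd : HasDerivAt (fun t : ℂ => exp (t • X)) X 0 :=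
      (hasDerivAt_exp_smul X 0).congr_deriv (by simp)
    have hd2 : HasDerivAt (fun t : ℂ => gr.pr (exp (t • X))) (gr.pr X) 0 :=
      (LinearMap.toContinuousLinearMap gr.pr).hasFDerivAt.comp_hasDerivAt 0 hd
    refine hd2.unique (hd.congr_of_eventuallyEq (Eventually.of_forall fun t => ?_))
    exact (hw.mem_levi_iff.1 (expGL_smul_mem hw.isZariskiClosed_levi hX t)).2
  · rintro ⟨hX, h⟩
    refine mem_lieAlgebra_of_expGL fun t => ?_
    refine hw.mem_levi_iff.2 ⟨expGL_smul_mem hw.closed hX _, ?_⟩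
    rw [coe_expGL, gr.pr_exp (hw.isPar_lie ((lieAlgebra P).smul_mem _ hX)), map_smul, h]

/-- The decomposition `P = W ⋊ L`. -/
theorem mul_prHom_inv_mem (g : P) : (g : GL (Fin n) ℂ) * (hw.prHom g)⁻¹ ∈ W := by
  rw [hw.mem_W_iff]
  have hm := P.mul_mem g.2 (P.inv_mem (hw.prHom_mem g))
  refine ⟨hm, ?_⟩
  have h1 : hw.prHom ⟨_, hm⟩ = hw.prHom g * (hw.prHom ⟨_, hw.prHom_mem g⟩)⁻¹ := by
    have h3 : (⟨(g : GL (Fin n) ℂ) * (hw.prHom g)⁻¹, hm⟩ : P) = g * ⟨hw.prHom g, hw.prHom_mem g⟩⁻¹ :=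
      rfl
    rw [h3, map_mul, map_inv]
  have h2 : hw.prHom ⟨_, hw.prHom_mem g⟩ = hw.prHom g := Units.ext (gr.pr_pr _)
  rw [h2, mul_inv_cancel] at h1
  exact congrArg Units.val h1

end IsWeighted

end Kuga
end

/-! ### Representations of compact Lie algebras and the Casimir operator -/

open Matrix
noncomputable section
namespace Kuga
open Module.End

section CompactRep

variable {K M : Type*} [NormedAddCommGroup K] [InnerProductSpace ℝ K] [FiniteDimensional ℝ K]
  [AddCommGroup M] [Module ℂ M] [FiniteDimensional ℂ M]

/-- A complex representation of a perfect real Lie algebra (with bracket `br`) whose adjoint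
representation is skew for the inner product. -/
structure IsCompactRep (br : K →ₗ[ℝ] K →ₗ[ℝ] K) (ρ : K →+ Module.End ℂ M) : Prop where
  skew : ∀ x y z, inner ℝ (br x y) z = -inner ℝ y (br x z)
  span_br : Submodule.span ℝ {z | ∃ x y, br x y = z} = ⊤
  map_smul : ∀ (c : ℝ) x, ρ (c • x) = (c : ℂ) • ρ x
  map_br : ∀ x y, ρ (br x y) = ρ x * ρ y - ρ y * ρ x

-- An eigenvector `Y` of `ad A` shifts generalized eigenspaces, because `(A - μ - c) Y = Y (A - μ)`.
omit [FiniteDimensional ℂ M] in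
theorem map_maxGenEigenspace_of_comm {A Y : Module.End ℂ M} {c μ : ℂ}
    (h : A * Y - Y * A = c • Y) {v : M} (hv : v ∈ maxGenEigenspace A μ) :
    Y v ∈ maxGenEigenspace A (μ + c) := by
  rw [mem_maxGenEigenspace] at hv ⊢
  obtain ⟨k, hk⟩ := hv
  refine ⟨k, ?_⟩
  have h1 : (A - (μ + c) • 1) * Y = Y * (A - μ • 1) := by
    rw [sub_mul, mul_sub, smul_mul_assoc, mul_smul_comm, one_mul, mul_one, add_smul, ← h]
    abel
  have h2 : ∀ k : ℕ, (A - (μ + c) • 1) ^ k * Y = Y * (A - μ • 1) ^ k := by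
    intro k
    induction k with
    | zero => simp
    | succ k ih => rw [pow_succ, mul_assoc, h1, ← mul_assoc, ih, mul_assoc, ← pow_succ]
  have h3 := LinearMap.congr_fun (h2 k) v
  rw [Module.End.mul_apply, Module.End.mul_apply, hk, map_zero] at h3
  exact h3

theorem exists_eigenvector_of_charpoly_root {A : Module.End ℂ M} {μ : ℂ}
    (h : μ ∈ (LinearMap.charpoly A).roots) : ∃ v, v ≠ 0 ∧ A v = μ • v := by
  have h1 := (Module.End.hasEigenvalue_iff_isRoot_charpoly A μ).2
    (Polynomial.isRoot_of_mem_roots h)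
  obtain ⟨v, hv⟩ := h1.exists_hasEigenvector
  exact ⟨v, hv.2, hv.apply_eq_smul⟩

theorem trace_eq_sum_roots (A : Module.End ℂ M) :
    LinearMap.trace ℂ M A = (LinearMap.charpoly A).roots.sum :=
  Module.End.trace_eq_sum_roots_charpoly_of_splits (IsAlgClosed.splits _)

/-- The eigenvalues of `A ^ 2` are squares of imaginary numbers, hence real and nonpositive. If
their sum vanishes then all of them do, and `A ^ 2` is nilpotent. -/
theorem re_trace_sq_nonpos {A : Module.End ℂ M} (hA : ∀ (μ : ℂ) (v : M), v ≠ 0 → A v = μ • v → μ.re = 0) :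
    (LinearMap.trace ℂ M (A ^ 2)).re ≤ 0 ∧
      ((LinearMap.trace ℂ M (A ^ 2)).re = 0 → IsNilpotent A) := by
  have hroot : ∀ ν ∈ (LinearMap.charpoly (A ^ 2)).roots, ν.im = 0 ∧ ν.re ≤ 0 := by
    intro ν hν
    have h1 : ν ∈ spectrum ℂ (A ^ 2) := Module.End.hasEigenvalue_iff_mem_spectrum.1
      ((Module.End.hasEigenvalue_iff_isRoot_charpoly _ ν).2 (Polynomial.isRoot_of_mem_roots hν))
    rw [spectrum.map_pow_of_pos A two_pos] at h1
    obtain ⟨μ, hμ, rfl⟩ := h1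
    obtain ⟨v, hv⟩ := (Module.End.hasEigenvalue_iff_mem_spectrum.2 hμ).exists_hasEigenvector
    have h2 := hA μ v hv.2 hv.apply_eq_smul
    constructor
    · simp [pow_two, h2]
    · simp only [pow_two, Complex.mul_re, h2, zero_mul, zero_sub, neg_nonpos]
      exact mul_self_nonneg _
  have hsum : ∀ s : Multiset ℂ, (∀ ν ∈ s, ν.im = 0 ∧ ν.re ≤ 0) →
      s.sum.re ≤ 0 ∧ (s.sum.re = 0 → ∀ ν ∈ s, ν = 0) := by
    intro s
    induction s using Multiset.induction with
    | empty => simp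
    | cons a s ih =>
      intro h
      have h1 := ih fun ν hν => h ν (Multiset.mem_cons_of_mem hν)
      have h2 := h a (Multiset.mem_cons_self a s)
      rw [Multiset.sum_cons, Complex.add_re]
      refine ⟨by linarith, fun h3 ν hν => ?_⟩
      rcases Multiset.mem_cons.1 hν with rfl | hν
      · exact Complex.ext (by simp; linarith) h2.1
      · exact h1.2 (by linarith) ν hν
  rw [trace_eq_sum_roots]
  refine ⟨(hsum _ hroot).1, fun h0 => ?_⟩
  have h1 := (hsum _ hroot).2 h0
  have h2 : IsNilpotent (A ^ 2) := by
    rw [LinearMap.isNilpotent_iff_charpoly]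
    have h3 := (IsAlgClosed.splits (LinearMap.charpoly (A ^ 2))).eq_prod_roots_of_monic
      (LinearMap.charpoly_monic _)
    have h4 : (LinearMap.charpoly (A ^ 2)).roots =
        Multiset.replicate (Module.finrank ℂ M) 0 := by
      rw [Multiset.eq_replicate]
      refine ⟨?_, h1⟩
      rw [← (IsAlgClosed.splits _).natDegree_eq_card_roots, LinearMap.charpoly_natDegree]
    rw [h3, h4]
    simp
  exact by
    obtain ⟨k, hk⟩ := h2
    exact ⟨2 * k, by rw [pow_mul, hk]⟩

/-- The Casimir element. -/
def casimir (ρ : K →+ Module.End ℂ M) : Module.End ℂ M := ∑ i, ρ (stdOrthonormalBasis ℝ K i) ^ 2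

namespace IsCompactRep

variable {br : K →ₗ[ℝ] K →ₗ[ℝ] K} {ρ : K →+ Module.End ℂ M} (hρ : IsCompactRep br ρ)
include hρ

omit [FiniteDimensional ℂ M] in
/-- The endomorphisms `ρ y` are sums of eigenvectors of `ad (ρ x)` with imaginary eigenvalues. -/
theorem span_ad_eigenvectors (x : K) (Z : Submodule ℂ (Module.End ℂ M))
    (hZ : ∀ (m : ℝ) (Y : Module.End ℂ M), ρ x * Y - Y * ρ x = (m * Complex.I) • Y → Y ∈ Z) (y : K) :
    ρ y ∈ Z := by
  -- `ad x` is skew, so its square is symmetric and has an orthonormal eigenbasis; the eigenvalue at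
  -- `b i` is `-m ^ 2` with `m = ‖[x, b i]‖`.
  let S : K →ₗ[ℝ] K := (br x).comp (br x)
  have hS : S.IsSymmetric := by
    intro y z
    rw [LinearMap.comp_apply, LinearMap.comp_apply, hρ.skew, hρ.skew, neg_neg]
  let b := hS.eigenvectorBasis rfl
  have hb : ∀ i, ρ (b i) ∈ Z := by
    intro i
    have hSb : S (b i) = (hS.eigenvalues rfl i : ℝ) • b i := hS.apply_eigenvectorBasis rfl i
    set s : ℝ := hS.eigenvalues rfl i with hs
    have h1 : s = -‖br x (b i)‖ ^ 2 := by
      rw [← real_inner_self_eq_norm_sq, ← neg_eq_iff_eq_neg, neg_eq_iff_eq_neg, hρ.skew, neg_neg]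
      change s = inner ℝ (b i) (S (b i))
      rw [hSb, inner_smul_right, real_inner_self_eq_norm_sq, b.orthonormal.1 i]
      simp
    set m := ‖br x (b i)‖ with hm
    by_cases hm0 : m = 0
    · refine hZ 0 _ ?_
      rw [← hρ.map_br, norm_eq_zero.1 hm0]
      simp
    · have hm0' : (m : ℂ) ≠ 0 := Complex.ofReal_ne_zero.2 hm0
      have h2 : ρ x * ρ (b i) - ρ (b i) * ρ x = ρ (br x (b i)) := (hρ.map_br _ _).symm
      have h3 : ρ x * ρ (br x (b i)) - ρ (br x (b i)) * ρ x = (-(m : ℂ) ^ 2) • ρ (b i) := by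
        rw [← hρ.map_br]
        change ρ (S (b i)) = _
        rw [hSb, hρ.map_smul, h1]
        simp
      -- This element and the one in `hn` are eigenvectors of `ad (ρ x)` for `m i` and `-m i`, and
      -- their mean is `ρ (b i)`.
      have hp := hZ m (ρ (b i) - (Complex.I / m) • ρ (br x (b i))) (by
        rw [mul_sub, sub_mul, mul_smul_comm, smul_mul_assoc, sub_sub_sub_comm, h2, ← smul_sub, h3,
          smul_sub, smul_smul, smul_smul, sub_eq_sub_iff_add_eq_add, add_comm (ρ (br x (b i)))]
        have e1 : (m : ℂ) * Complex.I * (Complex.I / m) = -1 := by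
          field_simp
          simp
        have e2 : (Complex.I / m) * (-(m : ℂ) ^ 2) = - (m * Complex.I) := by
          field_simp
        rw [e1, e2, neg_smul, neg_smul, one_smul]
        abel)
      have hn := hZ (-m) (ρ (b i) + (Complex.I / m) • ρ (br x (b i))) (by
        rw [mul_add, add_mul, mul_smul_comm, smul_mul_assoc, add_sub_add_comm, h2, ← smul_sub, h3,
          smul_add, smul_smul, smul_smul]
        have e1 : ((-m : ℝ) : ℂ) * Complex.I * (Complex.I / m) = 1 := by
          push_cast
          field_simp
          simp
        have e2 : (Complex.I / m) * (-(m : ℂ) ^ 2) = ((-m : ℝ) : ℂ) * Complex.I := by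
          push_cast
          field_simp
        rw [e1, e2, one_smul, add_comm])
      have h4 := Z.smul_mem (1 / 2 : ℂ) (Z.add_mem hp hn)
      rw [sub_add_add_cancel, ← two_smul ℂ (ρ (b i)), smul_smul] at h4
      simpa using h4
  rw [← b.sum_repr y, map_sum]
  refine Z.sum_mem fun i _ => ?_
  rw [hρ.map_smul]
  exact Z.smul_mem _ (hb i)

omit [FiniteDimensional ℂ M] [FiniteDimensional ℝ K] in
/-- A linear statement about all `ρ x` only has to be verified for brackets. -/
theorem forall_of_br (Z : Submodule ℂ (Module.End ℂ M))
    (hZ : ∀ x y, ρ x * ρ y - ρ y * ρ x ∈ Z) (x : K) : ρ x ∈ Z := by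
  have hx : x ∈ Submodule.span ℝ {z | ∃ x y, br x y = z} := by
    rw [hρ.span_br]; trivial
  induction hx using Submodule.span_induction with
  | mem z hz =>
    obtain ⟨x, y, rfl⟩ := hz
    rw [hρ.map_br]
    exact hZ x y
  | zero => rw [map_zero]; exact Z.zero_mem
  | add x y _ _ h1 h2 => rw [map_add]; exact Z.add_mem h1 h2
  | smul c x _ h => rw [hρ.map_smul]; exact Z.smul_mem _ h

/-- Let `F` be the sum of the generalized eigenspaces of `ρ x` whose eigenvalues have the same real
part as `μ`. It is stable under all `ρ y`, since these are sums of operators shifting eigenvalues by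
imaginary amounts. On `F` every `ρ y` has trace zero, as the Lie algebra is spanned by brackets; but
the trace of `ρ x` on `F` has real part `dim F * μ.re`. -/
theorem eigenvalue_re (x : K) {μ : ℂ} {v : M} (hv : v ≠ 0) (h : ρ x v = μ • v) : μ.re = 0 := by
  let F : Submodule ℂ M := ⨆ ν : {ν : ℂ // ν.re = μ.re}, maxGenEigenspace (ρ x) ν
  have hvF : v ∈ F := by
    refine Submodule.mem_iSup_of_mem ⟨μ, rfl⟩ ?_
    rw [mem_maxGenEigenspace]
    exact ⟨1, by simp [h]⟩
  have hstab : ∀ y, ∀ u ∈ F, ρ y u ∈ F := by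
    intro y
    let Z : Submodule ℂ (Module.End ℂ M) :=
      { carrier := {Y | ∀ u ∈ F, Y u ∈ F}
        zero_mem' := fun u _ => F.zero_mem
        add_mem' := fun hA hB u hu => F.add_mem (hA u hu) (hB u hu)
        smul_mem' := fun c A hA u hu => F.smul_mem c (hA u hu) }
    refine hρ.span_ad_eigenvectors x Z (fun m Y hY u hu => ?_) y
    refine Submodule.iSup_induction (motive := fun u => Y u ∈ F) _ hu ?_ ?_ ?_
    · intro ν u hu
      refine Submodule.mem_iSup_of_mem ⟨ν + m * Complex.I, ?_⟩ (map_maxGenEigenspace_of_comm hY hu)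
      simp [ν.2]
    · rw [map_zero]; exact F.zero_mem
    · intro a b ha hb
      rw [map_add]
      exact F.add_mem ha hb
  have htr : ∀ y, LinearMap.trace ℂ F ((ρ y).restrict (hstab y)) = 0 := by
    let Z : Submodule ℂ (Module.End ℂ M) :=
      { carrier := {Y | ∃ hY : ∀ u ∈ F, Y u ∈ F, LinearMap.trace ℂ F (Y.restrict hY) = 0}
        zero_mem' := ⟨fun u _ => F.zero_mem, by
          have : (0 : Module.End ℂ M).restrict (fun u (_ : u ∈ F) => F.zero_mem) = 0 := by
            ext; rfl
          rw [this, map_zero]⟩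
        add_mem' := by
          rintro A B ⟨hA, hA'⟩ ⟨hB, hB'⟩
          refine ⟨fun u hu => F.add_mem (hA u hu) (hB u hu), ?_⟩
          have : (A + B).restrict (fun u hu => F.add_mem (hA u hu) (hB u hu)) =
            A.restrict hA + B.restrict hB := by ext; rfl
          rw [this, map_add, hA', hB', add_zero]
        smul_mem' := by
          rintro c A ⟨hA, hA'⟩
          refine ⟨fun u hu => F.smul_mem c (hA u hu), ?_⟩
          have : (c • A).restrict (fun u hu => F.smul_mem c (hA u hu)) =
            c • A.restrict hA := by ext; rfl
          rw [this, _root_.map_smul, hA', smul_zero] }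
    intro y
    have h1 := hρ.forall_of_br Z (fun a b => ?_) y
    · exact h1.2
    · refine ⟨fun u hu => F.sub_mem (hstab a _ (hstab b _ hu)) (hstab b _ (hstab a _ hu)), ?_⟩
      have : (ρ a * ρ b - ρ b * ρ a).restrict
          (fun u hu => F.sub_mem (hstab a _ (hstab b _ hu)) (hstab b _ (hstab a _ hu))) =
          (ρ a).restrict (hstab a) * (ρ b).restrict (hstab b) -
            (ρ b).restrict (hstab b) * (ρ a).restrict (hstab a) := by ext; rfl
      rw [this, map_sub, LinearMap.trace_mul_comm, sub_self]
  have hroots : ∀ ν ∈ (LinearMap.charpoly ((ρ x).restrict (hstab x))).roots, ν.re = μ.re := by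
    intro ν hν
    obtain ⟨u, hu, huν⟩ := exists_eigenvector_of_charpoly_root hν
    by_contra hne
    have hdis := (Module.End.independent_maxGenEigenspace (ρ x)) ν
    have h1 : (u : M) ∈ maxGenEigenspace (ρ x) ν := by
      rw [mem_maxGenEigenspace]
      refine ⟨1, ?_⟩
      have := congrArg Subtype.val huν
      simpa [sub_eq_zero] using this
    have h2 : (u : M) ∈ ⨆ ν' : ℂ, ⨆ (_ : ν' ≠ ν), maxGenEigenspace (ρ x) ν' := by
      refine (iSup_le fun ν' => ?_ : F ≤ _) u.2
      refine le_iSup_of_le (ν' : ℂ) (le_iSup_of_le ?_ le_rfl)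
      rintro h
      exact hne (h ▸ ν'.2)
    exact hu (Subtype.ext (Submodule.disjoint_def.1 hdis _ h1 h2))
  have h0 := htr x
  rw [trace_eq_sum_roots] at h0
  have hsum : ∀ s : Multiset ℂ, (∀ ν ∈ s, ν.re = μ.re) → s.sum.re = Multiset.card s * μ.re := by
    intro s
    induction s using Multiset.induction with
    | empty => simp
    | cons a s ih =>
      intro h
      rw [Multiset.sum_cons, Complex.add_re, h a (Multiset.mem_cons_self a s),
        ih fun ν hν => h ν (Multiset.mem_cons_of_mem hν), Multiset.card_cons]
      push_cast
      ring
  have h1 := hsum _ hroots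
  rw [h0, ← (IsAlgClosed.splits _).natDegree_eq_card_roots, LinearMap.charpoly_natDegree] at h1
  have h2 : Module.finrank ℂ F ≠ 0 := by
    have : Nontrivial F := ⟨⟨⟨v, hvF⟩, 0, fun h => hv (congrArg Subtype.val h)⟩⟩
    exact Module.finrank_pos.ne'
  rw [Complex.zero_re, eq_comm, mul_eq_zero] at h1
  exact h1.resolve_left (by exact_mod_cast h2)

-- If `ρ x` is nilpotent, its only generalized eigenspace is that of `0`, so an eigenvector of `ad
-- (ρ x)` with nonzero eigenvalue has nowhere to map to and vanishes. Thus `ρ x` commutes with every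
-- `ρ y`, and perfectness finishes the argument.
omit [FiniteDimensional ℂ M] in
theorem eq_zero_of_isNilpotent (h : ∀ x, IsNilpotent (ρ x)) (x : K) : ρ x = 0 := by
  have hbr : ∀ x y, ρ (br x y) = 0 := by
    intro x y
    let Z : Submodule ℂ (Module.End ℂ M) :=
      { carrier := {Y | ρ x * Y - Y * ρ x = 0}
        zero_mem' := by simp
        add_mem' := by
          intro A B hA hB
          rw [Set.mem_ofPred_eq] at *
          rw [mul_add, add_mul, add_sub_add_comm, hA, hB, add_zero]
        smul_mem' := by
          intro c A hA
          rw [Set.mem_ofPred_eq] at *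
          rw [mul_smul_comm, smul_mul_assoc, ← smul_sub, hA, smul_zero] }
    rw [hρ.map_br]
    refine hρ.span_ad_eigenvectors x Z (fun m Y hY => ?_) y
    change _ = _
    rw [hY]
    by_cases hm : m = 0
    · simp [hm]
    · have : Y = 0 := by
        ext v
        obtain ⟨k, hk⟩ := h x
        have hv : ∀ v, v ∈ maxGenEigenspace (ρ x) 0 := fun v => by
          rw [mem_maxGenEigenspace]
          exact ⟨k, by simp [hk]⟩
        have h1 := map_maxGenEigenspace_of_comm hY (hv v)
        rw [zero_add] at h1
        have hne : (0 : ℂ) ≠ m * Complex.I := by simp [hm]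
        exact Submodule.disjoint_def.1
          ((Module.End.independent_maxGenEigenspace (ρ x)).pairwiseDisjoint hne) _ (hv _) h1
      rw [this, smul_zero]
  have := hρ.forall_of_br ⊥ (fun x y => by rw [← hρ.map_br, hbr]; exact Submodule.zero_mem _) x
  simpa using this

-- In an orthonormal basis the matrix of `ad x` is antisymmetric, and the terms of the commutator
-- cancel in pairs.
omit [FiniteDimensional ℂ M] in
theorem casimir_comm (x : K) : ρ x * casimir ρ = casimir ρ * ρ x := by
  let e := stdOrthonormalBasis ℝ K
  let a : _ → _ → ℝ := fun j i => inner ℝ (e j) (br x (e i))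
  have hanti : ∀ i j, a j i = - a i j := fun i j => by
    change inner ℝ (e j) (br x (e i)) = - inner ℝ (e i) (br x (e j))
    rw [real_inner_comm, hρ.skew]
  have hrep : ∀ i, ρ (br x (e i)) = ∑ j, (a j i : ℂ) • ρ (e j) := by
    intro i
    conv_lhs => rw [← e.sum_repr' (br x (e i)), map_sum]
    exact Finset.sum_congr rfl fun j _ => hρ.map_smul _ _
  rw [← sub_eq_zero]
  have h1 : ρ x * casimir ρ - casimir ρ * ρ x =
      ∑ i, (ρ (br x (e i)) * ρ (e i) + ρ (e i) * ρ (br x (e i))) := by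
    rw [casimir, Finset.mul_sum, Finset.sum_mul, ← Finset.sum_sub_distrib]
    refine Finset.sum_congr rfl fun i _ => ?_
    change ρ x * ρ (e i) ^ 2 - ρ (e i) ^ 2 * ρ x = _
    rw [hρ.map_br]
    noncomm_ring
  rw [h1, Finset.sum_add_distrib]
  have h2 : ∑ i, ρ (br x (e i)) * ρ (e i) = ∑ i, ∑ j, (a j i : ℂ) • (ρ (e j) * ρ (e i)) := by
    refine Finset.sum_congr rfl fun i _ => ?_
    rw [hrep, Finset.sum_mul]
    simp only [smul_mul_assoc]
  have h3 : ∑ i, ρ (e i) * ρ (br x (e i)) = ∑ i, ∑ j, (a i j : ℂ) • (ρ (e j) * ρ (e i)) := by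
    rw [Finset.sum_comm]
    refine Finset.sum_congr rfl fun i _ => ?_
    rw [hrep, Finset.mul_sum]
    simp only [mul_smul_comm]
  rw [h2, h3, ← Finset.sum_add_distrib]
  refine Finset.sum_eq_zero fun i _ => ?_
  rw [← Finset.sum_add_distrib]
  refine Finset.sum_eq_zero fun j _ => ?_
  rw [hanti i j]
  push_cast
  rw [neg_smul, neg_add_cancel]

/-- The trace of the Casimir element is a sum of terms with nonpositive real part. If it is zero,
each term has real part zero, and every `ρ x` turns out to be nilpotent. -/
theorem eq_zero_of_casimir (h : IsNilpotent (casimir ρ)) (x : K) : ρ x = 0 := by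
  have hneg := fun x => re_trace_sq_nonpos fun μ v hv hμ => hρ.eigenvalue_re x (μ := μ) hv hμ
  have h0 : ∀ i, (LinearMap.trace ℂ M (ρ (stdOrthonormalBasis ℝ K i) ^ 2)).re = 0 := by
    have h1 := (LinearMap.isNilpotent_trace_of_isNilpotent h).eq_zero
    rw [casimir, map_sum] at h1
    have h2 := congrArg Complex.re h1
    rw [Complex.re_sum, Complex.zero_re] at h2
    intro i
    exact (Finset.sum_eq_zero_iff_of_nonpos fun i _ => (hneg _).1).1 h2 i (Finset.mem_univ i)
  have hall : ∀ x, (LinearMap.trace ℂ M (ρ x ^ 2)).re = 0 := by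
    intro x
    have hx : x ∈ Submodule.span ℝ (Set.range (stdOrthonormalBasis ℝ K)) := by
      rw [← (stdOrthonormalBasis ℝ K).coe_toBasis, Module.Basis.span_eq]
      trivial
    induction hx using Submodule.span_induction with
    | mem x hx =>
      obtain ⟨i, rfl⟩ := hx
      exact h0 i
    | zero => simp
    | smul c x _ ih =>
      rw [hρ.map_smul, smul_pow, _root_.map_smul, smul_eq_mul, ← Complex.ofReal_pow,
        Complex.re_ofReal_mul, ih, mul_zero]
    | add x y _ _ h1 h2 =>
      -- By the parallelogram law the traces for `x + y` and `x - y` have real parts summing to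
      -- zero. Both are nonpositive, so both vanish.
      have h3 : ρ (x + y) ^ 2 + ρ (x - y) ^ 2 = ρ x ^ 2 + ρ x ^ 2 + (ρ y ^ 2 + ρ y ^ 2) := by
        rw [map_add, map_sub]
        noncomm_ring
      have h4 := congrArg (fun A => (LinearMap.trace ℂ M A).re) h3
      simp only [map_add, Complex.add_re, h1, h2] at h4
      have := (hneg (x + y)).1
      have := (hneg (x - y)).1
      rw [map_add] at *
      linarith
  exact hρ.eq_zero_of_isNilpotent (fun x => (hneg x).2 (hall x)) x

omit [FiniteDimensional ℝ K] [FiniteDimensional ℂ M] in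
/-- The representation on a stable subspace. -/
theorem restrict {F : Submodule ℂ M} (hF : ∀ x, ∀ u ∈ F, ρ x u ∈ F) :
    ∃ σ : K →+ Module.End ℂ F, IsCompactRep br σ ∧ ∀ x (u : F), (σ x u : M) = ρ x u := by
  let σ : K →+ Module.End ℂ F :=
    { toFun := fun x => (ρ x).restrict (hF x)
      map_zero' := by ext; simp
      map_add' := fun x y => by ext; simp }
  refine ⟨σ, ⟨hρ.skew, hρ.span_br, fun c x => ?_, fun x y => ?_⟩, fun x u => rfl⟩
  · ext u
    exact LinearMap.congr_fun (hρ.map_smul c x) u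
  · ext u
    exact LinearMap.congr_fun (hρ.map_br x y) u

/-- If there are no invariants, then an element that is moved into a stable subspace by all
`ρ x` lies in the subspace. -/
theorem mem_of_forall_mem (hinv : ∀ v, (∀ x, ρ x v = 0) → v = 0) {N : Submodule ℂ M}
    (hN : ∀ x, ∀ u ∈ N, ρ x u ∈ N) {v : M} (hv : ∀ x, ρ x v ∈ N) : v ∈ N := by
  set c := casimir ρ with hc
  -- On this stable subspace the Casimir element is nilpotent, so the representation there is zero
  -- and its vectors are invariants.
  have hker : maxGenEigenspace c 0 = ⊥ := by
    set F := maxGenEigenspace c 0 with hF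
    have hstab : ∀ x, ∀ u ∈ F, ρ x u ∈ F := by
      intro x u hu
      have := map_maxGenEigenspace_of_comm (A := c) (Y := ρ x) (c := 0) (μ := 0) (v := u)
        (by rw [hc, hρ.casimir_comm, sub_self, zero_smul]) hu
      rwa [add_zero] at this
    obtain ⟨σ, hσ, hσρ⟩ := hρ.restrict hstab
    have hcas : ∀ u : F, (casimir σ u : M) = c u := by
      intro u
      rw [hc, casimir, casimir, LinearMap.sum_apply, LinearMap.sum_apply, AddSubmonoidClass.coe_finsetSum]
      refine Finset.sum_congr rfl fun i _ => ?_
      rw [pow_two, pow_two, Module.End.mul_apply, Module.End.mul_apply, hσρ, hσρ]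
    have hcpow : ∀ (k : ℕ) (u : F), ((casimir σ ^ k) u : M) = (c ^ k) u := by
      intro k
      induction k with
      | zero => intro u; rfl
      | succ k ih =>
        intro u
        rw [pow_succ, pow_succ, Module.End.mul_apply, Module.End.mul_apply, ih, hcas]
    have hnil : IsNilpotent (casimir σ) := by
      rw [Module.End.isNilpotent_iff_of_finite]
      intro u
      obtain ⟨k, hk⟩ := (mem_maxGenEigenspace c 0 (u : M)).1 u.2
      refine ⟨k, Subtype.ext ?_⟩
      rw [hcpow]
      simpa using hk
    rw [eq_bot_iff]
    intro u hu
    rw [Submodule.mem_bot]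
    refine hinv u fun x => ?_
    rw [← hσρ x ⟨u, hu⟩, hσ.eq_zero_of_casimir hnil x]
    rfl
  have hinj : Function.Injective c := by
    rw [← LinearMap.ker_eq_bot, eq_bot_iff, ← hker]
    intro u hu
    rw [mem_maxGenEigenspace]
    exact ⟨1, by simpa using hu⟩
  have hcmem : ∀ u, (∀ x, ρ x u ∈ N) → c u ∈ N := by
    intro u hu
    rw [hc, casimir, LinearMap.sum_apply]
    refine N.sum_mem fun i _ => ?_
    rw [pow_two, Module.End.mul_apply]
    exact hN _ _ (hu _)
  have hcN : ∀ u ∈ N, c u ∈ N := fun u hu => hcmem u fun x => hN x u hu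
  -- `c` is injective and preserves `N`, so it maps `N` onto itself. As `c v ∈ N`, injectivity gives
  -- `v ∈ N`.
  have hsurj : Function.Surjective (c.restrict hcN) := by
    refine LinearMap.injective_iff_surjective.1 fun a b hab => Subtype.ext (hinj ?_)
    exact congrArg Subtype.val hab
  obtain ⟨u, hu⟩ := hsurj ⟨c v, hcmem v hv⟩
  have := hinj (congrArg Subtype.val hu : c u = c v)
  exact this ▸ u.2

end IsCompactRep

end CompactRep

end Kuga
end

/-! ### Invariant inner products and compact real forms -/

open Matrix
noncomputable section
namespace Kuga

section Haar

open MeasureTheory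

/-- A finite-dimensional real representation of a compact group has an invariant inner product. -/
theorem exists_invariant_inner {G V : Type*} [Group G] [TopologicalSpace G] [IsTopologicalGroup G]
    [CompactSpace G] [AddCommGroup V] [Module ℝ V] [FiniteDimensional ℝ V]
    (θ : G →* Module.End ℝ V) (hθ : ∀ (v : V) (l : V →ₗ[ℝ] ℝ), Continuous fun g => l (θ g v)) :
    ∃ (d : ℕ) (e : V ≃ₗ[ℝ] EuclideanSpace ℝ (Fin d)),
      ∀ g x y, inner ℝ (e (θ g x)) (e (θ g y)) = inner ℝ (e x) (e y) := by
  let _ : MeasurableSpace G := borel G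
  have : BorelSpace G := ⟨rfl⟩
  let μ : Measure G := Measure.haar
  let B := Module.finBasis ℝ V
  let q : V → V → ℝ := fun x y => ∑ i, B.coord i x * B.coord i y
  have hqc : ∀ x y, Continuous fun g : G => q (θ g⁻¹ x) (θ g⁻¹ y) := by
    intro x y
    refine continuous_finsetSum _ fun i _ => ?_
    exact ((hθ x (B.coord i)).comp continuous_inv).mul ((hθ y (B.coord i)).comp continuous_inv)
  have hqi : ∀ x y, Integrable (fun g : G => q (θ g⁻¹ x) (θ g⁻¹ y)) μ := fun x y =>
    (hqc x y).integrable_of_hasCompactSupport (HasCompactSupport.of_compactSpace _)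
  -- The inverses turn left invariance of Haar measure into invariance of `b`, because `θ (h * g)⁻¹
  -- (θ h v) = θ g⁻¹ v`.
  let b : V → V → ℝ := fun x y => ∫ g, q (θ g⁻¹ x) (θ g⁻¹ y) ∂μ
  have hqpos : ∀ x, 0 ≤ q x x := fun x => Finset.sum_nonneg fun i _ => mul_self_nonneg _
  have hqdef : ∀ x, q x x = 0 → x = 0 := by
    intro x hx
    rw [Finset.sum_eq_zero_iff_of_nonneg fun i _ => mul_self_nonneg _] at hx
    refine B.ext_elem fun i => ?_
    have := mul_self_eq_zero.1 (hx i (Finset.mem_univ i))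
    rw [B.coord_apply] at this
    rw [this, map_zero, Finsupp.zero_apply]
  have hinv : ∀ h x y, b (θ h x) (θ h y) = b x y := by
    intro h x y
    have h1 := integral_mul_left_eq_self (μ := μ)
      (fun g => q (θ g⁻¹ (θ h x)) (θ g⁻¹ (θ h y))) h
    refine h1.symm.trans (integral_congr_ae (Filter.Eventually.of_forall fun g => ?_))
    have h2 : ∀ v, θ (h * g)⁻¹ (θ h v) = θ g⁻¹ v := by
      intro v
      rw [← Module.End.mul_apply, ← map_mul]
      congr 2
      group
    simp only [h2]
  let core : InnerProductSpace.Core ℝ V :=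
    { inner := b
      conj_inner_symm := fun x y => by
        change b y x = b x y
        exact integral_congr_ae (Filter.Eventually.of_forall fun g =>
          Finset.sum_congr rfl fun i _ => mul_comm _ _)
      re_inner_nonneg := fun x => by
        change 0 ≤ b x x
        exact integral_nonneg fun g => hqpos _
      add_left := fun x y z => by
        change b (x + y) z = b x z + b y z
        rw [← integral_add (hqi x z) (hqi y z)]
        refine integral_congr_ae (Filter.Eventually.of_forall fun g => ?_)
        simp only [q, map_add, add_mul, Finset.sum_add_distrib]
      smul_left := fun x y r => by
        change b (r • x) y = r * b x y
        rw [← integral_const_mul]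
        refine integral_congr_ae (Filter.Eventually.of_forall fun g => ?_)
        simp only [q, _root_.map_smul, smul_eq_mul, mul_assoc, Finset.mul_sum]
      definite := fun x hx => by
        by_contra hne
        have h1 := (hqc x x).integral_pos_of_hasCompactSupport_nonneg_nonzero (μ := μ) (x := 1)
          (HasCompactSupport.of_compactSpace _) (fun g => hqpos _) (by
            rw [inv_one, map_one, Module.End.one_apply]
            exact fun h => hne (hqdef x h))
        exact h1.ne' hx }
  let _ : NormedAddCommGroup V := core.toNormedAddCommGroup
  let _ : InnerProductSpace ℝ V := InnerProductSpace.ofCore core.toCore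
  refine ⟨_, (stdOrthonormalBasis ℝ V).repr.toLinearEquiv, fun g x y => ?_⟩
  change inner ℝ ((stdOrthonormalBasis ℝ V).repr _) ((stdOrthonormalBasis ℝ V).repr _) =
    inner ℝ ((stdOrthonormalBasis ℝ V).repr _) ((stdOrthonormalBasis ℝ V).repr _)
  rw [LinearIsometryEquiv.inner_map_map, LinearIsometryEquiv.inner_map_map]
  exact hinv g x y

end Haar

/-- The span of all brackets of elements of `l`. -/
def derivedLie {n : ℕ} (l : Submodule ℂ (Mat n)) : Submodule ℂ (Mat n) :=
  Submodule.span ℂ {Z | ∃ X ∈ l, ∃ Y ∈ l, X * Y - Y * X = Z}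

theorem bracket_mem_derivedLie {n : ℕ} {l : Submodule ℂ (Mat n)} {X Y : Mat n} (hX : X ∈ l)
    (hY : Y ∈ l) : X * Y - Y * X ∈ derivedLie l :=
  Submodule.subset_span ⟨X, hX, Y, hY, rfl⟩

/-- A compact real form of a Lie algebra of matrices: the image of `ι` spans `l` over `ℂ`, and
the brackets with its elements are skew for an inner product. -/
structure CompactForm {n : ℕ} (l : Submodule ℂ (Mat n)) (E : Type*) [NormedAddCommGroup E]
    [InnerProductSpace ℝ E] where
  ι : E →ₗ[ℝ] Mat n
  injective : Function.Injective ι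
  br : E →ₗ[ℝ] E →ₗ[ℝ] E
  ι_br : ∀ x y, ι (br x y) = ι x * ι y - ι y * ι x
  skew : ∀ x y z, inner ℝ (br x y) z = -inner ℝ y (br x z)
  mem : ∀ x, ι x ∈ l
  exists_add : ∀ X ∈ l, ∃ x y, X = ι x + Complex.I • ι y

namespace CompactForm

variable {n : ℕ} {l : Submodule ℂ (Mat n)} {E : Type*} [NormedAddCommGroup E]
  [InnerProductSpace ℝ E] [FiniteDimensional ℝ E] (κ : CompactForm l E)

/-- The derived algebra of the compact form. -/
def derived : Submodule ℝ E := Submodule.span ℝ {z | ∃ x y, κ.br x y = z}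

omit [FiniteDimensional ℝ E] in
theorem br_mem_derived (x y : E) : κ.br x y ∈ κ.derived := Submodule.subset_span ⟨x, y, rfl⟩

omit [FiniteDimensional ℝ E] in
theorem br_neg (x y : E) : κ.br x y = -κ.br y x := by
  refine κ.injective ?_
  rw [map_neg, κ.ι_br, κ.ι_br, neg_sub]

-- By skewness `‖[y, x]‖ ^ 2 = -⟨x, [y, [y, x]]⟩ = 0`. Thus the orthogonal complement of the derived
-- algebra is central.
omit [FiniteDimensional ℝ E] in
theorem br_eq_zero {x : E} (hx : x ∈ κ.derivedᗮ) (y : E) : κ.br y x = 0 := by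
  rw [← inner_self_eq_zero (𝕜 := ℝ), κ.skew]
  rw [neg_eq_zero, real_inner_comm]
  exact Submodule.inner_right_of_mem_orthogonal (κ.br_mem_derived y (κ.br y x)) hx

omit [FiniteDimensional ℝ E] in
theorem ι_mem_derivedLie {x : E} (hx : x ∈ κ.derived) : κ.ι x ∈ derivedLie l := by
  induction hx using Submodule.span_induction with
  | mem z hz =>
    obtain ⟨x, y, rfl⟩ := hz
    rw [κ.ι_br]
    exact bracket_mem_derivedLie (κ.mem x) (κ.mem y)
  | zero => rw [map_zero]; exact Submodule.zero_mem _
  | add x y _ _ h1 h2 => rw [map_add]; exact Submodule.add_mem _ h1 h2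
  | smul c x _ h => rw [_root_.map_smul]; exact Submodule.smul_of_tower_mem _ c h

omit [FiniteDimensional ℝ E] in
theorem comm_of_mem_orthogonal {x : E} (hx : x ∈ κ.derivedᗮ) {Y : Mat n} (hY : Y ∈ l) :
    κ.ι x * Y = Y * κ.ι x := by
  have h : ∀ y, κ.ι x * κ.ι y = κ.ι y * κ.ι x := by
    intro y
    have := κ.ι_br y x
    rw [κ.br_eq_zero hx, map_zero] at this
    exact (sub_eq_zero.1 this.symm).symm
  obtain ⟨a, b, rfl⟩ := κ.exists_add Y hY
  rw [mul_add, add_mul, h, Matrix.mul_smul, Matrix.smul_mul, h]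

include κ in
/-- A Lie algebra with a compact form is the sum of its center and its derived algebra. -/
theorem exists_central_add {X : Mat n} (hX : X ∈ l) :
    ∃ Z ∈ l, (∀ Y ∈ l, Z * Y = Y * Z) ∧ X - Z ∈ derivedLie l := by
  have key : ∀ x, ∃ z ∈ κ.derivedᗮ, x - z ∈ κ.derived := by
    intro x
    refine ⟨x - κ.derived.orthogonalProjectionOnto x, ?_, ?_⟩
    · exact Submodule.sub_starProjection_mem_orthogonal (K := κ.derived) x
    · rw [sub_sub_cancel]
      exact (κ.derived.orthogonalProjectionOnto x).2
  obtain ⟨x, y, rfl⟩ := κ.exists_add X hX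
  obtain ⟨z, hz, hxz⟩ := key x
  obtain ⟨u, hu, hyu⟩ := key y
  refine ⟨κ.ι z + Complex.I • κ.ι u, l.add_mem (κ.mem z) (l.smul_mem _ (κ.mem u)), ?_, ?_⟩
  · intro Y hY
    rw [mul_add, add_mul, κ.comm_of_mem_orthogonal hz hY, Matrix.mul_smul, Matrix.smul_mul,
      κ.comm_of_mem_orthogonal hu hY]
  · rw [add_sub_add_comm, ← smul_sub, ← map_sub, ← map_sub]
    exact Submodule.add_mem _ (κ.ι_mem_derivedLie hxz)
      (Submodule.smul_mem _ _ (κ.ι_mem_derivedLie hyu))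

omit [FiniteDimensional ℝ E] in
theorem comm_derivedLie {X : Mat n} (h : ∀ x ∈ κ.derived, κ.ι x * X = X * κ.ι x) {Y : Mat n}
    (hY : Y ∈ derivedLie l) : Y * X = X * Y := by
  induction hY using Submodule.span_induction with
  | mem Y hY =>
    obtain ⟨A, hA, B, hB, rfl⟩ := hY
    obtain ⟨a, a', rfl⟩ := κ.exists_add A hA
    obtain ⟨b, b', rfl⟩ := κ.exists_add B hB
    have h' : ∀ a b, (κ.ι a * κ.ι b - κ.ι b * κ.ι a) * X = X * (κ.ι a * κ.ι b - κ.ι b * κ.ι a) :=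
      fun a b => by
        rw [← κ.ι_br]
        exact h _ (κ.br_mem_derived a b)
    have e : (κ.ι a + Complex.I • κ.ι a') * (κ.ι b + Complex.I • κ.ι b') -
        (κ.ι b + Complex.I • κ.ι b') * (κ.ι a + Complex.I • κ.ι a') =
        (κ.ι a * κ.ι b - κ.ι b * κ.ι a) + Complex.I • (κ.ι a * κ.ι b' - κ.ι b' * κ.ι a) +
        Complex.I • (κ.ι a' * κ.ι b - κ.ι b * κ.ι a') +
        (Complex.I * Complex.I) • (κ.ι a' * κ.ι b' - κ.ι b' * κ.ι a') := by
      simp only [add_mul, mul_add, Matrix.smul_mul, Matrix.mul_smul, smul_sub, mul_smul]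
      abel
    rw [e]
    simp only [add_mul, mul_add, Matrix.smul_mul, Matrix.mul_smul, h']
  | zero => simp
  | add a b _ _ h1 h2 => rw [add_mul, mul_add, h1, h2]
  | smul c a _ h1 => rw [Matrix.smul_mul, Matrix.mul_smul, h1]

include κ in
/-- If no nonzero element of a stable space `M` commutes with the derived algebra, then an element
of `M` which is moved into a stable subspace `N` lies in `N`. -/
theorem mem_of_forall_bracket_mem {M N : Submodule ℂ (Mat n)}
    (hM : ∀ X ∈ derivedLie l, ∀ Y ∈ M, X * Y - Y * X ∈ M)
    (hN : ∀ X ∈ derivedLie l, ∀ Y ∈ N, X * Y - Y * X ∈ N)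
    (hinv : ∀ Y ∈ M, (∀ X ∈ derivedLie l, X * Y = Y * X) → Y = 0) {v : Mat n} (hv : v ∈ M)
    (h : ∀ X ∈ derivedLie l, X * v - v * X ∈ N) : v ∈ N := by
  let ρ : κ.derived →+ Module.End ℂ M :=
    { toFun := fun x =>
        { toFun := fun Y => ⟨κ.ι x * Y - Y * κ.ι x, hM _ (κ.ι_mem_derivedLie x.2) _ Y.2⟩
          map_add' := fun Y Z => Subtype.ext (by
            simp only [Submodule.coe_add, mul_add, add_mul]; abel)
          map_smul' := fun c Y => Subtype.ext (by
            simp [smul_sub]) }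
      map_zero' := LinearMap.ext fun Y => Subtype.ext (by simp)
      map_add' := fun x y => LinearMap.ext fun Y => Subtype.ext (by
        simp only [Submodule.coe_add, map_add, LinearMap.coe_mk, AddHom.coe_mk, LinearMap.add_apply,
          mul_add, add_mul]
        abel) }
  have hρa : ∀ (x : κ.derived) (Y : M), (ρ x Y : Mat n) = κ.ι x * Y - Y * κ.ι x := fun x Y => rfl
  let br : κ.derived →ₗ[ℝ] κ.derived →ₗ[ℝ] κ.derived :=
    LinearMap.mk₂ ℝ (fun x y => ⟨κ.br x y, κ.br_mem_derived x y⟩)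
      (fun x y z => Subtype.ext (by simp)) (fun c x y => Subtype.ext (by simp))
      (fun x y z => Subtype.ext (by simp)) (fun c x y => Subtype.ext (by simp))
  have hbr : ∀ x y : κ.derived, (br x y : E) = κ.br x y := fun x y => rfl
  have hρ : IsCompactRep br ρ := by
    refine ⟨fun x y z => κ.skew x y z, ?_, fun c x => ?_, fun x y => ?_⟩
    · rw [eq_top_iff]
      rintro ⟨z, hz⟩ -
      have h1 : κ.derived ≤ (Submodule.span ℝ {z | ∃ x y, br x y = z}).map κ.derived.subtype := by
        refine Submodule.span_le.2 ?_
        rintro _ ⟨x, y, rfl⟩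
        -- The derived algebra is perfect: a bracket does not change when its entries are projected
        -- to the derived algebra, since the discarded parts are central.
        have hproj : ∀ x : E, κ.derived.orthogonalProjectionOnto x - x ∈ κ.derivedᗮ := fun x => by
          rw [← neg_sub]
          exact Submodule.neg_mem _ (Submodule.sub_starProjection_mem_orthogonal (K := κ.derived) x)
        refine ⟨br (κ.derived.orthogonalProjectionOnto x) (κ.derived.orthogonalProjectionOnto y),
          Submodule.subset_span ⟨_, _, rfl⟩, ?_⟩
        rw [Submodule.subtype_apply, hbr]
        have e1 := κ.br_eq_zero (hproj y) (κ.derived.orthogonalProjectionOnto x : E)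
        have e2 := κ.br_eq_zero (hproj x) y
        rw [map_sub, sub_eq_zero] at e1 e2
        rw [e1, κ.br_neg, e2, ← κ.br_neg]
      obtain ⟨z', h2, h3⟩ := h1 hz
      have : z' = ⟨z, hz⟩ := Subtype.ext h3
      exact this ▸ h2
    · refine LinearMap.ext fun Y => Subtype.ext ?_
      change κ.ι (c • (x : E)) * (Y : Mat n) - Y * κ.ι (c • (x : E)) =
        (c : ℂ) • (κ.ι x * (Y : Mat n) - Y * κ.ι x)
      rw [_root_.map_smul]
      ext i j
      simp [mul_sub]
    · refine LinearMap.ext fun Y => Subtype.ext ?_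
      rw [hρa, hbr, κ.ι_br, LinearMap.sub_apply, Submodule.coe_sub, Module.End.mul_apply,
        Module.End.mul_apply, hρa, hρa, hρa, hρa]
      noncomm_ring
  have h1 := hρ.mem_of_forall_mem (N := N.comap M.subtype) (v := ⟨v, hv⟩) ?_ ?_ ?_
  · exact h1
  · intro u hu
    refine Subtype.ext (hinv u u.2 fun X hX => ?_)
    refine κ.comm_derivedLie (fun x hx => ?_) hX
    have := congrArg Subtype.val (hu ⟨x, hx⟩)
    rw [hρa] at this
    exact sub_eq_zero.1 this
  · intro x u hu
    exact hN _ (κ.ι_mem_derivedLie x.2) _ hu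
  · intro x
    exact h _ (κ.ι_mem_derivedLie x.2)

end CompactForm

end Kuga
end

/-! ### Field automorphisms and twisted complex conjugation -/

open Matrix
noncomputable section
namespace Kuga
open scoped Matrix.Norms.Operator Topology
open NormedSpace Filter

theorem IsQGroup.map_mem {n : ℕ} {H : Subgroup (GL (Fin n) ℂ)} (hH : IsQGroup H) (σ : ℂ →+* ℂ)
    {g : GL (Fin n) ℂ} (hg : g ∈ H) : GeneralLinearGroup.map σ g ∈ H := by
  obtain ⟨S, hS⟩ := hH
  have hS' : ∀ g, g ∈ H ↔ ∀ f ∈ S,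
      MvPolynomial.aeval (fun ij : Fin n × Fin n => g ij.1 ij.2) f = 0 := fun g => by
    rw [← SetLike.mem_coe, hS]; rfl
  rw [hS'] at hg ⊢
  intro f hf
  have h1 := MvPolynomial.comp_aeval_apply (fun ij : Fin n × Fin n => g ij.1 ij.2)
    σ.toRatAlgHom f
  rw [hg f hf, map_zero] at h1
  exact h1.symm

theorem eval_map_apply {ι R S : Type*} [CommSemiring R] [CommSemiring S] (τ : R →+* S) (v : ι → R)
    (p : MvPolynomial ι R) :
    MvPolynomial.eval (fun i => τ (v i)) (MvPolynomial.map τ p) = τ (MvPolynomial.eval v p) := by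
  rw [MvPolynomial.eval_map, MvPolynomial.eval, MvPolynomial.coe_eval₂Hom,
    MvPolynomial.eval₂_comp_left, RingHom.comp_id]
  rfl

/-- The Lie algebra of a group that is stable under field automorphisms is stable. -/
theorem map_mem_lieAlgebra {n : ℕ} {H : Subgroup (GL (Fin n) ℂ)}
    (hH : ∀ σ : ℂ ≃+* ℂ, ∀ g ∈ H, GeneralLinearGroup.map (σ : ℂ →+* ℂ) g ∈ H) (σ : ℂ ≃+* ℂ)
    {X : Mat n} (hX : X ∈ lieAlgebra H) : X.map σ ∈ lieAlgebra H := by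
  intro f hf
  have hmap : MvPolynomial.map (σ : ℂ →+* ℂ) (MvPolynomial.map (σ.symm : ℂ →+* ℂ) f) = f := by
    rw [MvPolynomial.map_map, RingEquiv.comp_symm, MvPolynomial.map_id]
  have h1 := hX (MvPolynomial.map (σ.symm : ℂ →+* ℂ) f) fun g hg => by
    refine σ.injective ?_
    rw [map_zero]
    refine (eval_map_apply (σ : ℂ →+* ℂ) _ _).symm.trans ?_
    rw [hmap]
    have h0 := hf _ (hH σ g hg)
    simp only [GeneralLinearGroup.map_apply] at h0
    exact h0
  have h2 := (congrArg σ h1).trans (map_zero σ)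
  rw [map_sum] at h2
  refine (Finset.sum_congr rfl fun ij _ => ?_).trans h2
  rw [map_mul]
  refine congrArg₂ (· * ·) rfl ?_
  refine Eq.trans ?_ (eval_map_apply (σ : ℂ →+* ℂ) _ _)
  rw [← MvPolynomial.pderiv_map, hmap]
  refine congrArg (fun v => MvPolynomial.eval v _) (funext fun kl => ?_)
  change _ = σ _
  rw [Matrix.one_apply]
  split_ifs
  · exact (map_one σ).symm
  · exact (map_zero σ).symm

theorem conjGL_atI {n : ℕ} {φ : ℂˣ × ℂˣ →* GL (Fin n) ℂ} (h : IsDefinedOverReals φ) :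
    conjGL (atI φ) = atI φ := by
  rw [atI, ← h, star_star]

/-- The square is a value of the weight cocharacter, hence acts trivially on matrices of weight 0.
This makes the twisted conjugation an involution on the Lie algebra of the Levi subgroup. -/
theorem atI_mul_self {n : ℕ} (φ : ℂˣ × ℂˣ →* GL (Fin n) ℂ) : atI φ * atI φ = φ (-1, -1) := by
  rw [atI, ← map_mul]
  congr 1
  refine Prod.ext (Units.ext ?_) (Units.ext ?_)
  · simp
  · simp [Units.coe_star]

/-- Complex conjugation, twisted by an inner automorphism. -/
def twistedConj {n : ℕ} (a : GL (Fin n) ℂ) : Mat n →ₗ[ℝ] Mat n where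
  toFun X := (a : Mat n) * X.map (starRingEnd ℂ) * ((a⁻¹ : GL (Fin n) ℂ) : Mat n)
  map_add' X Y := by
    rw [Matrix.map_add _ (map_add _), mul_add, add_mul]
  map_smul' c X := by
    have : (c • X).map (starRingEnd ℂ) = c • X.map (starRingEnd ℂ) := by
      ext i j
      simp
    rw [this, RingHom.id_apply, Matrix.mul_smul, Matrix.smul_mul]

theorem twistedConj_apply {n : ℕ} (a : GL (Fin n) ℂ) (X : Mat n) : twistedConj a X =
    (a : Mat n) * X.map (starRingEnd ℂ) * ((a⁻¹ : GL (Fin n) ℂ) : Mat n) := rfl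

theorem twistedConj_mul {n : ℕ} (a : GL (Fin n) ℂ) (X Y : Mat n) :
    twistedConj a (X * Y) = twistedConj a X * twistedConj a Y := by
  simp only [twistedConj_apply, Matrix.map_mul]
  have h : ((a⁻¹ : GL (Fin n) ℂ) : Mat n) * (a : Mat n) = 1 := a.inv_val
  calc _ = (a : Mat n) * X.map (starRingEnd ℂ) * 1 * Y.map (starRingEnd ℂ) *
        ((a⁻¹ : GL (Fin n) ℂ) : Mat n) := by simp only [mul_one, mul_assoc]
    _ = _ := by rw [← h]; simp only [mul_assoc]

theorem twistedConj_smul {n : ℕ} (a : GL (Fin n) ℂ) (c : ℂ) (X : Mat n) :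
    twistedConj a (c • X) = (starRingEnd ℂ c) • twistedConj a X := by
  have : (c • X).map (starRingEnd ℂ) = (starRingEnd ℂ c) • X.map (starRingEnd ℂ) := by
    ext i j
    simp
  rw [twistedConj_apply, this, Matrix.mul_smul, Matrix.smul_mul, twistedConj_apply]

theorem twistedConj_exp {n : ℕ} (a : GL (Fin n) ℂ) (X : Mat n) :
    twistedConj a (exp X) = exp (twistedConj a X) := by
  let F : Mat n →+* Mat n :=
    { toFun := twistedConj a
      map_one' := by
        rw [twistedConj_apply, Matrix.map_one _ (map_zero _) (map_one _), mul_one]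
        exact a.val_inv
      map_mul' := twistedConj_mul a
      map_zero' := map_zero _
      map_add' := map_add _ }
  exact map_exp F (twistedConj a).continuous_of_finiteDimensional X

namespace KugaDatum

variable {n : ℕ} (D : KugaDatum n)

instance adjointKernel_normal : (adjointKernel D.isUnipotentRadical).Normal := by
  have : (D.W.subgroupOf D.P).Normal := D.isUnipotentRadical.1.2.1.2
  unfold adjointKernel
  infer_instance

/-- `c` is central modulo `W`, and `prHom` kills `W`; so `prHom c` commutes with the Levi subgroup,
and by differentiation with its Lie algebra. -/
theorem comm_of_mem_adjointKernel {gr : Grading n} (hw : IsWeighted gr D.P D.W) {c : D.P}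
    (hc : c ∈ adjointKernel D.isUnipotentRadical) {X : Mat n} (hX : X ∈ lieAlgebra hw.levi) :
    (hw.prHom c : Mat n) * X = X * hw.prHom c := by
  have : (D.W.subgroupOf D.P).Normal := D.isUnipotentRadical.1.2.1.2
  have h1 : ∀ p : D.P, hw.prHom p * hw.prHom c = hw.prHom c * hw.prHom p := by
    intro p
    have h2 := Subgroup.mem_center_iff.1 (Subgroup.mem_comap.1 hc) (QuotientGroup.mk p)
    have h3 : (p * c)⁻¹ * (c * p) ∈ D.W.subgroupOf D.P := QuotientGroup.eq.1 h2
    rw [Subgroup.mem_subgroupOf] at h3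
    have h4 : hw.prHom ((p * c)⁻¹ * (c * p)) = 1 := Units.ext (hw.mem_W_iff.1 h3).2
    rw [map_mul, map_inv, map_mul, map_mul, inv_mul_eq_one] at h4
    exact h4
  let S : Submodule ℂ (Mat n) := LinearMap.ker
    (LinearMap.mulLeft ℂ (hw.prHom c : Mat n) - LinearMap.mulRight ℂ (hw.prHom c : Mat n))
  have hS : ∀ Y, Y ∈ S ↔ (hw.prHom c : Mat n) * Y = Y * hw.prHom c := fun Y => by
    simp [S, sub_eq_zero]
  rw [← hS]
  refine mem_submodule_of_hasDerivAt (γ := fun t : ℂ => exp (t • X))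
    ((hasDerivAt_exp_smul X 0).congr_deriv (by simp)) fun t => ?_
  rw [hS]
  have hm := expGL_smul_mem hw.isZariskiClosed_levi hX t
  obtain ⟨hm1, hm2⟩ := hw.mem_levi_iff.1 hm
  have h5 := congrArg Units.val (h1 ⟨_, hm1⟩)
  have h6 : hw.prHom ⟨_, hm1⟩ = expGL (t • X) := Units.ext hm2
  rw [h6] at h5
  exact h5.symm

end KugaDatum
end Kuga
end

/-! ### From a compact group of automorphisms to a compact form -/

open Matrix
noncomputable section
namespace Kuga
open scoped Matrix.Norms.Operator Topology
open NormedSpace Filter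

theorem Grading.S_mul_S_inv {n : ℕ} (gr : Grading n) (t : ℂˣ) :
    gr.S t * gr.S (t⁻¹ : ℂˣ) = 1 := by
  refine gr.eq_of_blocks fun i j => ?_
  have := gr.E_mul_conj_mul_E 1 t i j
  rw [mul_one] at this
  rw [this]
  rcases eq_or_ne i j with rfl | h
  · rw [← mul_pow, Units.mul_inv, one_pow, one_smul]
  · rw [mul_one, gr.mul_ne i j h, smul_zero]

theorem Grading.conj_of_pr_eq {n : ℕ} (gr : Grading n) {X : Mat n} (h : gr.pr X = X) (t : ℂˣ) :
    gr.S t * X * gr.S (t⁻¹ : ℂˣ) = X := by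
  have h1 : gr.S t * X = X * gr.S t := by
    rw [Grading.S, Finset.sum_mul, Finset.mul_sum]
    refine Finset.sum_congr rfl fun i _ => ?_
    rw [Matrix.smul_mul, gr.comm_of_pr_eq h, Matrix.mul_smul]
  rw [h1, mul_assoc, gr.S_mul_S_inv, mul_one]

theorem IsQGroup.conjGL_mem {n : ℕ} {H : Subgroup (GL (Fin n) ℂ)} (hH : IsQGroup H)
    {g : GL (Fin n) ℂ} (hg : g ∈ H) : conjGL g ∈ H := hH.map_mem _ hg

/-- A compact group of automorphisms gives a compact form. -/
theorem exists_compactForm_of_isCompact {n : ℕ} {l : Submodule ℂ (Mat n)} {Q : Type*} [Group Q]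
    [TopologicalSpace Q] [IsTopologicalGroup Q] (C : Subgroup Q) (hC : IsCompact (C : Set Q))
    (Θ : Q →* Module.End ℝ (l.restrictScalars ℝ))
    (hΘ : ∀ v, Continuous fun q => (Θ q v : Mat n)) (σ : Mat n →ₗ[ℝ] Mat n)
    (hσmul : ∀ X Y, σ (X * Y) = σ X * σ Y) (hσsmul : ∀ (c : ℂ) X, σ (c • X) = starRingEnd ℂ c • σ X)
    (hσl : ∀ X ∈ l, σ X ∈ l) (hσσ : ∀ X ∈ l, σ (σ X) = X)
    (hbr : ∀ X ∈ l, ∀ Y ∈ l, X * Y - Y * X ∈ l)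
    (hexp : ∀ X ∈ l, σ X = X → ∀ t : ℝ, ∃ q ∈ C, ∀ Y : l.restrictScalars ℝ,
      (Θ q Y : Mat n) = exp ((t : ℂ) • X) * Y * exp (-((t : ℂ) • X))) :
    ∃ (d : ℕ) (k : Submodule ℝ (EuclideanSpace ℝ (Fin d))), Nonempty (CompactForm l k) := by
  let V := l.restrictScalars ℝ
  have : CompactSpace C := isCompact_iff_compactSpace.1 hC
  obtain ⟨d, e, he⟩ := exists_invariant_inner (V := V) (Θ.comp C.subtype) fun v f => by
    have h1 : Continuous fun g : C => Θ g v :=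
      Continuous.subtype_mk ((hΘ v).comp continuous_subtype_val) _
    exact f.continuous_of_finiteDimensional.comp h1
  let F : EuclideanSpace ℝ (Fin d) →ₗ[ℝ] Mat n := V.subtype.comp e.symm.toLinearMap
  have hFl : ∀ x, F x ∈ l := fun x => (e.symm x).2
  have hFe : ∀ X (hX : X ∈ l), F (e ⟨X, hX⟩) = X := fun X hX =>
    congrArg Subtype.val (e.symm_apply_apply ⟨X, hX⟩)
  have heF : ∀ x, e ⟨F x, hFl x⟩ = x := fun x => e.apply_symm_apply x
  -- The real form fixed by `σ`, transported to Euclidean space so that it carries the invariant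
  -- inner product.
  let k : Submodule ℝ (EuclideanSpace ℝ (Fin d)) := LinearMap.eqLocus (σ.comp F) F
  have hk : ∀ x, x ∈ k ↔ σ (F x) = F x := fun x => Iff.rfl
  have hbrk : ∀ x y : k, σ (F x * F y - F y * F x) = F x * F y - F y * F x := fun x y => by
    rw [map_sub, hσmul, hσmul, (hk x).1 x.2, (hk y).1 y.2]
  have hFinj : Function.Injective F := fun x y hxy => e.symm.injective (Subtype.ext hxy)
  let br : k →ₗ[ℝ] k →ₗ[ℝ] k :=
    LinearMap.mk₂ ℝ (fun x y => ⟨e ⟨F x * F y - F y * F x, hbr _ (hFl x) _ (hFl y)⟩, by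
      rw [hk, hFe]
      exact hbrk x y⟩)
      (fun x y z => Subtype.ext (hFinj (by
        change F (e _) = F (e _ + e _)
        rw [map_add, hFe, hFe, hFe, Submodule.coe_add, map_add, mul_add, add_mul]
        abel)))
      (fun c x y => Subtype.ext (hFinj (by
        change F (e _) = F (c • e _)
        rw [_root_.map_smul, hFe, hFe, Submodule.coe_smul, _root_.map_smul, Matrix.mul_smul,
          Matrix.smul_mul, smul_sub])))
      (fun x y z => Subtype.ext (hFinj (by
        change F (e _) = F (e _ + e _)
        rw [map_add, hFe, hFe, hFe, Submodule.coe_add, map_add, mul_add, add_mul]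
        abel)))
      (fun c x y => Subtype.ext (hFinj (by
        change F (e _) = F (c • e _)
        rw [_root_.map_smul, hFe, hFe, Submodule.coe_smul, _root_.map_smul, Matrix.mul_smul,
          Matrix.smul_mul, smul_sub])))
  have hFbr : ∀ x y : k, F (br x y) = F x * F y - F y * F x := fun x y => hFe _ _
  have hext : ∀ z : EuclideanSpace ℝ (Fin d), ∃ f : Mat n →ₗ[ℝ] ℝ,
      ∀ X (hX : X ∈ l), f X = inner ℝ (e ⟨X, hX⟩) z := by
    intro z
    obtain ⟨f, hf⟩ := LinearMap.exists_extend (p := V)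
      (((innerₗ (EuclideanSpace ℝ (Fin d))).flip z).comp e.toLinearMap)
    exact ⟨f, fun X hX => LinearMap.congr_fun hf ⟨X, hX⟩⟩
  have hder : ∀ (f : Mat n →ₗ[ℝ] ℝ) (X Y : Mat n),
      HasDerivAt (fun t : ℝ => f (exp ((t : ℂ) • X) * Y * exp (-((t : ℂ) • X))))
        (f (X * Y - Y * X)) 0 := by
    intro f X Y
    have h1 : HasDerivAt (fun t : ℝ => exp ((t : ℂ) • X) * Y * exp (-((t : ℂ) • X)))
        (X * Y - Y * X) 0 := by
      have := (hasDerivAt_conj_exp X Y).scomp_of_eq (0 : ℝ) Complex.ofRealCLM.hasDerivAt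
        Complex.ofReal_zero.symm
      exact this.congr_deriv (by simp)
    exact (LinearMap.toContinuousLinearMap f).hasFDerivAt.comp_hasDerivAt 0 h1
  have hskew : ∀ x y z : k, inner ℝ (br x y) z = -inner ℝ y (br x z) := by
    intro x y z
    obtain ⟨f, hf⟩ := hext z
    obtain ⟨g, hg⟩ := hext y
    -- The invariance `⟨Ad (exp (t x)) y, z⟩ = ⟨y, Ad (exp (-t x)) z⟩`; its derivative at `t = 0` is
    -- skewness. The functionals `f` and `g` extend the inner products to all matrices, where the
    -- curves can be differentiated.
    have key : ∀ t : ℝ, f (exp ((t : ℂ) • F x) * F y * exp (-((t : ℂ) • F x))) =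
        g (exp ((t : ℂ) • -F x) * F z * exp (-((t : ℂ) • -F x))) := by
      intro t
      obtain ⟨q, hq, hqY⟩ := hexp (F x) (hFl x) ((hk x).1 x.2) t
      obtain ⟨r, hr, hrY⟩ := hexp (F x) (hFl x) ((hk x).1 x.2) (-t)
      have hrY' : ∀ Y : V, (Θ r Y : Mat n) =
          exp ((t : ℂ) • -F x) * Y * exp (-((t : ℂ) • -F x)) := fun Y => by
        rw [hrY, Complex.ofReal_neg, neg_smul, smul_neg]
      have hinv1 : exp (-((t : ℂ) • F x)) * exp ((t : ℂ) • F x) = 1 :=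
        (expGL ((t : ℂ) • F x)).inv_val
      have h1 : Θ r (Θ q ⟨F y, hFl y⟩) = ⟨F y, hFl y⟩ := by
        refine Subtype.ext ?_
        rw [hrY', hqY, smul_neg, neg_neg]
        calc _ = (exp (-((t : ℂ) • F x)) * exp ((t : ℂ) • F x)) * F y *
              (exp (-((t : ℂ) • F x)) * exp ((t : ℂ) • F x)) := by simp only [mul_assoc]
          _ = _ := by rw [hinv1, one_mul, mul_one]
      rw [← hqY ⟨F y, hFl y⟩, ← hrY' ⟨F z, hFl z⟩, hf _ (Θ q ⟨F y, hFl y⟩).2,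
        hg _ (Θ r ⟨F z, hFl z⟩).2]
      have h2 := he ⟨r, hr⟩ (Θ q ⟨F y, hFl y⟩) ⟨F z, hFl z⟩
      simp only [MonoidHom.comp_apply, Subgroup.subtype_apply] at h2
      rw [h1, heF, heF] at h2
      exact h2.symm.trans (real_inner_comm _ _)
    have h1 := hder f (F x) (F y)
    have h2 := hder g (-F x) (F z)
    rw [funext key] at h1
    have h3 := h1.unique h2
    rw [neg_mul, mul_neg, sub_neg_eq_add, neg_add_eq_sub, ← neg_sub (F x * F z), map_neg,
      hf _ (hbr _ (hFl x) _ (hFl y)), hg _ (hbr _ (hFl x) _ (hFl z))] at h3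
    exact h3.trans (congrArg Neg.neg (real_inner_comm _ _))
  refine ⟨d, k, ⟨⟨F.comp k.subtype, ?_, br, fun x y => hFbr x y, hskew, fun x => hFl x, ?_⟩⟩⟩
  · intro x y hxy
    exact Subtype.ext (hFinj hxy)
  · intro X hX
    -- Real and imaginary parts with respect to the conjugate-linear involution `σ`.
    have hA : (1 / 2 : ℂ) • (X + σ X) ∈ l := l.smul_mem _ (l.add_mem hX (hσl X hX))
    have hB : (-Complex.I / 2 : ℂ) • (X - σ X) ∈ l := l.smul_mem _ (l.sub_mem hX (hσl X hX))
    refine ⟨⟨e ⟨_, hA⟩, ?_⟩, ⟨e ⟨_, hB⟩, ?_⟩, ?_⟩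
    · rw [hk, hFe, hσsmul, map_add, hσσ X hX, add_comm (σ X)]
      simp [Complex.conj_ofNat]
    · rw [hk, hFe, hσsmul, map_sub, hσσ X hX, ← neg_sub X, smul_neg, ← neg_smul]
      simp [neg_div, Complex.conj_ofNat]
    · change X = F (e _) + Complex.I • F (e _)
      rw [hFe, hFe, smul_smul]
      have : Complex.I * (-Complex.I / 2) = 1 / 2 := by
        rw [mul_div_assoc', mul_neg, Complex.I_mul_I, neg_neg]
      rw [this, ← smul_add, add_add_sub_cancel, ← two_smul ℂ X, smul_smul]
      norm_num

end Kuga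
end

/-! ### The compact form attached to a Kuga datum -/

open Matrix
noncomputable section
namespace Kuga
open scoped Matrix.Norms.Operator Topology
open NormedSpace Filter

namespace IsWeighted

variable {n : ℕ} {gr : Grading n} {P W : Subgroup (GL (Fin n) ℂ)} (hw : IsWeighted gr P W)

theorem prHom_mem_levi (g : P) : hw.prHom g ∈ hw.levi := ⟨g, rfl⟩

theorem conj_mem_lie_levi {g : GL (Fin n) ℂ} (hg : g ∈ hw.levi) {X : Mat n}
    (hX : X ∈ lieAlgebra hw.levi) :
    (g : Mat n) * X * (g⁻¹ : GL (Fin n) ℂ) ∈ lieAlgebra hw.levi :=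
  conj_mem_lieAlgebra hw.isZariskiClosed_levi
    (fun _ hx => hw.levi.mul_mem (hw.levi.mul_mem hg hx) (hw.levi.inv_mem hg)) hX

/-- The adjoint action of the group on the Lie algebra of its Levi quotient. -/
def adLevi : P →* Module.End ℝ ((lieAlgebra hw.levi).restrictScalars ℝ) where
  toFun g :=
    { toFun := fun Y => ⟨(hw.prHom g : Mat n) * Y * ((hw.prHom g)⁻¹ : GL (Fin n) ℂ),
        hw.conj_mem_lie_levi (hw.prHom_mem_levi g) Y.2⟩
      map_add' := fun Y Z => Subtype.ext (by simp only [Submodule.coe_add, mul_add, add_mul])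
      map_smul' := fun c Y => Subtype.ext (by
        simp only [Submodule.coe_smul, Matrix.mul_smul, Matrix.smul_mul, RingHom.id_apply]) }
  map_one' := LinearMap.ext fun Y => Subtype.ext (by
    change (hw.prHom 1 : Mat n) * Y * ((hw.prHom 1)⁻¹ : GL (Fin n) ℂ) = Y
    rw [map_one, inv_one, Units.val_one, one_mul, mul_one])
  map_mul' g h := LinearMap.ext fun Y => Subtype.ext (by
    change (hw.prHom (g * h) : Mat n) * Y * ((hw.prHom (g * h))⁻¹ : GL (Fin n) ℂ) =
      (hw.prHom g : Mat n) * ((hw.prHom h : Mat n) * Y * ((hw.prHom h)⁻¹ : GL (Fin n) ℂ)) *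
        ((hw.prHom g)⁻¹ : GL (Fin n) ℂ)
    rw [map_mul, _root_.mul_inv_rev, Units.val_mul, Units.val_mul]
    simp only [mul_assoc])

theorem adLevi_apply (g : P) (Y : (lieAlgebra hw.levi).restrictScalars ℝ) :
    (hw.adLevi g Y : Mat n) = (hw.prHom g : Mat n) * Y * ((hw.prHom g)⁻¹ : GL (Fin n) ℂ) := rfl

theorem continuous_adLevi (Y : (lieAlgebra hw.levi).restrictScalars ℝ) :
    Continuous fun g => (hw.adLevi g Y : Mat n) := by
  have h1 : Continuous fun g : P => (hw.prHom g : Mat n) :=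
    gr.continuous_pr.comp (Units.continuous_val.comp continuous_subtype_val)
  have h2 : Continuous fun g : P => (((hw.prHom g)⁻¹ : GL (Fin n) ℂ) : Mat n) := by
    have h3 : Continuous fun g : P => (hw.prHom g⁻¹ : Mat n) := h1.comp continuous_inv
    simpa only [map_inv] using h3
  exact (h1.mul continuous_const).mul h2

end IsWeighted

namespace KugaDatum

variable {n : ℕ} (D : KugaDatum n)

/-- The Lie algebra of the Levi quotient of a Kuga datum has a compact form. -/
theorem exists_compactForm (y : D.Y) {gr : Grading n} (hgr : ∀ (t : ℂˣ) (X : Mat n),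
      (D.h y (t, t) : Mat n) * X * ((D.h y (t, t))⁻¹ : GL (Fin n) ℂ).val =
        gr.S t * X * gr.S (t⁻¹ : ℂˣ)) (hw : IsWeighted gr D.P D.W) :
    ∃ (d : ℕ) (k : Submodule ℝ (EuclideanSpace ℝ (Fin d))),
      Nonempty (CompactForm (lieAlgebra hw.levi) k) := by
  set a := atI (D.h y) with ha
  have hreal := (D.real y).2.1
  have haP : a ∈ D.P := (D.real y).2.2 _
  let α : D.P →* D.P :=
    { toFun := fun g => ⟨a * conjGL (g : GL (Fin n) ℂ) * a⁻¹, D.P.mul_mem (D.P.mul_mem haP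
        (D.isQGroup.conjGL_mem g.2)) (D.P.inv_mem haP)⟩
      map_one' := Subtype.ext (by simp)
      map_mul' := fun g h => Subtype.ext (by simp) }
  let mk := QuotientGroup.mk' (adjointKernel D.isUnipotentRadical)
  -- The compact twisted real form of the Cartan condition, presented as a subgroup of the adjoint
  -- group.
  let C : Subgroup (D.P ⧸ adjointKernel D.isUnipotentRadical) :=
    (MonoidHom.eqLocus (mk.comp α) mk).map mk
  have hmk : ∀ g, mk (α g) = mk g ↔ ∃ c ∈ adjointKernel D.isUnipotentRadical,
      a * conjGL (g : GL (Fin n) ℂ) * a⁻¹ = (g : GL (Fin n) ℂ) * (c : GL (Fin n) ℂ) := by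
    intro g
    constructor
    · intro h
      refine ⟨g⁻¹ * α g, QuotientGroup.eq.1 h.symm, ?_⟩
      exact (mul_inv_cancel_left (g : GL (Fin n) ℂ) (α g : GL (Fin n) ℂ)).symm
    · rintro ⟨c, hc, h⟩
      have h1 : α g = g * c := Subtype.ext h
      have h2 : mk c = 1 := (QuotientGroup.eq_one_iff c).2 hc
      rw [h1, map_mul, h2, mul_one]
  have hC : IsCompact (C : Set (D.P ⧸ adjointKernel D.isUnipotentRadical)) := by
    have h := D.cartan y
    rw [InducesCartanInvolution] at h
    convert h using 1
    ext q
    constructor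
    · rintro ⟨g, hg, rfl⟩
      exact ⟨g, (hmk g).1 hg, rfl⟩
    · rintro ⟨g, hg, rfl⟩
      exact ⟨g, (hmk g).2 hg, rfl⟩
  have hker : ∀ c ∈ adjointKernel D.isUnipotentRadical, hw.adLevi c = 1 := by
    intro c hc
    refine LinearMap.ext fun Y => Subtype.ext ?_
    rw [hw.adLevi_apply, D.comm_of_mem_adjointKernel hw hc Y.2, mul_assoc, Units.mul_inv, mul_one]
    rfl
  let Θ := QuotientGroup.lift _ hw.adLevi hker
  have hΘ : ∀ g : D.P, Θ (mk g) = hw.adLevi g := fun g => rfl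
  have hcomm : ∀ t : ℂˣ, a * D.h y (t, t) = D.h y (t, t) * a := fun t => by
    rw [ha, atI, ← map_mul, ← map_mul, mul_comm]
  have hpr : ∀ X : Mat n, gr.pr X = X → ∀ t : ℂˣ,
      (D.h y (t, t) : Mat n) * X = X * (D.h y (t, t) : Mat n) := by
    intro X hX t
    have h1 := hgr t X
    rw [gr.conj_of_pr_eq hX] at h1
    have h2 := congrArg (· * (D.h y (t, t) : Mat n)) h1
    rwa [mul_assoc, Units.inv_mul, mul_one] at h2
  have hmapcomm : ∀ (g : GL (Fin n) ℂ) (X : Mat n), (g : Mat n) * X = X * g →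
      ((conjGL g : GL (Fin n) ℂ) : Mat n) * X.map (starRingEnd ℂ) =
        X.map (starRingEnd ℂ) * (conjGL g : GL (Fin n) ℂ) := by
    intro g X h
    have h1 := congrArg (fun M : Mat n => M.map (starRingEnd ℂ)) h
    simp only [Matrix.map_mul] at h1
    exact h1
  have hσl : ∀ X ∈ lieAlgebra hw.levi, twistedConj a X ∈ lieAlgebra hw.levi := by
    intro X hX
    rw [hw.mem_lie_levi_iff] at hX ⊢
    constructor
    · rw [twistedConj_apply]
      exact conj_mem_lieAlgebra hw.closed
        (fun x hx => D.P.mul_mem (D.P.mul_mem haP hx) (D.P.inv_mem haP))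
        (map_mem_lieAlgebra (fun σ g hg => D.isQGroup.map_mem _ hg) (starRingAut : ℂ ≃+* ℂ) hX.1)
    -- Complex conjugation permutes the values of the weight cocharacter, because `h y` is real, and
    -- `a` commutes with them. Hence the twisted conjugation preserves their centralizer.
    · refine gr.pr_eq_of_conj fun t => ?_
      rw [← hgr]
      have h1 := hmapcomm _ _ (hpr X hX.2 (star t))
      have h2 := hreal (star t) (star t)
      rw [star_star] at h2
      rw [← h2] at h1
      have h3 := congrArg Units.val (hcomm t)
      rw [Units.val_mul, Units.val_mul] at h3
      have h4 : ((a⁻¹ : GL (Fin n) ℂ) : Mat n) * D.h y (t, t) =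
          (D.h y (t, t) : Mat n) * ((a⁻¹ : GL (Fin n) ℂ) : Mat n) := by
        rw [← Units.val_mul, ← Units.val_mul, inv_mul_eq_iff_eq_mul.2]
        rw [← mul_assoc, hcomm, mul_assoc, mul_inv_cancel, mul_one]
      have h5 : (D.h y (t, t) : Mat n) * twistedConj a X = twistedConj a X * D.h y (t, t) := by
        rw [twistedConj_apply, mul_assoc _ _ (D.h y (t, t) : Mat n), h4, ← mul_assoc, ← mul_assoc,
          ← h3, mul_assoc (a : Mat n), h1]
        simp only [mul_assoc]
      rw [h5, mul_assoc, Units.mul_inv, mul_one]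
  have hσσ : ∀ X ∈ lieAlgebra hw.levi, twistedConj a (twistedConj a X) = X := by
    intro X hX
    have h1 : ∀ X : Mat n, twistedConj a (twistedConj a X) =
        (a * a : GL (Fin n) ℂ) * X * ((a * a)⁻¹ : GL (Fin n) ℂ) := by
      intro X
      have h2 : ((a : GL (Fin n) ℂ) : Mat n).map (starRingEnd ℂ) = a :=
        congrArg Units.val (conjGL_atI hreal)
      have h3 : ((a⁻¹ : GL (Fin n) ℂ) : Mat n).map (starRingEnd ℂ) = (a⁻¹ : GL (Fin n) ℂ) := by
        have h4 : conjGL a⁻¹ = a⁻¹ := by rw [map_inv, conjGL_atI hreal]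
        exact congrArg Units.val h4
      have h5 : (X.map (starRingEnd ℂ)).map (starRingEnd ℂ) = X := by
        ext i j
        simp
      rw [twistedConj_apply, twistedConj_apply, Matrix.map_mul, Matrix.map_mul, h2, h3, h5,
        _root_.mul_inv_rev, Units.val_mul, Units.val_mul]
      simp only [mul_assoc]
    rw [h1, ha, atI_mul_self, hpr X (hw.mem_lie_levi_iff.1 hX).2, mul_assoc, Units.mul_inv, mul_one]
  refine exists_compactForm_of_isCompact C hC Θ ?_ (twistedConj a) (twistedConj_mul a)
    (twistedConj_smul a) hσl hσσ ?_ ?_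
  · intro v
    refine (QuotientGroup.isQuotientMap_mk
      (N := adjointKernel D.isUnipotentRadical)).continuous_iff.2 ?_
    exact hw.continuous_adLevi v
  · exact fun X hX Y hY => bracket_mem_lieAlgebra hw.isZariskiClosed_levi hX hY
  · intro X hX hσX t
    have hL := expGL_smul_mem hw.isZariskiClosed_levi hX t
    obtain ⟨hP, hprL⟩ := hw.mem_levi_iff.1 hL
    have hpr1 : hw.prHom ⟨_, hP⟩ = expGL ((t : ℂ) • X) := Units.ext hprL
    refine ⟨mk ⟨_, hP⟩, ⟨⟨_, hP⟩, ?_, rfl⟩, fun Y => ?_⟩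
    · change mk (α _) = mk _
      congr 1
      refine Subtype.ext (Units.ext ?_)
      change twistedConj a (exp ((t : ℂ) • X)) = exp ((t : ℂ) • X)
      rw [twistedConj_exp, twistedConj_smul, hσX, Complex.conj_ofReal]
    · rw [hΘ, hw.adLevi_apply, hpr1, coe_expGL_inv]
      rfl

end KugaDatum

end Kuga
end

/-! ### Galois descent along automorphisms of the complex numbers -/

open Matrix
noncomputable section
namespace Kuga

/-- Automorphisms of a polynomial ring over a subfield extend to `ℂ`. -/
theorem exists_ringEquiv_extending {k : Type} [Field k] [Algebra k ℂ] {ι : Type} {v : ι → ℂ}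
    (hv : IsTranscendenceBasis k v) (e : MvPolynomial ι k ≃+* MvPolynomial ι k) :
    ∃ σ : ℂ ≃+* ℂ, ∀ p, σ (MvPolynomial.aeval v p) = MvPolynomial.aeval v (e p) := by
  let A := Algebra.adjoin k (Set.range v)
  have : IsAlgClosure A ℂ := IsAlgClosed.isAlgClosure_of_transcendence_basis v hv
  let f : MvPolynomial ι k ≃ₐ[k] A := hv.1.aevalEquiv
  have hf : ∀ p, algebraMap A ℂ (f p) = MvPolynomial.aeval v p := fun p =>
    hv.1.algebraMap_aevalEquiv p
  refine ⟨IsAlgClosure.equivOfEquiv ℂ ℂ ((f.symm.toRingEquiv.trans e).trans f.toRingEquiv),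
    fun p => ?_⟩
  rw [← hf, ← hf, IsAlgClosure.equivOfEquiv_algebraMap]
  refine congrArg (algebraMap A ℂ) ?_
  change f (e (f.symm (f p))) = f (e p)
  rw [AlgEquiv.symm_apply_apply]

/-- A complex number fixed by all field automorphisms is rational. -/
theorem mem_range_of_forall_ringEquiv {z : ℂ} (h : ∀ σ : ℂ ≃+* ℂ, σ z = z) :
    z ∈ Set.range (algebraMap ℚ ℂ) := by
  by_cases hz : IsAlgebraic ℚ z
  · have : IsAlgClosure ℚ (algebraicClosure ℚ ℂ) := algebraicClosure.isAlgClosure ℚ ℂ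
    have : IsGalois ℚ (algebraicClosure ℚ ℂ) := IsAlgClosure.isGalois ℚ _
    obtain ⟨ι, v, hv⟩ := exists_isTranscendenceBasis' (algebraicClosure ℚ ℂ) ℂ
    have h1 : (⟨z, mem_algebraicClosure_iff.2 hz⟩ : algebraicClosure ℚ ℂ) ∈
        Set.range (algebraMap ℚ (algebraicClosure ℚ ℂ)) := by
      rw [InfiniteGalois.mem_range_algebraMap_iff_fixed]
      intro τ
      -- `τ` acts on the coefficients of polynomials in a transcendence basis over the algebraic
      -- numbers, and thereby extends to `ℂ`.
      obtain ⟨σ, hσ⟩ := exists_ringEquiv_extending hv (MvPolynomial.mapEquiv ι τ.toRingEquiv)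
      have h2 := hσ (MvPolynomial.C ⟨z, mem_algebraicClosure_iff.2 hz⟩)
      rw [MvPolynomial.mapEquiv_apply, MvPolynomial.map_C, MvPolynomial.aeval_C,
        MvPolynomial.aeval_C] at h2
      exact Subtype.ext (h2.symm.trans (h σ))
    obtain ⟨q, hq⟩ := h1
    exact ⟨q, congrArg Subtype.val hq⟩
  · exfalso
    obtain ⟨s, hs, hv⟩ := exists_isTranscendenceBasis_superset (R := ℚ) (A := ℂ) (s := {z})
      ((algebraicIndependent_singleton_iff (⟨z, rfl⟩ : ({z} : Set ℂ))).2 hz)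
    -- A transcendental `z` is made part of a transcendence basis; the sign change of the basis
    -- extends to an automorphism that sends `z` to `-z`.
    let g : MvPolynomial s ℚ →ₐ[ℚ] MvPolynomial s ℚ := MvPolynomial.aeval fun i => -MvPolynomial.X i
    have hg : g.comp g = AlgHom.id ℚ _ := by
      ext i
      simp [g]
    obtain ⟨σ, hσ⟩ := exists_ringEquiv_extending hv (AlgEquiv.ofAlgHom g g hg hg).toRingEquiv
    have h1 := hσ (MvPolynomial.X ⟨z, hs rfl⟩)
    rw [MvPolynomial.aeval_X, h σ] at h1
    have h2 : MvPolynomial.aeval (fun i : s => (i : ℂ))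
        (g (MvPolynomial.X ⟨z, hs rfl⟩)) = -z := by
      simp [g]
    have h3 : z = -z := h1.trans h2
    have h4 : z = 0 := self_eq_neg.1 h3
    exact hz (h4 ▸ isAlgebraic_zero)

/-- Galois descent: a nonzero space of matrices that is stable under all field automorphisms
contains a nonzero rational matrix. -/
theorem exists_rational_of_stable {n : ℕ} {F : Submodule ℂ (Mat n)}
    (hF : ∀ (σ : ℂ ≃+* ℂ), ∀ X ∈ F, X.map σ ∈ F) (h0 : ∃ X ∈ F, X ≠ 0) :
    ∃ X : Matrix (Fin n) (Fin n) ℚ, X ≠ 0 ∧ X.map (algebraMap ℚ ℂ) ∈ F := by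
  classical
  let supp : Mat n → Finset (Fin n × Fin n) := fun X => Finset.univ.filter fun ij => X ij.1 ij.2 ≠ 0
  have hsupp : ∀ X ij, ij ∈ supp X ↔ X ij.1 ij.2 ≠ 0 := fun X ij => by simp [supp]
  -- Descent on the size of the support. With one entry scaled to `1`, either every automorphism
  -- fixes the matrix, which is then rational, or some nonzero `σ Y - Y` has smaller support.
  have key : ∀ m : ℕ, ∀ X ∈ F, X ≠ 0 → (supp X).card = m →
      ∃ X : Matrix (Fin n) (Fin n) ℚ, X ≠ 0 ∧ X.map (algebraMap ℚ ℂ) ∈ F := by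
    intro m
    induction m using Nat.strong_induction_on with
    | _ m ih =>
      intro X hX hX0 hm
      obtain ⟨i, j, hij⟩ : ∃ i j, X i j ≠ 0 := by
        by_contra! h
        exact hX0 (Matrix.ext h)
      set Y : Mat n := (X i j)⁻¹ • X with hYdef
      have hYF : Y ∈ F := F.smul_mem _ hX
      have hYij : Y i j = 1 := by
        rw [hYdef, Matrix.smul_apply, smul_eq_mul, inv_mul_cancel₀ hij]
      by_cases hfix : ∀ σ : ℂ ≃+* ℂ, Y.map σ = Y
      · have hr : ∀ a b, Y a b ∈ Set.range (algebraMap ℚ ℂ) := fun a b =>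
          mem_range_of_forall_ringEquiv fun σ => congrFun (congrFun (hfix σ) a) b
        choose q hq using hr
        refine ⟨Matrix.of q, fun h => ?_, ?_⟩
        · have h1 := hq i j
          have h2 : q i j = 0 := congrFun (congrFun h i) j
          rw [h2, map_zero, hYij] at h1
          exact zero_ne_one h1
        · convert hYF using 1
          ext a b
          exact hq a b
      · push Not at hfix
        obtain ⟨σ, hσ⟩ := hfix
        refine ih (supp (Y.map σ - Y)).card ?_ _ (F.sub_mem (hF σ Y hYF) hYF)
          (sub_ne_zero.2 hσ) rfl
        rw [← hm]
        refine Finset.card_lt_card (Finset.ssubset_iff_subset_ne.2 ⟨fun ab hab => ?_, fun h => ?_⟩)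
        · rw [hsupp] at hab ⊢
          intro h0
          have hY0 : Y ab.1 ab.2 = 0 := by rw [hYdef, Matrix.smul_apply, h0, smul_zero]
          exact hab (by rw [Matrix.sub_apply, Matrix.map_apply, hY0, map_zero, sub_zero])
        · have h1 : (i, j) ∈ supp (Y.map σ - Y) := h ▸ (hsupp X (i, j)).2 hij
          rw [hsupp] at h1
          exact h1 (by rw [Matrix.sub_apply, Matrix.map_apply, hYij, map_one, sub_self])
  obtain ⟨X, hX, hX0⟩ := h0
  exact key _ X hX hX0 rfl

/-- The invariants of the commutator subgroup of a rigid group vanish. -/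
theorem eq_zero_of_isRhoRigid {n : ℕ} {W G' : Subgroup (GL (Fin n) ℂ)} (hW : IsQGroup W)
    (hG' : ∀ σ : ℂ →+* ℂ, ∀ g ∈ G', GeneralLinearGroup.map σ g ∈ G') (h : IsRhoRigid W G')
    {X : Mat n} (hX : X ∈ lieAlgebra W) (hfix : ∀ g ∈ ⁅G', G'⁆, (g : Mat n) * X = X * g) :
    X = 0 := by
  have hcomm : ∀ σ : ℂ →+* ℂ, ∀ g ∈ ⁅G', G'⁆, GeneralLinearGroup.map σ g ∈ ⁅G', G'⁆ := by
    intro σ g hg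
    have h1 : ⁅G'.map (GeneralLinearGroup.map σ), G'.map (GeneralLinearGroup.map σ)⁆ ≤ ⁅G', G'⁆ := by
      have h2 : G'.map (GeneralLinearGroup.map σ) ≤ G' := Subgroup.map_le_iff_le_comap.2 (hG' σ)
      exact Subgroup.commutator_mono h2 h2
    rw [← Subgroup.map_commutator] at h1
    exact h1 ⟨g, hg, rfl⟩
  let F : Submodule ℂ (Mat n) :=
    { carrier := {X | X ∈ lieAlgebra W ∧ ∀ g ∈ ⁅G', G'⁆, (g : Mat n) * X = X * g}
      zero_mem' := ⟨Submodule.zero_mem _, fun g _ => by simp⟩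
      add_mem' := fun ha hb => ⟨Submodule.add_mem _ ha.1 hb.1, fun g hg => by
        rw [mul_add, add_mul, ha.2 g hg, hb.2 g hg]⟩
      smul_mem' := fun c a ha => ⟨Submodule.smul_mem _ c ha.1, fun g hg => by
        rw [Matrix.mul_smul, Matrix.smul_mul, ha.2 g hg]⟩ }
  have hF : ∀ (σ : ℂ ≃+* ℂ), ∀ X ∈ F, X.map σ ∈ F := by
    rintro σ X ⟨hX, hXg⟩
    refine ⟨map_mem_lieAlgebra (fun σ g hg => hW.map_mem _ hg) σ hX, fun g hg => ?_⟩
    have h1 := congrArg (fun M : Mat n => M.map σ) (hXg _ (hcomm (σ.symm : ℂ →+* ℂ) g hg))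
    simp only [Matrix.map_mul] at h1
    have h2 : ((GeneralLinearGroup.map (σ.symm : ℂ →+* ℂ) g : GL (Fin n) ℂ) : Mat n).map σ = g := by
      ext i j
      exact σ.apply_symm_apply _
    rwa [h2] at h1
  by_contra hX0
  obtain ⟨q, hq0, hq⟩ := exists_rational_of_stable hF ⟨X, ⟨hX, hfix⟩, hX0⟩
  have hU := h (Submodule.span ℚ {q}) ?_ ?_
  · exact hq0 (Submodule.span_singleton_eq_bot.1 hU)
  · intro Y hY
    obtain ⟨c, rfl⟩ := Submodule.mem_span_singleton.1 hY
    have : (c • q).map (algebraMap ℚ ℂ) = (c : ℂ) • q.map (algebraMap ℚ ℂ) := by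
      ext i j
      simp
    rw [this]
    exact Submodule.smul_mem _ _ hq.1
  · let S : Set (MvPolynomial (Fin n × Fin n) ℚ) := Set.range fun ij : Fin n × Fin n =>
      ∑ k, (MvPolynomial.X (ij.1, k) * MvPolynomial.C (q k ij.2) -
        MvPolynomial.C (q ij.1 k) * MvPolynomial.X (k, ij.2))
    let Z : Subgroup (GL (Fin n) ℂ) :=
      { carrier := {g | (g : Mat n) * q.map (algebraMap ℚ ℂ) = q.map (algebraMap ℚ ℂ) * g}
        one_mem' := by simp
        mul_mem' := fun {a b} ha hb => by
          change _ = _ at ha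
          change _ = _ at hb
          change _ = _
          rw [Units.val_mul, mul_assoc, hb, ← mul_assoc, ha, mul_assoc]
        inv_mem' := fun {a} ha => by
          change _ = _ at ha
          change _ = _
          calc ((a⁻¹ : GL (Fin n) ℂ) : Mat n) * q.map (algebraMap ℚ ℂ) =
              ((a⁻¹ : GL (Fin n) ℂ) : Mat n) * (q.map (algebraMap ℚ ℂ) * a) *
                ((a⁻¹ : GL (Fin n) ℂ) : Mat n) := by
                rw [mul_assoc, mul_assoc, Units.mul_inv, mul_one]
            _ = _ := by rw [← ha, ← mul_assoc, Units.inv_mul, one_mul] }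
    -- The centralizer of a rational matrix is a `ℚ`-group. Since it contains the commutators it
    -- contains `derivedGroup G'`, so the line through `q` contradicts rigidity.
    have hZ : IsQGroup Z := by
      refine ⟨S, Set.ext fun g => ?_⟩
      have h1 : ∀ i j, MvPolynomial.aeval (fun ij : Fin n × Fin n => g ij.1 ij.2)
          (∑ k, (MvPolynomial.X (i, k) * MvPolynomial.C (q k j) -
            MvPolynomial.C (q i k) * MvPolynomial.X (k, j))) =
          ((g : Mat n) * q.map (algebraMap ℚ ℂ)) i j - (q.map (algebraMap ℚ ℂ) * (g : Mat n)) i j := by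
        intro i j
        rw [Matrix.mul_apply, Matrix.mul_apply, ← Finset.sum_sub_distrib, map_sum]
        refine Finset.sum_congr rfl fun k _ => ?_
        simp
      simp only [S, Set.mem_ofPred_eq, Set.forall_mem_range, h1, Prod.forall, sub_eq_zero]
      exact ⟨fun h i j => congrFun (congrFun h i) j, fun h => Matrix.ext h⟩
    have hle : derivedGroup G' ≤ Z := sInf_le ⟨hZ, fun g hg => hq.2 g hg⟩
    intro Y hY g hg
    obtain ⟨c, rfl⟩ := Submodule.mem_span_singleton.1 hY
    have : (c • q).map (algebraMap ℚ ℂ) = (c : ℂ) • q.map (algebraMap ℚ ℂ) := by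
      ext i j
      simp
    have hgZ : (g : Mat n) * q.map (algebraMap ℚ ℂ) = q.map (algebraMap ℚ ℂ) * g := hle hg
    rw [this, Matrix.mul_smul, Matrix.smul_mul, hgZ, mul_assoc, Units.mul_inv, mul_one]

end Kuga
end

/-! ### The adjoint action -/

open Matrix
noncomputable section
namespace Kuga
open scoped Matrix.Norms.Operator Topology
open NormedSpace Filter

/-- Covers conditions on `Ad g`, which is bilinear in `g` and `g⁻¹`. Replacing the inverse by the
adjugate changes the value by the unit `det g` only. -/
theorem isZariskiClosed_bilinear_inv {n : ℕ} (Φ : Mat n →ₗ[ℂ] Mat n →ₗ[ℂ] Mat n) :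
    IsZariskiClosed ℂ {g : GL (Fin n) ℂ | Φ (g : Mat n) ((g⁻¹ : GL (Fin n) ℂ) : Mat n) = 0} := by
  let M : Matrix (Fin n) (Fin n) (MatPoly n) := Matrix.of fun i j => MvPolynomial.X (i, j)
  have hM : ∀ (A : Mat n) i j, ev (M.adjugate i j) A = A.adjugate i j := by
    intro A i j
    have := RingHom.map_adjugate (MvPolynomial.eval fun ij : Fin n × Fin n => A ij.1 ij.2) M
    have h2 : (MvPolynomial.eval fun ij : Fin n × Fin n => A ij.1 ij.2).mapMatrix M = A := by
      ext i j; simp [M]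
    rw [h2] at this
    rw [← this]
    rfl
  have hsum : ∀ A : Mat n, A = ∑ kl : Fin n × Fin n, A kl.1 kl.2 • Matrix.single kl.1 kl.2 1 := by
    intro A
    conv_lhs => rw [Matrix.matrix_eq_sum_single A]
    rw [Fintype.sum_prod_type]
    refine Finset.sum_congr rfl fun k _ => Finset.sum_congr rfl fun l _ => ?_
    simp
  let p : Fin n × Fin n → MatPoly n := fun ij => ∑ kl : Fin n × Fin n, ∑ ab : Fin n × Fin n,
    MvPolynomial.X kl * (M.adjugate ab.1 ab.2 * MvPolynomial.C
      (Φ (Matrix.single kl.1 kl.2 1) (Matrix.single ab.1 ab.2 1) ij.1 ij.2))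
  have hp : ∀ (A : Mat n) ij, ev (p ij) A = Φ A A.adjugate ij.1 ij.2 := by
    intro A ij
    have h1 : Φ A A.adjugate = ∑ kl : Fin n × Fin n, ∑ ab : Fin n × Fin n,
        (A : Matrix _ _ ℂ) kl.1 kl.2 • A.adjugate ab.1 ab.2 •
          Φ (Matrix.single kl.1 kl.2 1) (Matrix.single ab.1 ab.2 1) := by
      refine Eq.trans (congrArg₂ (fun B C => Φ B C) (hsum A) (hsum A.adjugate)) ?_
      rw [map_sum Φ, LinearMap.sum_apply]
      refine Finset.sum_congr rfl fun kl _ => ?_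
      rw [_root_.map_smul Φ, LinearMap.smul_apply, map_sum, Finset.smul_sum]
      refine Finset.sum_congr rfl fun ab _ => ?_
      rw [_root_.map_smul]
    rw [h1]
    simp only [Matrix.sum_apply, Matrix.smul_apply, smul_eq_mul, ← hM]
    simp only [p, ev, map_sum, map_mul, MvPolynomial.eval_C, MvPolynomial.eval_X]
  have := isZariskiClosed_setOf (Set.range p)
  convert this using 1
  ext g
  simp only [Set.mem_ofPred_eq, Set.forall_mem_range, hp]
  have hdet : IsUnit (g : Mat n).det := (Matrix.isUnit_iff_isUnit_det _).1 g.isUnit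
  have hg : ((g⁻¹ : GL (Fin n) ℂ) : Mat n) = (g : Mat n).det⁻¹ • (g : Mat n).adjugate := by
    rw [Matrix.coe_units_inv, Matrix.inv_def, Ring.inverse_eq_inv]
  rw [hg, _root_.map_smul, smul_eq_zero_iff_right (inv_ne_zero hdet.ne_zero)]
  exact ⟨fun h ij => by rw [h]; rfl, fun h => Matrix.ext fun i j => h (i, j)⟩

/-- Conjugation by `g`. -/
def Ad {n : ℕ} (g : GL (Fin n) ℂ) : Mat n →ₗ[ℂ] Mat n :=
  (LinearMap.mulRight ℂ ((g⁻¹ : GL (Fin n) ℂ) : Mat n)).comp (LinearMap.mulLeft ℂ (g : Mat n))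

theorem Ad_apply {n : ℕ} (g : GL (Fin n) ℂ) (X : Mat n) :
    Ad g X = (g : Mat n) * X * ((g⁻¹ : GL (Fin n) ℂ) : Mat n) := rfl

theorem Ad_mul {n : ℕ} (g h : GL (Fin n) ℂ) (X : Mat n) : Ad (g * h) X = Ad g (Ad h X) := by
  simp only [Ad_apply, _root_.mul_inv_rev, Units.val_mul, mul_assoc]

theorem Ad_one {n : ℕ} (X : Mat n) : Ad (1 : GL (Fin n) ℂ) X = X := by
  simp [Ad_apply]

theorem Ad_mul_apply {n : ℕ} (g : GL (Fin n) ℂ) (X Y : Mat n) :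
    Ad g (X * Y) = Ad g X * Ad g Y := by
  simp only [Ad_apply]
  calc _ = (g : Mat n) * X * (((g⁻¹ : GL (Fin n) ℂ) : Mat n) * (g : Mat n)) * Y *
        ((g⁻¹ : GL (Fin n) ℂ) : Mat n) := by rw [Units.inv_mul, mul_one]; simp only [mul_assoc]
    _ = _ := by simp only [mul_assoc]

theorem Ad_inv_Ad {n : ℕ} (g : GL (Fin n) ℂ) (X : Mat n) : Ad g⁻¹ (Ad g X) = X := by
  rw [← Ad_mul, inv_mul_cancel, Ad_one]

theorem Ad_Ad_inv {n : ℕ} (g : GL (Fin n) ℂ) (X : Mat n) : Ad g (Ad g⁻¹ X) = X := by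
  rw [← Ad_mul, mul_inv_cancel, Ad_one]

theorem Ad_eq_self_iff {n : ℕ} {g : GL (Fin n) ℂ} {X : Mat n} :
    Ad g X = X ↔ (g : Mat n) * X = X * g := by
  rw [Ad_apply]
  constructor
  · intro h
    have := congrArg (· * (g : Mat n)) h
    rwa [mul_assoc, Units.inv_mul, mul_one] at this
  · intro h
    rw [h, mul_assoc, Units.mul_inv, mul_one]

theorem Ad_mem_derivedLie {n : ℕ} {l : Submodule ℂ (Mat n)} {g : GL (Fin n) ℂ}
    (hg : ∀ X ∈ l, Ad g X ∈ l) {X : Mat n} (hX : X ∈ derivedLie l) : Ad g X ∈ derivedLie l := by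
  induction hX using Submodule.span_induction with
  | mem X hX =>
    obtain ⟨A, hA, B, hB, rfl⟩ := hX
    rw [map_sub, Ad_mul_apply, Ad_mul_apply]
    exact bracket_mem_derivedLie (hg A hA) (hg B hB)
  | zero => rw [map_zero]; exact Submodule.zero_mem _
  | add a b _ _ h1 h2 => rw [map_add]; exact Submodule.add_mem _ h1 h2
  | smul c a _ h1 => rw [_root_.map_smul]; exact Submodule.smul_mem _ _ h1

theorem hasDerivAt_Ad_exp {n : ℕ} (X Y : Mat n) (t : ℂ) :
    HasDerivAt (fun t : ℂ => Ad (expGL (t • X)) Y) (Ad (expGL (t • X)) (X * Y - Y * X)) t := by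
  have h1 := hasDerivAt_exp_smul X t
  have h2 := hasDerivAt_exp_smul (-X) t
  have h3 := (h1.mul_const Y).mul h2
  simp only [smul_neg] at h3
  refine h3.congr_deriv ?_
  have hc : exp (-(t • X)) * X = X * exp (-(t • X)) :=
    (((Commute.refl X).smul_right t).neg_right.exp_right).eq.symm
  rw [Ad_apply, coe_expGL, coe_expGL_inv, mul_neg, hc]
  noncomm_ring

/-- If the derivatives of `t ↦ Ad (exp (t X)) Y` lie in `S`, then so do the differences. -/
theorem Ad_exp_sub_mem {n : ℕ} {S : Submodule ℂ (Mat n)} {X Y : Mat n}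
    (h : ∀ t : ℂ, Ad (expGL (t • X)) (X * Y - Y * X) ∈ S) : Ad (expGL X) Y - Y ∈ S := by
  -- A linear map with kernel `S` turns membership into an equation, so that a vanishing derivative
  -- can be used.
  obtain ⟨T, hT⟩ : ∃ T : Mat n →ₗ[ℂ] Mat n, LinearMap.ker T = S := by
    obtain ⟨S', hS'⟩ := S.exists_isCompl
    refine ⟨S'.subtype.comp (S'.projectionOnto S hS'.symm), ?_⟩
    rw [LinearMap.ker_comp_of_ker_eq_bot _ S'.ker_subtype, Submodule.ker_projectionOnto]
  have hd : ∀ t, HasDerivAt (fun t : ℂ => T (Ad (expGL (t • X)) Y)) 0 t := by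
    intro t
    have := (LinearMap.toContinuousLinearMap T).hasFDerivAt.comp_hasDerivAt t
      (hasDerivAt_Ad_exp X Y t)
    refine this.congr_deriv ?_
    have h1 := h t
    rw [← hT] at h1
    exact h1
  have hc := is_const_of_deriv_eq_zero (fun t => (hd t).differentiableAt) (fun t => (hd t).deriv) 1 0
  simp only [one_smul, zero_smul, expGL_zero, Ad_one] at hc
  rw [← hT, LinearMap.mem_ker, map_sub, hc, sub_self]

end Kuga
end

/-! ### Commutators act trivially on the invariants of the derived algebra -/

open Matrix
noncomputable section
namespace Kuga
open scoped Matrix.Norms.Operator Topology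
open NormedSpace Filter

section CommutatorAction

variable {n : ℕ} {L : Subgroup (GL (Fin n) ℂ)}

theorem Ad_mem_lieAlgebra (hL : IsZariskiClosed ℂ (L : Set (GL (Fin n) ℂ))) {g : GL (Fin n) ℂ}
    (hg : g ∈ L) {X : Mat n} (hX : X ∈ lieAlgebra L) : Ad g X ∈ lieAlgebra L :=
  conj_mem_lieAlgebra hL (fun _ hx => L.mul_mem (L.mul_mem hg hx) (L.inv_mem hg)) hX

/-- A connected group acts trivially on the abelianization of its Lie algebra. -/
theorem Ad_sub_mem_derivedLie (hL : IsZariskiClosed ℂ (L : Set (GL (Fin n) ℂ)))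
    (hLc : IsZariskiConnected L) {g : GL (Fin n) ℂ} (hg : g ∈ L) {Y : Mat n}
    (hY : Y ∈ lieAlgebra L) : Ad g Y - Y ∈ derivedLie (lieAlgebra L) := by
  have hst : ∀ g ∈ L, ∀ X ∈ derivedLie (lieAlgebra L), Ad g X ∈ derivedLie (lieAlgebra L) :=
    fun g hg X hX => Ad_mem_derivedLie (fun Y hY => Ad_mem_lieAlgebra hL hg hY) hX
  let Z : Subgroup (GL (Fin n) ℂ) :=
    { carrier := {g | g ∈ L ∧ ∀ Y ∈ lieAlgebra L, Ad g Y - Y ∈ derivedLie (lieAlgebra L)}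
      one_mem' := ⟨L.one_mem, fun Y _ => by rw [Ad_one, sub_self]; exact Submodule.zero_mem _⟩
      mul_mem' := fun {a b} ha hb => ⟨L.mul_mem ha.1 hb.1, fun Y hY => by
        have := Submodule.add_mem _ (hst a ha.1 _ (hb.2 Y hY)) (ha.2 Y hY)
        rwa [map_sub, ← Ad_mul, sub_add_sub_cancel] at this⟩
      inv_mem' := fun {a} ha => ⟨L.inv_mem ha.1, fun Y hY => by
        have := Submodule.neg_mem _ (hst a⁻¹ (L.inv_mem ha.1) _ (ha.2 Y hY))
        rwa [map_sub, Ad_inv_Ad, neg_sub] at this⟩ }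
  obtain ⟨T, hT⟩ : ∃ T : Mat n →ₗ[ℂ] Mat n, LinearMap.ker T = derivedLie (lieAlgebra L) := by
    obtain ⟨S', hS'⟩ := (derivedLie (lieAlgebra L)).exists_isCompl
    refine ⟨S'.subtype.comp (S'.projectionOnto _ hS'.symm), ?_⟩
    rw [LinearMap.ker_comp_of_ker_eq_bot _ S'.ker_subtype, Submodule.ker_projectionOnto]
  have hZ : IsZariskiClosed ℂ (Z : Set (GL (Fin n) ℂ)) := by
    -- The term `Y` of `Ad g Y - Y` is written as `g * g⁻¹ * Y` to make the condition bilinear in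
    -- `g` and `g⁻¹`.
    have h1 := hL.inter (IsZariskiClosed.iInter (ι := lieAlgebra L) fun Y =>
      isZariskiClosed_bilinear_inv (LinearMap.mk₂ ℂ
        (fun A B : Mat n => T (A * (Y : Mat n) * B - A * B * (Y : Mat n)))
        (fun a b c => by rw [← map_add]; congr 1; noncomm_ring)
        (fun c a b => by
          rw [← _root_.map_smul, smul_sub]; simp only [Matrix.smul_mul])
        (fun a b c => by rw [← map_add]; congr 1; noncomm_ring)
        (fun c a b => by
          rw [← _root_.map_smul, smul_sub]; simp only [Matrix.smul_mul, Matrix.mul_smul])))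
    convert h1 using 1
    ext g
    refine and_congr_right fun _ => ?_
    simp only [Subtype.forall, Set.mem_ofPred_eq, LinearMap.mk₂_apply, Units.mul_inv, one_mul, ← hT]
    rfl
  refine (le_of_expGL_mem (Z := Z) hL hLc hZ (fun X hX => ⟨expGL_mem hL hX, fun Y hY => ?_⟩) hg).2
    Y hY
  exact Ad_exp_sub_mem fun t => hst _ (expGL_smul_mem hL hX t) _ (bracket_mem_derivedLie hX hY)

/-- On matrices that commute with the derived algebra, `Ad (exp Y)` depends only on the class of
`Y` modulo the derived algebra. -/
theorem Ad_exp_eq_of_sub_mem (hL : IsZariskiClosed ℂ (L : Set (GL (Fin n) ℂ)))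
    {F : Submodule ℂ (Mat n)} (hF : ∀ g ∈ L, ∀ X ∈ F, Ad g X ∈ F)
    (hd : ∀ Y ∈ derivedLie (lieAlgebra L), ∀ X ∈ F, Y * X = X * Y) {Y Y' : Mat n}
    (hY' : Y' ∈ lieAlgebra L) (hYY' : Y' - Y ∈ derivedLie (lieAlgebra L)) {X : Mat n} (hX : X ∈ F) :
    Ad (expGL Y') X = Ad (expGL Y) X := by
  -- The derivative is a conjugate of the bracket of `Y' - Y` with an element of `F`, which is zero
  -- by assumption.
  have hder : ∀ t : ℂ, HasDerivAt
      (fun t : ℂ => exp (-(t • Y)) * Ad (expGL (t • Y')) X * exp (t • Y)) 0 t := by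
    intro t
    have h1 := hasDerivAt_exp_smul (-Y) t
    have h2 := hasDerivAt_exp_smul Y t
    have h3 := (h1.mul (hasDerivAt_Ad_exp Y' X t)).mul h2
    simp only [smul_neg] at h3
    refine h3.congr_deriv ?_
    have hA : Ad (expGL (t • Y')) X ∈ F := hF _ (expGL_smul_mem hL hY' t) X hX
    have hYY : Ad (expGL (t • Y')) Y' = Y' := by
      rw [Ad_eq_self_iff, coe_expGL]
      exact (((Commute.refl Y').smul_left t).exp_left).eq
    have h4 := hd _ hYY' _ hA
    rw [sub_mul, mul_sub, sub_eq_sub_iff_sub_eq_sub] at h4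
    have hc : exp (t • Y) * Y = Y * exp (t • Y) := (((Commute.refl Y).smul_left t).exp_left).eq
    rw [map_sub, Ad_mul_apply, Ad_mul_apply, hYY, hc, h4, Pi.mul_apply]
    noncomm_ring
  have hc := is_const_of_deriv_eq_zero (fun t => (hder t).differentiableAt)
    (fun t => (hder t).deriv) 1 0
  simp only [one_smul, zero_smul, expGL_zero, Ad_one, neg_zero, exp_zero, mul_one, one_mul] at hc
  rw [Ad_apply (expGL Y), coe_expGL, coe_expGL_inv]
  conv_rhs => rw [← hc]
  have h5 : exp Y * exp (-Y) = 1 := (expGL Y).val_inv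
  calc _ = 1 * Ad (expGL Y') X * 1 := by rw [one_mul, mul_one]
    _ = _ := by rw [← h5]; simp only [mul_assoc]

/-- For `h = exp Y` one has `g * h = exp (Ad g Y) * g`, and `Ad g Y` agrees with `Y` modulo the
derived algebra, so both exponentials act equally on `F`. Connectedness extends this to all `h`.
There is no need to identify the Lie algebra of the commutator subgroup. -/
theorem Ad_comm_of_derivedLie (hL : IsZariskiClosed ℂ (L : Set (GL (Fin n) ℂ)))
    (hLc : IsZariskiConnected L) {F : Submodule ℂ (Mat n)} (hF : ∀ g ∈ L, ∀ X ∈ F, Ad g X ∈ F)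
    (hd : ∀ Y ∈ derivedLie (lieAlgebra L), ∀ X ∈ F, Y * X = X * Y) {g h : GL (Fin n) ℂ} (hg : g ∈ L)
    (hh : h ∈ L) {X : Mat n} (hX : X ∈ F) : Ad h (Ad g X) = Ad g (Ad h X) := by
  let Z : Subgroup (GL (Fin n) ℂ) :=
    { carrier := {h | h ∈ L ∧ ∀ X ∈ F, Ad h (Ad g X) = Ad g (Ad h X)}
      one_mem' := ⟨L.one_mem, fun X _ => by rw [Ad_one, Ad_one]⟩
      mul_mem' := fun {a b} ha hb => ⟨L.mul_mem ha.1 hb.1, fun X hX => by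
        rw [Ad_mul, Ad_mul, hb.2 X hX, ha.2 _ (hF b hb.1 X hX)]⟩
      inv_mem' := fun {a} ha => ⟨L.inv_mem ha.1, fun X hX => by
        have := ha.2 _ (hF _ (L.inv_mem ha.1) X hX)
        rw [Ad_Ad_inv] at this
        rw [← this, Ad_inv_Ad]⟩ }
  have hZ : IsZariskiClosed ℂ (Z : Set (GL (Fin n) ℂ)) := by
    have h1 := hL.inter (IsZariskiClosed.iInter (ι := F) fun X =>
      isZariskiClosed_bilinear_inv (LinearMap.mk₂ ℂ
        (fun A B : Mat n => A * Ad g (X : Mat n) * B - Ad g (A * (X : Mat n) * B))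
        (fun a b c => by simp only [add_mul, map_add]; abel)
        (fun c a b => by simp only [Matrix.smul_mul, _root_.map_smul, smul_sub])
        (fun a b c => by simp only [mul_add, map_add]; abel)
        (fun c a b => by simp only [Matrix.mul_smul, _root_.map_smul, smul_sub])))
    convert h1 using 1
    ext g
    refine and_congr_right fun _ => ?_
    simp only [Subtype.forall, Set.mem_ofPred_eq, LinearMap.mk₂_apply, sub_eq_zero]
    rfl
  refine (le_of_expGL_mem (Z := Z) hL hLc hZ (fun Y hY => ⟨expGL_mem hL hY, fun X hX => ?_⟩) hh).2
    X hX
  have h1 : g * expGL Y = expGL (Ad g Y) * g := by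
    have h2 : expGL (Ad g Y) = g * expGL Y * g⁻¹ := Units.ext (Matrix.exp_units_conj g Y)
    rw [h2, inv_mul_cancel_right]
  rw [← Ad_mul g, h1, Ad_mul]
  exact (Ad_exp_eq_of_sub_mem hL hF hd (Ad_mem_lieAlgebra hL hg hY)
    (Ad_sub_mem_derivedLie hL hLc hg hY) (hF g hg X hX)).symm

end CommutatorAction

namespace IsWeighted

variable {n : ℕ} {gr : Grading n} {P W : Subgroup (GL (Fin n) ℂ)}

theorem Ad_mem_lieW (hw : IsWeighted gr P W) {g : GL (Fin n) ℂ} (hg : g ∈ P) {X : Mat n}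
    (hX : X ∈ lieAlgebra W) : Ad g X ∈ lieAlgebra W :=
  conj_mem_lieAlgebra hw.closedW (hw.normal g hg) hX

/-- `W` acts trivially on its commutative Lie algebra, so the action of `P` on `Lie W` only depends
on the image in the Levi quotient. -/
theorem Ad_prHom (hw : IsWeighted gr P W) (g : P) {X : Mat n} (hX : X ∈ lieAlgebra W) :
    Ad (hw.prHom g) X = Ad (g : GL (Fin n) ℂ) X := by
  have h1 := Ad_mul ((g : GL (Fin n) ℂ) * (hw.prHom g)⁻¹) (hw.prHom g) X
  rw [inv_mul_cancel_right] at h1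
  rw [h1]
  refine (Ad_eq_self_iff.2 ?_).symm
  exact hw.conj_lieW (hw.mul_prHom_inv_mem g) (hw.Ad_mem_lieW (hw.prHom_mem g) hX)

/-- The product of a weighted subgroup with `W` is the preimage of its Levi subgroup. -/
theorem mem_sup_iff (hw : IsWeighted gr P W) {P' W' : Subgroup (GL (Fin n) ℂ)}
    (hw' : IsWeighted gr P' W') (hP' : P' ≤ P) {g : GL (Fin n) ℂ} :
    g ∈ P' ⊔ W ↔ ∃ hg : g ∈ P, hw.prHom ⟨g, hg⟩ ∈ hw'.levi := by
  constructor
  · intro hg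
    have hle : P' ⊔ W ≤ (hw'.levi.comap hw.prHom).map P.subtype := by
      refine sup_le (fun x hx => ⟨⟨x, hP' hx⟩, ?_, rfl⟩) fun x hx => ⟨⟨x, hw.le hx⟩, ?_, rfl⟩
      · exact ⟨⟨x, hx⟩, Units.ext rfl⟩
      · have : hw.prHom ⟨x, hw.le hx⟩ = 1 := Units.ext (hw.mem_W_iff.1 hx).2
        change hw.prHom ⟨x, hw.le hx⟩ ∈ hw'.levi
        rw [this]
        exact one_mem _
    obtain ⟨x, hx, rfl⟩ := hle hg
    exact ⟨x.2, hx⟩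
  · rintro ⟨hg, h⟩
    have h1 := hw.mul_prHom_inv_mem ⟨g, hg⟩
    have h2 := Subgroup.mul_mem _ (Subgroup.mem_sup_right (S := P') h1)
      (Subgroup.mem_sup_left (T := W) (hw'.levi_le h))
    rwa [inv_mul_cancel_right] at h2

/-- If `π(P')` is rigid, then no nonzero element of `Lie W` commutes with the derived algebra of
the Levi quotient of `P'`. -/
theorem eq_zero_of_comm_derivedLie (hw : IsWeighted gr P W) {P' W' G : Subgroup (GL (Fin n) ℂ)}
    (hw' : IsWeighted gr P' W') (hP' : P' ≤ P) (hWQ : IsQGroup W) (hPQ : IsQGroup P')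
    (hGQ : IsQGroup G) (hrig : IsRhoRigid W (leviProjection W G P')) {X : Mat n}
    (hX : X ∈ lieAlgebra W) (h : ∀ Y ∈ derivedLie (lieAlgebra hw'.levi), Y * X = X * Y) : X = 0 := by
  have hlev : ∀ l ∈ hw'.levi, l ∈ P := fun l hl => hP' (hw'.levi_le hl)
  let F : Submodule ℂ (Mat n) :=
    { carrier := {X | X ∈ lieAlgebra W ∧ ∀ Y ∈ derivedLie (lieAlgebra hw'.levi), Y * X = X * Y}
      zero_mem' := ⟨Submodule.zero_mem _, fun g _ => by simp⟩
      add_mem' := fun ha hb => ⟨Submodule.add_mem _ ha.1 hb.1, fun g hg => by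
        rw [mul_add, add_mul, ha.2 g hg, hb.2 g hg]⟩
      smul_mem' := fun c a ha => ⟨Submodule.smul_mem _ c ha.1, fun g hg => by
        rw [Matrix.mul_smul, Matrix.smul_mul, ha.2 g hg]⟩ }
  have hF : ∀ g ∈ hw'.levi, ∀ X ∈ F, Ad g X ∈ F := by
    rintro g hg X ⟨hX, hXc⟩
    refine ⟨hw.Ad_mem_lieW (hlev g hg) hX, fun Y hY => ?_⟩
    have h1 := hXc _ (Ad_mem_derivedLie (fun Y hY => Ad_mem_lieAlgebra hw'.isZariskiClosed_levi
      (hw'.levi.inv_mem hg) hY) hY)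
    have h2 := congrArg (Ad g) h1
    rwa [Ad_mul_apply, Ad_mul_apply, Ad_Ad_inv] at h2
  refine eq_zero_of_isRhoRigid hWQ (fun σ g hg => ?_) hrig hX fun g hg => ?_
  · have hsup : (P' ⊔ W).map (GeneralLinearGroup.map σ) ≤ P' ⊔ W := by
      rw [Subgroup.map_sup]
      refine sup_le_sup ?_ ?_
      · rintro _ ⟨x, hx, rfl⟩
        exact hPQ.map_mem σ hx
      · rintro _ ⟨x, hx, rfl⟩
        exact hWQ.map_mem σ hx
    exact ⟨hsup ⟨g, hg.1, rfl⟩, hGQ.map_mem σ hg.2⟩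
  · let S : Subgroup (GL (Fin n) ℂ) :=
      { carrier := {g | Ad g X = X}
        one_mem' := Ad_one X
        mul_mem' := fun {a b} ha hb => by
          change _ = _
          rw [Ad_mul, show Ad b X = X from hb, show Ad a X = X from ha]
        inv_mem' := fun {a} ha => by
          change _ = _
          conv_lhs => rw [← show Ad a X = X from ha]
          exact Ad_inv_Ad a X }
    have hle : ⁅leviProjection W G P', leviProjection W G P'⁆ ≤ S := by
      refine Subgroup.commutator_le.2 fun a ha b hb => ?_
      obtain ⟨haP, ha'⟩ := (hw.mem_sup_iff hw' hP').1 ha.1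
      obtain ⟨hbP, hb'⟩ := (hw.mem_sup_iff hw' hP').1 hb.1
      change Ad (a * b * a⁻¹ * b⁻¹) X = X
      -- The commutator acts on `X` like its image under `prHom`, which is a commutator in the Levi
      -- subgroup of `P'`.
      let c : P := ⟨a, haP⟩ * ⟨b, hbP⟩ * ⟨a, haP⟩⁻¹ * ⟨b, hbP⟩⁻¹
      have h1 := hw.Ad_prHom c hX
      refine h1.symm.trans ?_
      set l := hw.prHom ⟨a, haP⟩
      set m := hw.prHom ⟨b, hbP⟩
      have h2 : hw.prHom c = l * m * (m * l)⁻¹ := by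
        simp only [c, map_mul, map_inv, _root_.mul_inv_rev, mul_assoc]
        rfl
      have hXF : Ad (m * l)⁻¹ X ∈ F :=
        hF _ (hw'.levi.inv_mem (hw'.levi.mul_mem hb' ha')) X ⟨hX, h⟩
      rw [h2, Ad_mul, Ad_mul, ← Ad_comm_of_derivedLie hw'.isZariskiClosed_levi
        hw'.isZariskiConnected_levi hF (fun Y hY X hX => hX.2 Y hY) ha' hb' hXF, ← Ad_mul, Ad_Ad_inv]
    exact Ad_eq_self_iff.1 (hle hg)

end IsWeighted

end Kuga
end

/-! ### Lattice subspaces and Baire's theorem -/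

open Matrix
noncomputable section
namespace Kuga
open scoped Matrix.Norms.Operator Topology
open NormedSpace Filter

theorem isQGroup_sInf {n : ℕ} {T : Set (Subgroup (GL (Fin n) ℂ))} (hT : ∀ K ∈ T, IsQGroup K) :
    IsQGroup (sInf T) := by
  choose! S hS using hT
  refine ⟨⋃ K ∈ T, S K, Set.ext fun g => ?_⟩
  rw [SetLike.mem_coe, Subgroup.mem_sInf]
  have h1 : ∀ K ∈ T, (g ∈ K ↔ ∀ f ∈ S K,
      MvPolynomial.aeval (fun ij : Fin n × Fin n => g ij.1 ij.2) f = 0) := fun K hK => by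
    rw [← SetLike.mem_coe, hS K hK]; rfl
  constructor
  · intro h f hf
    obtain ⟨K, hK, hfK⟩ := Set.mem_iUnion₂.1 hf
    exact (h1 K hK).1 (h K hK) f hfK
  · intro h K hK
    exact (h1 K hK).2 fun f hf => h f (Set.mem_iUnion₂.2 ⟨K, hK, hf⟩)

theorem isQGroup_derivedGroup {n : ℕ} (H : Subgroup (GL (Fin n) ℂ)) : IsQGroup (derivedGroup H) :=
  isQGroup_sInf fun _ hK => hK.1

theorem commutator_le_derivedGroup {n : ℕ} (H : Subgroup (GL (Fin n) ℂ)) : ⁅H, H⁆ ≤ derivedGroup H :=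
  le_sInf fun _ hK => hK.2

theorem derivedGroup_mono {n : ℕ} {H K : Subgroup (GL (Fin n) ℂ)} (h : H ≤ K) :
    derivedGroup H ≤ derivedGroup K :=
  le_sInf fun _ hL => sInf_le ⟨hL.1, (Subgroup.commutator_mono h h).trans hL.2⟩

theorem derivedGroup_le {n : ℕ} {H : Subgroup (GL (Fin n) ℂ)} (hH : IsQGroup H) :
    derivedGroup H ≤ H :=
  sInf_le ⟨hH, Subgroup.commutator_le.2 fun _ ha _ hb =>
    H.mul_mem (H.mul_mem (H.mul_mem ha hb) (H.inv_mem ha)) (H.inv_mem hb)⟩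

/-- The exponential of a real matrix as an element of `GL n ℝ`. -/
def expReal {n : ℕ} (Y : Matrix (Fin n) (Fin n) ℝ) : GL (Fin n) ℝ where
  val := exp Y
  inv := exp (-Y)
  val_inv := by rw [← Matrix.exp_add_of_commute _ _ (Commute.refl Y).neg_right, add_neg_cancel, exp_zero]
  inv_val := by rw [← Matrix.exp_add_of_commute _ _ (Commute.refl Y).neg_left, neg_add_cancel, exp_zero]

theorem map_expReal {n : ℕ} (Y : Matrix (Fin n) (Fin n) ℝ) (t : ℝ) :
    GeneralLinearGroup.map (algebraMap ℝ ℂ) (expReal (t • Y)) =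
      expGL ((t : ℂ) • Y.map (algebraMap ℝ ℂ)) := by
  refine Units.ext ?_
  have h := map_exp (algebraMap ℝ ℂ).mapMatrix (continuous_id.matrix_map Complex.continuous_ofReal)
    (t • Y)
  refine h.trans ?_
  rw [coe_expGL]
  congr 1
  ext i j
  simp

theorem expReal_mem_realPointsPlus {n : ℕ} {H : Subgroup (GL (Fin n) ℂ)}
    (hH : IsZariskiClosed ℂ (H : Set (GL (Fin n) ℂ))) {Y : Matrix (Fin n) (Fin n) ℝ}
    (hY : Y.map (algebraMap ℝ ℂ) ∈ lieAlgebra H) (t : ℝ) : expReal (t • Y) ∈ realPointsPlus H := by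
  have hmem : ∀ t : ℝ, expReal (t • Y) ∈ realPoints H := fun t => by
    change GeneralLinearGroup.map (algebraMap ℝ ℂ) (expReal (t • Y)) ∈ H
    rw [map_expReal]
    exact expGL_smul_mem hH hY _
  let γ : ℝ → realPoints H := fun t => ⟨expReal (t • Y), hmem t⟩
  have hγ : Continuous γ := by
    refine Continuous.subtype_mk ?_ _
    refine Units.continuous_iff.2 ⟨?_, ?_⟩
    · exact (exp_continuous).comp (continuous_id.smul continuous_const)
    · exact (exp_continuous).comp (continuous_id.smul continuous_const).neg
  have h0 : γ 0 = 1 := Subtype.ext (Units.ext (by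
    change exp ((0 : ℝ) • Y) = 1
    rw [zero_smul, exp_zero]))
  have h1 : IsPreconnected (Set.range γ) := isPreconnected_range hγ
  have h2 := h1.subset_connectedComponent (x := 1) ⟨0, h0⟩
  exact ⟨γ t, h2 ⟨t, rfl⟩, rfl⟩

/-- A real one-parameter group that lies in countably many translates of a closed group
lies in the group. -/
theorem mem_lieAlgebra_of_countable {n : ℕ} {H : Subgroup (GL (Fin n) ℂ)}
    (hH : IsZariskiClosed ℂ (H : Set (GL (Fin n) ℂ))) {ι : Type*} [Countable ι]
    (q : ι → GL (Fin n) ℂ) {X : Mat n} (h : ∀ t : ℝ, ∃ i, q i * expGL ((t : ℂ) • X) ∈ H) :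
    X ∈ lieAlgebra H := by
  let T : ι → Set ℝ := fun i => {t | q i * expGL ((t : ℂ) • X) ∈ H}
  have hT : ∀ i, IsClosed (T i) := by
    intro i
    have h1 : T i = ⋂ (f : MatPoly n) (_ : VanishesOn f (H : Set (GL (Fin n) ℂ))),
        {t : ℝ | ev f ((q i : Mat n) * exp ((t : ℂ) • X)) = 0} := by
      ext t
      simp only [Set.mem_iInter, Set.mem_ofPred_eq]
      exact ⟨fun ht f hf => hf (q i * expGL ((t : ℂ) • X)) ht,
        fun ht => isZariskiClosed_iff.1 hH (q i * expGL ((t : ℂ) • X)) ht⟩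
    rw [h1]
    refine isClosed_iInter fun f => isClosed_iInter fun _ => ?_
    refine isClosed_eq ((continuous_ev f).comp ?_) continuous_const
    exact continuous_const.mul (exp_continuous.comp
      (Complex.continuous_ofReal.smul continuous_const))
  -- By Baire's theorem one translate contains an interval of times. Quotients of its points give
  -- `exp (s X) ∈ H` for all small `s`, and powers of these give all `s`.
  obtain ⟨i, t0, ht0⟩ := nonempty_interior_of_iUnion_of_closed hT
    (Set.eq_univ_of_forall fun t => Set.mem_iUnion.2 (h t))
  rw [mem_interior_iff_mem_nhds, Metric.mem_nhds_iff] at ht0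
  obtain ⟨ε, hε, hball⟩ := ht0
  have hsmall : ∀ s : ℝ, |s| < ε → expGL ((s : ℂ) • X) ∈ H := by
    intro s hs
    have h1 : q i * expGL ((t0 : ℂ) • X) ∈ H := hball (Metric.mem_ball_self hε)
    have h2 : q i * expGL (((t0 + s : ℝ) : ℂ) • X) ∈ H := hball (by
      rw [Metric.mem_ball, Real.dist_eq, add_sub_cancel_left]; exact hs)
    have h3 := H.mul_mem (H.inv_mem h1) h2
    rw [Complex.ofReal_add, expGL_add_smul] at h3
    convert h3 using 1
    group
  refine mem_lieAlgebra_of_expGL fun t => ?_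
  obtain ⟨m, hm⟩ := exists_nat_gt (|t| / ε)
  have hm0 : (0 : ℝ) < m := lt_of_le_of_lt (div_nonneg (abs_nonneg t) hε.le) hm
  have h1 := hsmall (t / m) (by
    rw [abs_div, abs_of_pos hm0, div_lt_iff₀ hm0, mul_comm]
    exact (div_lt_iff₀ hε).1 hm)
  have h2 := H.pow_mem h1 m
  rw [← expGL_nsmul, smul_smul] at h2
  have h3 : (m : ℂ) * ((t / m : ℝ) : ℂ) = t := by
    push_cast
    have : (m : ℂ) ≠ 0 := by exact_mod_cast hm0.ne'
    field_simp
  rwa [h3] at h2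

/-- Lattice subspaces determine the Lie algebras of the derived groups. -/
theorem lieAlgebra_derivedGroup_le {n : ℕ} {P P₁ P₂ : Subgroup (GL (Fin n) ℂ)}
    {Γ : Subgroup (GL (Fin n) ℚ)} (h₁ : P₁ ≤ P)
    (h : latticeSubspace P Γ P₁ = latticeSubspace P Γ P₂) :
    lieAlgebra (derivedGroup P₁) ≤ lieAlgebra (derivedGroup P₂) := by
  have hreal : ∀ Y : Matrix (Fin n) (Fin n) ℝ,
      Y.map (algebraMap ℝ ℂ) ∈ lieAlgebra (derivedGroup P₁) →
      Y.map (algebraMap ℝ ℂ) ∈ lieAlgebra (derivedGroup P₂) := by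
    intro Y hY
    have : Countable (Matrix (Fin n) (Fin n) ℚ) :=
      inferInstanceAs (Countable (Fin n → Fin n → ℚ))
    have : Countable (GL (Fin n) ℚ) := Units.val_injective.countable
    -- Equality of cosets yields `q ∈ Γ` such that `q⁻¹ * exp (t Y)` is a real point of the derived
    -- group of `P₂`. There are only countably many rational matrices `q`.
    refine mem_lieAlgebra_of_countable (isQGroup_derivedGroup P₂).isClosed
      (fun q : GL (Fin n) ℚ => (GeneralLinearGroup.map (algebraMap ℚ ℂ) q)⁻¹) fun t => ?_
    have h1 := expReal_mem_realPointsPlus (isQGroup_derivedGroup P₁).isClosed hY t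
    have h2 := expReal_mem_realPointsPlus (isQGroup_derivedGroup P).isClosed
      (lieAlgebra_mono (derivedGroup_mono h₁) hY) t
    have h3 : uniformization P Γ ⟨_, h2⟩ ∈ latticeSubspace P Γ P₁ := ⟨⟨_, h2⟩, h1, rfl⟩
    rw [h] at h3
    obtain ⟨g, hg, hgu⟩ := h3
    have h4 := QuotientGroup.rightRel_apply.1 (Quotient.exact hgu)
    obtain ⟨q, hq, hqe⟩ := Subgroup.mem_subgroupOf.1 h4
    refine ⟨q, ?_⟩
    obtain ⟨⟨g', hg'⟩, -, hgg⟩ := hg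
    have hgg' : g' = (g : GL (Fin n) ℝ) := hgg
    have h5 : GeneralLinearGroup.map (algebraMap ℚ ℂ) q = GeneralLinearGroup.map (algebraMap ℝ ℂ)
        (GeneralLinearGroup.map (algebraMap ℚ ℝ) q) := by
      refine Units.ext (Matrix.ext fun i j => ?_)
      exact (IsScalarTower.algebraMap_apply ℚ ℝ ℂ _)
    rw [h5, hqe, ← map_expReal, ← map_inv, ← map_mul]
    change GeneralLinearGroup.map (algebraMap ℝ ℂ)
      ((expReal (t • Y) * (g : GL (Fin n) ℝ)⁻¹)⁻¹ * expReal (t • Y)) ∈ _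
    rw [_root_.mul_inv_rev, inv_inv, mul_assoc, inv_mul_cancel, mul_one, ← hgg']
    exact hg'
  intro X hX
  -- The Lie algebra is stable under complex conjugation, hence contains the real and imaginary
  -- parts of its elements.
  have hconj := map_mem_lieAlgebra (fun σ g hg => (isQGroup_derivedGroup P₁).map_mem _ hg)
    (starRingAut : ℂ ≃+* ℂ) hX
  have hre : (Matrix.of fun i j => (X i j).re : Matrix (Fin n) (Fin n) ℝ).map (algebraMap ℝ ℂ) =
      (1 / 2 : ℂ) • (X + X.map (starRingAut : ℂ ≃+* ℂ)) := by
    ext i j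
    have := Complex.add_conj (X i j)
    simp only [Matrix.map_apply, Matrix.of_apply, Matrix.smul_apply, Matrix.add_apply, smul_eq_mul,
      starRingAut_apply, ← starRingEnd_apply, this, Complex.coe_algebraMap]
    push_cast
    ring
  have him : (Matrix.of fun i j => (X i j).im : Matrix (Fin n) (Fin n) ℝ).map (algebraMap ℝ ℂ) =
      (1 / (2 * Complex.I) : ℂ) • (X - X.map (starRingAut : ℂ ≃+* ℂ)) := by
    ext i j
    have := Complex.sub_conj (X i j)
    simp only [Matrix.map_apply, Matrix.of_apply, Matrix.smul_apply, Matrix.sub_apply, smul_eq_mul,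
      starRingAut_apply, ← starRingEnd_apply, this, Complex.coe_algebraMap]
    have := Complex.I_ne_zero
    push_cast
    field_simp
  have h1 := hreal _ (hre ▸ Submodule.smul_mem _ _ (Submodule.add_mem _ hX hconj))
  have h2 := hreal _ (him ▸ Submodule.smul_mem _ _ (Submodule.sub_mem _ hX hconj))
  have h3 := Submodule.add_mem _ h1 (Submodule.smul_mem _ Complex.I h2)
  convert h3 using 1
  ext i j
  simp only [Matrix.add_apply, Matrix.smul_apply, Matrix.map_apply, Matrix.of_apply, smul_eq_mul,
    Complex.coe_algebraMap]
  rw [mul_comm]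
  exact (Complex.re_add_im _).symm

end Kuga
end

/-! ### Unipotent radicals, central tori and the projection to `G` -/

open Matrix
noncomputable section
namespace Kuga
open scoped Matrix.Norms.Operator Topology
open NormedSpace Filter

theorem Grading.conj_of_isOne {n : ℕ} (gr : Grading n) {X : Mat n} (h : gr.IsOne X) (t : ℂˣ) :
    gr.S t * X * gr.S (t⁻¹ : ℂˣ) = (t : ℂ) • X := by
  refine gr.eq_of_blocks fun i j => ?_
  rw [gr.E_mul_conj_mul_E, Matrix.mul_smul, Matrix.smul_mul]
  by_cases hij : (i : ℕ) = j + 1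
  · rw [hij, pow_succ, mul_right_comm, ← mul_pow, Units.mul_inv, one_pow, one_mul]
  · rw [h i j hij, smul_zero, smul_zero]

section Center

variable {n : ℕ} {H : Subgroup (GL (Fin n) ℂ)}

theorem mem_map_center_iff {g : GL (Fin n) ℂ} :
    g ∈ (Subgroup.center H).map H.subtype ↔ g ∈ H ∧ ∀ x ∈ H, g * x = x * g := by
  constructor
  · rintro ⟨g, hg, rfl⟩
    exact ⟨g.2, fun x hx => congrArg Subtype.val (Subgroup.mem_center_iff.1 hg ⟨x, hx⟩).symm⟩
  · rintro ⟨hg, h⟩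
    exact ⟨⟨g, hg⟩, Subgroup.mem_center_iff.2 fun x => Subtype.ext (h x x.2).symm, rfl⟩

theorem isZariskiClosed_map_center (hH : IsZariskiClosed ℂ (H : Set (GL (Fin n) ℂ))) :
    IsZariskiClosed ℂ ((Subgroup.center H).map H.subtype : Set (GL (Fin n) ℂ)) := by
  have h1 := hH.inter (isZariskiClosed_commute ((fun g : GL (Fin n) ℂ => (g : Mat n)) '' H))
  convert h1 using 1
  ext g
  rw [SetLike.mem_coe, mem_map_center_iff]
  refine and_congr_right fun _ => ?_
  rw [Set.mem_ofPred_eq, Set.forall_mem_image]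
  exact forall₂_congr fun x _ => ⟨fun h => congrArg Units.val h, fun h => Units.ext h⟩

theorem connectedCenter_le (hH : IsZariskiClosed ℂ (H : Set (GL (Fin n) ℂ))) :
    connectedCenter H ≤ H := by
  have h1 : connectedCenter H ≤ (Subgroup.center H).map H.subtype :=
    sInf_le ⟨le_rfl, isZariskiClosed_map_center hH, by
      rw [Subgroup.relIndex_self]; exact one_ne_zero⟩
  exact h1.trans fun g hg => (mem_map_center_iff.1 hg).1

/-- Infinitely divisible elements lie in the identity component. -/
theorem mem_identityComponent_of_divisible {g : GL (Fin n) ℂ}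
    (h : ∀ m : ℕ, 0 < m → ∃ x ∈ H, x ^ m = g) : g ∈ identityComponent H := by
  refine Subgroup.mem_sInf.2 fun K hK => ?_
  -- Some positive power of `x` with exponent at most the index of `K` lies in `K`, and the
  -- factorial is a multiple of every such exponent.
  obtain ⟨x, hx, rfl⟩ := h (K.relIndex H).factorial (Nat.factorial_pos _)
  exact (Subgroup.pow_mem_of_relIndex_ne_zero_of_dvd hK.2.2 hx fun m hm hmK =>
    Nat.dvd_factorial hm hmK).1

end Center

namespace IsWeighted

variable {n : ℕ} {gr : Grading n} {P W : Subgroup (GL (Fin n) ℂ)}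

theorem mem_lieW_of_le (hw : IsWeighted gr P W) {P' W' : Subgroup (GL (Fin n) ℂ)}
    (hw' : IsWeighted gr P' W') (hP' : P' ≤ P) {X : Mat n} :
    X ∈ lieAlgebra W' ↔ X ∈ lieAlgebra P' ∧ X ∈ lieAlgebra W := by
  rw [hw.mem_lieW_iff, hw'.mem_lieW_iff]
  exact ⟨fun h => ⟨h.1, lieAlgebra_mono hP' h.1, h.2⟩, fun h => ⟨h.1, h.2.2⟩⟩

/-- `Lie W` is contained in the Lie algebra of the derived group. -/
theorem lieW_le_derivedGroup (hw : IsWeighted gr P W) :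
    lieAlgebra W ≤ lieAlgebra (derivedGroup P) := by
  intro X hX
  refine mem_lieAlgebra_of_expGL fun t => ?_
  -- The cocharacter at `2` conjugates `x = exp (t X)` to `x ^ 2`, because `X` has weight 1. The
  -- commutator of `g` and `x` is therefore `x` itself.
  obtain ⟨g, hg, hgX⟩ := hw.cochar (Units.mk0 2 two_ne_zero)
  have hx : expGL ((t : ℂ) • X) ∈ P := expGL_smul_mem hw.closed (lieAlgebra_mono hw.le hX) t
  have h1 : g * expGL ((t : ℂ) • X) * g⁻¹ = expGL ((t : ℂ) • X) * expGL ((t : ℂ) • X) := by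
    have h2 : Ad g ((t : ℂ) • X) = (t : ℂ) • X + (t : ℂ) • X := by
      rw [_root_.map_smul, Ad_apply, hgX, gr.conj_of_isOne (hw.isOne X hX), Units.val_mk0, two_smul,
        smul_add]
    rw [← expGL_add (Commute.refl _), ← h2]
    exact Units.ext (Matrix.exp_units_conj g _).symm
  have h3 := commutator_le_derivedGroup P (Subgroup.commutator_mem_commutator hg hx)
  rwa [commutatorElement_def, h1, mul_inv_cancel_right] at h3

/-- Recovers the Lie algebra of the unipotent radical from that of the derived group. It works
because one grading serves both `P'` and `P`. -/
theorem mem_lieW_iff_derivedGroup (hw : IsWeighted gr P W) {P' W' : Subgroup (GL (Fin n) ℂ)}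
    (hw' : IsWeighted gr P' W') (hP' : P' ≤ P) (hPQ : IsQGroup P') {X : Mat n} :
    X ∈ lieAlgebra W' ↔ X ∈ lieAlgebra (derivedGroup P') ∧ X ∈ lieAlgebra W := by
  refine ⟨fun h => ⟨hw'.lieW_le_derivedGroup h, ((hw.mem_lieW_of_le hw' hP').1 h).2⟩, fun h => ?_⟩
  exact (hw.mem_lieW_of_le hw' hP').2 ⟨lieAlgebra_mono (derivedGroup_le hPQ) h.1, h.2⟩

/-- `P' W` is the preimage under the projection `pr` of the closed Levi subgroup of `P'`. -/
theorem isZariskiClosed_sup (hw : IsWeighted gr P W) {P' W' : Subgroup (GL (Fin n) ℂ)}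
    (hw' : IsWeighted gr P' W') (hP' : P' ≤ P) :
    IsZariskiClosed ℂ ((P' ⊔ W : Subgroup (GL (Fin n) ℂ)) : Set (GL (Fin n) ℂ)) := by
  obtain ⟨S, hS⟩ := hw'.isZariskiClosed_levi
  have h1 := hw.closed.inter
    (isZariskiClosed_linear_preimage gr.pr (MvPolynomial.map (algebraMap ℂ ℂ) '' S))
  convert h1 using 1
  ext g
  rw [SetLike.mem_coe, hw.mem_sup_iff hw' hP', Set.mem_inter_iff, SetLike.mem_coe, ← exists_prop]
  refine exists_congr fun hg => ?_
  rw [← SetLike.mem_coe, hS, Set.mem_ofPred_eq, Set.mem_ofPred_eq, Set.forall_mem_image]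
  refine forall₂_congr fun f _ => ?_
  rw [ev, MvPolynomial.eval_map, ← MvPolynomial.aeval_def]
  rfl

/-- Elements of `P` with the same image in the Levi quotient as an element of `G`. -/
theorem exists_mem_isLevi (hw : IsWeighted gr P W) {G : Subgroup (GL (Fin n) ℂ)}
    (hG : IsLevi P W G) (x : P) :
    ∃ a : P, (a : GL (Fin n) ℂ) ∈ G ∧ hw.prHom a = hw.prHom x := by
  have h1 : P ≤ ((((G.subgroupOf P).map hw.prHom).comap hw.prHom).map P.subtype) := by
    conv_lhs => rw [← hG.2.2.2]
    refine sup_le (fun w hwW => ⟨⟨w, hw.le hwW⟩, ?_, rfl⟩) fun a ha =>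
      ⟨⟨a, hG.2.1 ha⟩, ⟨⟨a, hG.2.1 ha⟩, ha, rfl⟩, rfl⟩
    have : hw.prHom ⟨w, hw.le hwW⟩ = 1 := Units.ext (hw.mem_W_iff.1 hwW).2
    change hw.prHom ⟨w, hw.le hwW⟩ ∈ (G.subgroupOf P).map hw.prHom
    rw [this]
    exact one_mem _
  obtain ⟨y, ⟨a, ha, hay⟩, hyx⟩ := h1 x.2
  have : y = x := Subtype.ext hyx
  exact ⟨a, ha, this ▸ hay⟩

theorem prHom_injOn_isLevi (hw : IsWeighted gr P W) {G : Subgroup (GL (Fin n) ℂ)}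
    (hG : IsLevi P W G) {a b : P} (ha : (a : GL (Fin n) ℂ) ∈ G) (hb : (b : GL (Fin n) ℂ) ∈ G)
    (h : hw.prHom a = hw.prHom b) : a = b := by
  have h1 : hw.prHom (a * b⁻¹) = 1 := by rw [map_mul, map_inv, h, mul_inv_cancel]
  have h2 : ((a * b⁻¹ : P) : GL (Fin n) ℂ) ∈ W ⊓ G :=
    ⟨hw.mem_W_iff.2 ⟨(a * b⁻¹).2, congrArg Units.val h1⟩, G.mul_mem ha (G.inv_mem hb)⟩
  rw [hG.2.2.1, Subgroup.mem_bot] at h2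
  exact mul_inv_eq_one.1 (Subtype.ext h2)

/-- The central one-parameter groups of the Levi subgroup of `P'` lie in the product of `W` with
the connected center of the image of `P'` in `G`. -/
theorem exists_mem_connectedCenter (hw : IsWeighted gr P W) {P' W' G : Subgroup (GL (Fin n) ℂ)}
    (hw' : IsWeighted gr P' W') (hP' : P' ≤ P) (hG : IsLevi P W G) {Z : Mat n}
    (hZ : Z ∈ lieAlgebra hw'.levi) (hZc : ∀ Y ∈ lieAlgebra hw'.levi, Z * Y = Y * Z) :
    ∃ a ∈ connectedCenter (leviProjection W G P'), expGL Z * a⁻¹ ∈ W := by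
  have hexp : ∀ t : ℂ, expGL (t • Z) ∈ hw'.levi := fun t =>
    expGL_smul_mem hw'.isZariskiClosed_levi hZ t
  have hcent : ∀ t : ℂ, ∀ x ∈ hw'.levi, expGL (t • Z) * x = x * expGL (t • Z) := by
    intro t x hx
    have hcl : IsZariskiClosed ℂ (Subgroup.centralizer {expGL (t • Z)} : Set (GL (Fin n) ℂ)) := by
      convert isZariskiClosed_commute {(expGL (t • Z) : Mat n)} using 1
      ext g
      rw [SetLike.mem_coe, Subgroup.mem_centralizer_singleton_iff, Set.mem_ofPred_eq]
      simp only [Set.mem_singleton_iff, forall_eq]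
      exact ⟨fun h => congrArg Units.val h, fun h => Units.ext h⟩
    refine (Subgroup.mem_centralizer_singleton_iff.1 (le_of_expGL_mem hw'.isZariskiClosed_levi
      hw'.isZariskiConnected_levi hcl (fun Y hY => ?_) hx)).symm
    refine Subgroup.mem_centralizer_singleton_iff.2 (Units.ext ?_)
    have h1 : Commute Y (t • Z) := Commute.smul_right (hZc Y hY).symm t
    exact (h1.exp_left.exp_right).eq
  have hexpP : ∀ t : ℂ, expGL (t • Z) ∈ P := fun t => hP' (hw'.levi_le (hexp t))
  -- `a t` is the element of `G` congruent to `exp (t Z)` modulo `W`. It is central in the image of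
  -- `P'`, since `G` maps injectively to the Levi quotient.
  choose a haG hapr using fun t => hw.exists_mem_isLevi hG ⟨expGL (t • Z), hexpP t⟩
  have hpr : ∀ t, hw.prHom (a t) = expGL (t • Z) := fun t => by
    rw [hapr]
    exact Units.ext (hw'.mem_levi_iff.1 (hexp t)).2
  have ha : ∀ t, (a t : GL (Fin n) ℂ) ∈
      (Subgroup.center (leviProjection W G P')).map (leviProjection W G P').subtype := by
    intro t
    refine mem_map_center_iff.2 ⟨⟨(hw.mem_sup_iff hw' hP').2 ⟨(a t).2, ?_⟩, haG t⟩, fun x hx => ?_⟩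
    · have := hpr t
      rw [Subtype.coe_eta, this]
      exact hexp t
    · obtain ⟨hxP, hxL⟩ := (hw.mem_sup_iff hw' hP').1 hx.1
      refine congrArg Subtype.val (hw.prHom_injOn_isLevi hG (a := a t * ⟨x, hxP⟩)
        (b := ⟨x, hxP⟩ * a t) (G.mul_mem (haG t) hx.2) (G.mul_mem hx.2 (haG t)) ?_)
      rw [map_mul, map_mul, hpr, hcent t _ hxL]
  -- Since `a (1 / m) ^ m = a 1`, the element is infinitely divisible in the center and lies in its
  -- identity component.
  refine ⟨a 1, mem_identityComponent_of_divisible fun m hm => ⟨a (1 / m), ha _, ?_⟩, ?_⟩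
  · refine congrArg Subtype.val (hw.prHom_injOn_isLevi hG (a := a (1 / m) ^ m) (b := a 1)
      (G.pow_mem (haG _) m) (haG 1) ?_)
    rw [map_pow, hpr, hpr, ← expGL_nsmul, smul_smul, mul_one_div_cancel (by exact_mod_cast hm.ne')]
  · have h1 := hexpP 1
    rw [one_smul] at h1
    have h2 : expGL Z = hw.prHom (a 1) := by rw [hpr, one_smul]
    have h3 : hw.prHom ⟨expGL Z, h1⟩ = hw.prHom (a 1) := by
      rw [hapr]; congr 2; rw [one_smul]
    refine hw.mem_W_iff.2 ⟨P.mul_mem h1 (P.inv_mem (a 1).2), ?_⟩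
    have h4 : hw.prHom (⟨expGL Z, h1⟩ * (a 1)⁻¹) = 1 := by rw [map_mul, map_inv, h3, mul_inv_cancel]
    exact congrArg Units.val h4

/-- If all `exp (t X)` lie in `P' W`, then `X` lies in `Lie P' + Lie W`. -/
theorem pr_mem_lieAlgebra (hw : IsWeighted gr P W) {P' W' : Subgroup (GL (Fin n) ℂ)}
    (hw' : IsWeighted gr P' W') (hP' : P' ≤ P) {X : Mat n}
    (h : ∀ t : ℂ, expGL (t • X) ∈ P' ⊔ W) : gr.pr X ∈ lieAlgebra P' := by
  refine mem_lieAlgebra_of_expGL fun t => ?_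
  have hX : X ∈ lieAlgebra P := mem_lieAlgebra_of_expGL fun t =>
    ((hw.mem_sup_iff hw' hP').1 (h t)).1
  obtain ⟨hg, hgL⟩ := (hw.mem_sup_iff hw' hP').1 (h t)
  have h1 := hw'.levi_le hgL
  convert h1 using 1
  refine Units.ext ?_
  rw [coe_prHom, coe_expGL, coe_expGL, gr.pr_exp (hw.isPar_lie ((lieAlgebra P).smul_mem _ hX)),
    _root_.map_smul]

end IsWeighted

end Kuga
end

/-! ### Comparison of two rigid special subgroups -/

open Matrix
noncomputable section
namespace Kuga
open scoped Matrix.Norms.Operator Topology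
open NormedSpace Filter

theorem derivedLie_le_derivedGroup {n : ℕ} {P L : Subgroup (GL (Fin n) ℂ)}
    (hP : IsZariskiClosed ℂ (P : Set (GL (Fin n) ℂ))) (hL : L ≤ P) :
    derivedLie (lieAlgebra L) ≤ lieAlgebra (derivedGroup P) := by
  refine Submodule.span_le.2 ?_
  rintro _ ⟨X, hX, Y, hY, rfl⟩
  exact bracket_mem_lieAlgebra_of_commutator hP (commutator_le_derivedGroup P)
    (lieAlgebra_mono hL hX) (lieAlgebra_mono hL hY)

/-- A `ρ`-rigid subgroup is contained in every subgroup which has the same derived Lie algebra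
and the same connected center of the image in `G`. -/
theorem le_of_lieAlgebra_derivedGroup_eq {n : ℕ} {P W G P₁ W₁ P₂ W₂ : Subgroup (GL (Fin n) ℂ)}
    {gr₁ gr₂ : Grading n} (hw₁ : IsWeighted gr₁ P W) (hw₂ : IsWeighted gr₂ P W)
    (hv₁ : IsWeighted gr₁ P₁ W₁) (hv₂ : IsWeighted gr₂ P₂ W₂) (hP₁ : P₁ ≤ P) (hP₂ : P₂ ≤ P)
    (hQ₁ : IsQGroup P₁) (hQ₂ : IsQGroup P₂) (hWQ : IsQGroup W) (hG : IsLevi P W G)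
    (hrig : IsRhoRigid W (leviProjection W G P₁))
    {E : Type*} [NormedAddCommGroup E] [InnerProductSpace ℝ E] [FiniteDimensional ℝ E]
    (κ : CompactForm (lieAlgebra hv₁.levi) E)
    (hcc : connectedCenter (leviProjection W G P₁) = connectedCenter (leviProjection W G P₂))
    (hder : lieAlgebra (derivedGroup P₁) = lieAlgebra (derivedGroup P₂)) : P₁ ≤ P₂ := by
  have hWW : lieAlgebra W₁ = lieAlgebra W₂ := Submodule.ext fun X => by
    rw [hw₁.mem_lieW_iff_derivedGroup hv₁ hP₁ hQ₁, hw₂.mem_lieW_iff_derivedGroup hv₂ hP₂ hQ₂, hder]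
  have hder₂ : lieAlgebra (derivedGroup P₁) ≤ lieAlgebra P₂ := by
    rw [hder]
    exact lieAlgebra_mono (derivedGroup_le hQ₂)
  have hk : derivedLie (lieAlgebra hv₁.levi) ≤ lieAlgebra (derivedGroup P₁) :=
    derivedLie_le_derivedGroup hv₁.closed hv₁.levi_le
  have hkP₁ : derivedLie (lieAlgebra hv₁.levi) ≤ lieAlgebra P₁ :=
    hk.trans (lieAlgebra_mono (derivedGroup_le hQ₁))
  have hcentral : ∀ Z ∈ lieAlgebra hv₁.levi, (∀ Y ∈ lieAlgebra hv₁.levi, Z * Y = Y * Z) →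
      Z ∈ lieAlgebra P₂ := by
    intro Z hZ hZc
    have hZP : Z ∈ lieAlgebra P := lieAlgebra_mono (hv₁.levi_le.trans hP₁) hZ
    have hsup : ∀ t : ℂ, expGL (t • Z) ∈ P₂ ⊔ W := by
      intro t
      obtain ⟨a, ha, haW⟩ := hw₁.exists_mem_connectedCenter hv₁ hP₁ hG
        (Submodule.smul_mem _ t hZ) fun Y hY => by
          rw [Matrix.smul_mul, Matrix.mul_smul, hZc Y hY]
      rw [hcc] at ha
      -- The common connected center puts `a` into the image of `P₂` in `G`, hence into `P₂ W`.
      have h1 := connectedCenter_le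
        ((hw₂.isZariskiClosed_sup hv₂ hP₂).inter hG.1.isClosed) ha
      have h2 := Subgroup.mul_mem _ (Subgroup.mem_sup_right (S := P₂) haW) h1.1
      rwa [inv_mul_cancel_right] at h2
    have hX₂ := hw₂.pr_mem_lieAlgebra hv₂ hP₂ hsup
    have hu := hw₂.sub_pr_mem Z hZP
    -- This is where rigidity enters: the derived algebra of `Lie L₁` moves this element of `Lie W`
    -- into `Lie W₁` and has no invariants in `Lie W`.
    have hu₁ : Z - gr₂.pr Z ∈ lieAlgebra W₁ := by
      refine κ.mem_of_forall_bracket_mem (M := lieAlgebra W) (N := lieAlgebra W₁)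
        (fun X hX Y hY => hw₁.bracket_mem_lieW (lieAlgebra_mono hP₁ (hkP₁ hX)) hY)
        (fun X hX Y hY => hv₁.bracket_mem_lieW (hkP₁ hX) hY)
        (fun Y hY h => hw₁.eq_zero_of_comm_derivedLie hv₁ hP₁ hWQ hQ₁ hG.1 hrig hY h) hu
        fun X hX => ?_
      refine (hw₁.mem_lieW_iff_derivedGroup hv₁ hP₁ hQ₁).2
        ⟨?_, hw₁.bracket_mem_lieW (lieAlgebra_mono hP₁ (hkP₁ hX)) hu⟩
      have hXZ : X * Z - Z * X = 0 := by
        have h1 : derivedLie (lieAlgebra hv₁.levi) ≤ lieAlgebra hv₁.levi := by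
          refine Submodule.span_le.2 ?_
          rintro _ ⟨A, hA, B, hB, rfl⟩
          exact bracket_mem_lieAlgebra hv₁.isZariskiClosed_levi hA hB
        rw [hZc X (h1 hX), sub_self]
      have h2 : X * (Z - gr₂.pr Z) - (Z - gr₂.pr Z) * X =
          -(X * gr₂.pr Z - gr₂.pr Z * X) := by
        rw [mul_sub, sub_mul, sub_sub_sub_comm, hXZ, zero_sub]
      rw [h2, hder]
      exact Submodule.neg_mem _ (bracket_mem_lieAlgebra_of_commutator hv₂.closed
        (commutator_le_derivedGroup P₂) (hder₂ (hk hX)) hX₂)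
    rw [hWW] at hu₁
    have h3 := Submodule.add_mem _ (lieAlgebra_mono hv₂.le hu₁) hX₂
    rwa [sub_add_cancel] at h3
  -- An element of `Lie P₁` splits into a part in `Lie W₁`, a part in the derived algebra of `Lie
  -- L₁` and a central part of `Lie L₁`; all three lie in `Lie P₂`.
  refine le_of_expGL_mem hv₁.closed hv₁.connected hv₂.closed fun X hX => expGL_mem hv₂.closed ?_
  have h1 := hv₁.sub_pr_mem X hX
  rw [hWW] at h1
  obtain ⟨Z, hZ, hZc, hXZ⟩ := κ.exists_central_add
    (hv₁.mem_lie_levi_iff.2 ⟨hv₁.pr_mem_lie hX, gr₁.pr_pr X⟩)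
  have h2 := Submodule.add_mem _ (Submodule.add_mem _ (lieAlgebra_mono hv₂.le h1) (hder₂ (hk hXZ)))
    (hcentral Z hZ hZc)
  rwa [sub_add_sub_cancel, sub_add_cancel] at h2

/-- Arbitrary points of `Y₁` and `Y₂` supply the two gradings. Since the maps to `Y` are compatible
with `h`, each of them grades the ambient group as well. -/
theorem le_of_latticeSubspace_eq {n : ℕ} {D D₁ D₂ : KugaDatum n} {G : Subgroup (GL (Fin n) ℂ)}
    (hG : IsLevi D.P D.W G) (h₁ : IsSubdatum D₁ D) (h₂ : IsSubdatum D₂ D)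
    (hcc : connectedCenter (leviProjection D.W G D₁.P) =
      connectedCenter (leviProjection D.W G D₂.P))
    (hrig : IsRhoRigid D.W (leviProjection D.W G D₁.P)) {Γ : Subgroup (GL (Fin n) ℚ)}
    (h : latticeSubspace D.P Γ D₁.P = latticeSubspace D.P Γ D₂.P) : D₁.P ≤ D₂.P := by
  obtain ⟨hP₁, f₁, -, -, hf₁⟩ := h₁
  obtain ⟨hP₂, f₂, -, -, hf₂⟩ := h₂
  obtain ⟨y₁⟩ := D₁.nonempty
  obtain ⟨y₂⟩ := D₂.nonempty
  obtain ⟨gr₁, hgr₁⟩ := exists_grading (D₁.real y₁).1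
  obtain ⟨gr₂, hgr₂⟩ := exists_grading (D₂.real y₂).1
  have hv₁ := D₁.isWeighted y₁ hgr₁
  have hw₁ := D.isWeighted (f₁ y₁) (gr := gr₁) (by rw [hf₁]; exact hgr₁)
  have hw₂ := D.isWeighted (f₂ y₂) (gr := gr₂) (by rw [hf₂]; exact hgr₂)
  obtain ⟨d, k, ⟨κ⟩⟩ := D₁.exists_compactForm y₁ hgr₁ hv₁
  exact le_of_lieAlgebra_derivedGroup_eq hw₁ hw₂ hv₁ (D₂.isWeighted y₂ hgr₂) hP₁ hP₂ D₁.isQGroup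
    D₂.isQGroup D.isUnipotentRadical.1.1 hG hrig κ hcc
    (le_antisymm (lieAlgebra_derivedGroup_le hP₁ h) (lieAlgebra_derivedGroup_le hP₂ h.symm))

end Kuga
end

theorem mainTheorem3 {n : ℕ} (D : Kuga.KugaDatum n) (G : Subgroup (GL (Fin n) ℂ))
    (hG : Kuga.IsLevi D.P D.W G) (C : Subgroup (GL (Fin n) ℂ)) (hC : Kuga.IsQTorus C)
    (hCG : C ≤ G) (Γ : Subgroup (GL (Fin n) ℚ)) (hΓ : Kuga.IsCongruenceSubgroup D.P Γ) :
    Set.InjOn (Kuga.latticeSubspace D.P Γ) (Kuga.rigidSpecialSubgroups D G C) := by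
  rintro _ ⟨D₁, h₁, rfl, hC₁, hr₁⟩ _ ⟨D₂, h₂, rfl, hC₂, hr₂⟩ h
  exact le_antisymm (Kuga.le_of_latticeSubspace_eq hG h₁ h₂ (hC₁.trans hC₂.symm) hr₁ h)
    (Kuga.le_of_latticeSubspace_eq hG h₂ h₁ (hC₂.trans hC₁.symm) hr₂ h.symm)
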